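/- **Setting.** Let $T>0$, $\gamma\in(0,1]$, $N_\gamma:=\lfloor\gamma^{-1}\rfloor$. Words are taken over the alphabet $\{1,\dots,d\}$, $|w|$ is the length of $w$ and $\varepsilon$ the empty word; $H_N$ is the step-$N$ truncated tensor algebra over $\mathbb R^d$ with basis $(e_w)_{|w|\le N}$ and dual basis $(e_w^*)$, $\sqcup\!\sqcup $ is the shuffle product, and $\langle g\star h,e_w\rangle=\sum_{uv=w}\langle g,e_u\rangle\langle h,e_v\rangle$. Let $G^{(N)}\subset H_N^*$ be the group (under $\star$) of step-$N$ truncated characters $g$ ($\langle g,e_\varepsilon\rangle=1$ and $\langle g,e_u\sqcup\!\sqcup e_v\rangle=\langle g,e_u\rangle\langle g,e_v\rangle$ for $|u|+|v|\le N$), with the metric $d_N(g,h)=\|h^{-1}\star g\|_N$ of the sub-additive homogeneous norm $\|g\|_N=\max_{1\le|w|\le N}(|w|!\,|\langle g,e_w\rangle|)^{1/|w|}$. Let $\mathbf W$ be a geometric rough path of regularity $\gamma$, i.e. a $\gamma$-Hölder path $[0,T]\to(G^{(N_\gamma)},d_{N_\gamma})$, and put $\mathbf W_{st}=\mathbf W_s^{-1}\star\mathbf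 W_t$. We write $a_{st}\underset{\beta}{=}b_{st}$ if there is $C$ with $|a_{st}-b_{st}|\le C|t-s|^\beta$ for all $0\le s<t\le T$. For $1\le M\le N_\gamma+1$ a path $\mathbf X:[0,T]\to(H_{M-1})^n$ belongs to $(\mathscr D^{M\gamma}_{\mathbf W})^n$ if for every $|w|\le M-1$ the path $t\mapsto\langle e_w^*,\mathbf X_t\rangle$ is $\gamma$-Hölder and $\langle e_w^*,\mathbf X_t\rangle\underset{(M-|w|)\gamma}{=}\langle\mathbf W_{st}\star e_w^*,\mathbf X_s\rangle$; it lies above $X_t=\langle e_\varepsilon^*,\mathbf X_t\rangle$. For smooth enough $\phi$, the lift $\Phi(\mathbf X)$ of $\phi(X)$ has coefficients $\phi(X_t)$ at $\varepsilon$ and $$\langle e_w^*,\Phi(\mathbf X)_t\rangle=\sum_{k=1}^{|w|}\frac1{k!}\sum_{u_1,\dots,u_k\ne\varepsilon}\langle e_w^*,e_{u_1}\sqcup\!\sqcup \cdots\sqcup\!\sqcup e_{u_k}\rangle\,D^k\phi(X_t)(\langle e_{u_1}^*,\mathbf X_t\rangle,\dots,\langle e_{u_k}^*,\mathbf X_t\rangle)\qquad(w\neq\varepsilon).$$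 The integral $\int_0^t\mathbf Y_u\,d\mathbf W^i_u\in (H_{N_\gamma})^n$ has at $\varepsilon$ the coefficient $\lim_{|\pi|\to0}\sum_{[a,b]\in\pi}\sum_{|w|\le N_\gamma-1}\langle e_w^*,\mathbf Y_a\rangle\langle\mathbf W_{ab},e_{wi}\rangle$ ($\pi$ ranging over the partitions of $[0,t]$), at $wi$ the coefficient $\langle e_w^*,\mathbf Y_t\rangle$ for $|w|\le N_\gamma-1$, and zero elsewhere. Let $f_1,\dots,f_d:\mathbb R^n\to\mathbb R^n$ be of class $\mathcal C^{N_\gamma}$, let $\mathbf F_i(\mathbf X)$ be the lift of $f_i(X)$, and let $x\in\mathbb R^n$. For $M\in\{N_\gamma,N_\gamma+1\}$ an *$M$-lifted solution* is a path $\mathbf X\in(\mathscr D^{M\gamma}_{\mathbf W})^n$ with $$\mathbf X_t=x\,\mathbf 1+\sum_{i=1}^d\int_0^t\mathbf F_i(\mathbf X)_u\,d\mathbf W^i_u\quad\text{in }(H_{M-1})^n,\qquad t\in[0,T],$$ where the integrals exist. A path $X:[0,T]\to\mathbb R^n$ is a *solution* of $dX_t=\sum_i f_i(X_t)\,d\mathbf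 W^i_t$, $X_0=x$, if there is an $N_\gamma$-lifted solution above $X$. Define $F_w:\mathbb R^n\to\mathbb R^n$ for $|w|\le N_\gamma$ by $F_\varepsilon=\mathrm{id}$ and $F_{iw}(x)=DF_w(x)f_i(x)$. **Proposition (Davie's expansion).** 1. A path $X:[0,T]\to\mathbb R^n$ is a solution if and only if $X_0=x$ and $$X_t\underset{(N_\gamma+1)\gamma}{=}\sum_{0\le|w|\le N_\gamma}F_w(X_s)\langle\mathbf W_{st},e_w\rangle.\tag{$*$}$$ 2. For $M\in\{N_\gamma,N_\gamma+1\}$, a path $\mathbf X:[0,T]\to(H_{M-1})^n$ above a path $X$ is an $M$-lifted solution if and only if $X_0=x$, $X$ satisfies $(*)$, and $\langle e_w^*,\mathbf X_t\rangle=F_w(X_t)$ for all $t\in[0,T]$ and $|w|\le M-1$. 3. If moreover $f_1,\dots,f_d\in\mathcal C^{N_\gamma+1}_b$, then $X$ is the unique solution (that is, $X$ is a solution and every solution with $X_0=x$ equals $X$ on $[0,T]$) if and only if $X_0=x$ and $(*)$ holds. -/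

import Mathlib

namespace RoughPath

/-! ### Words, shuffles, and the truncated shuffle Hopf algebra in coordinates -/

/-- Words over the alphabet with `d` letters; the empty word is `[]`. -/
abbrev Word (d : ℕ) : Type := List (Fin d)

/-- All words of length at most `N`. -/
def words (d N : ℕ) : Finset (Word d) :=
  (Finset.range (N + 1)).biUnion fun p =>
    (Finset.univ : Finset (Fin p → Fin d)).image List.ofFn

theorem mem_words {d N : ℕ} {w : Word d} : w ∈ words d N ↔ w.length ≤ N := by
  simp only [words, Finset.mem_biUnion, Finset.mem_range, Finset.mem_image, Finset.mem_univ,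
    true_and]
  constructor
  · rintro ⟨p, hp, f, rfl⟩
    simp only [List.length_ofFn]
    omega
  · intro h
    exact ⟨w.length, by omega, w.get, List.ofFn_get w⟩

/-- All non-empty words of length at most `N`. -/
def nonemptyWords (d N : ℕ) : Finset (Word d) := (words d N).filter fun w => w ≠ []

/-- The shuffle product `e_u ⧢ e_v` of two basis elements, as the multiset of the words
occurring in it. -/
def shuffle {d : ℕ} : Word d → Word d → Multiset (Word d)
  | [], v => {v}
  | u, [] => {u}
  | a :: u, b :: v =>
      (shuffle u (b :: v)).map (List.cons a) + (shuffle (a :: u) v).map (List.cons b)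
  termination_by u v => u.length + v.length

/-- The iterated shuffle product `e_{u₁} ⧢ ⋯ ⧢ e_{u_k}` (the unit, `{[]}`, for `k = 0`). -/
def iterShuffle {d : ℕ} : List (Word d) → Multiset (Word d)
  | [] => {[]}
  | u :: us => (iterShuffle us).bind (shuffle u)

/-- The coefficient `⟨e_w^*, e_{u₁} ⧢ ⋯ ⧢ e_{u_k}⟩`. -/
def shuffleCoeff {d k : ℕ} (u : Fin k → Word d) (w : Word d) : ℕ :=
  (iterShuffle (List.ofFn u)).count w

/-! A linear functional `g` on the tensor algebra over `ℝ^d`, or on its truncation `H_N`, is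
represented by its values `g w = ⟨g, e_w⟩` on the basis of words. For a functional on `H_N` only
the values on words of length at most `N` are meaningful, and only these are ever used. In the
same way an element of `(H_N)^n` is represented by its coefficients `x w = ⟨e_w^*, x⟩ ∈ ℝ^n`. -/

/-- The convolution product, `⟨g ⋆ h, e_w⟩ = ∑_{uv = w} ⟨g, e_u⟩ ⟨h, e_v⟩`. -/
def conv {d : ℕ} (g h : Word d → ℝ) (w : Word d) : ℝ :=
  ∑ p ∈ Finset.range (w.length + 1), g (w.take p) * h (w.drop p)

/-- The dual basis element `e_w^*`. -/
def dualBasis {d : ℕ} (w : Word d) : Word d → ℝ := Pi.single w 1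

/-- The inverse `g⁻¹ = g ∘ S` of a character, where `S e_{i₁⋯i_p} = (-1)^p e_{i_p⋯i₁}`. -/
def charInv {d : ℕ} (g : Word d → ℝ) (w : Word d) : ℝ := (-1) ^ w.length * g w.reverse

/-- The duality pairing `⟨g, x⟩` of a functional on `H_N` and an element of `(H_N)^n`. -/
def pairing {d : ℕ} {E : Type*} [AddCommGroup E] [Module ℝ E]
    (N : ℕ) (g : Word d → ℝ) (x : Word d → E) : E :=
  ∑ w ∈ words d N, g w • x w

/-- `g` is a (unital) step-`N` truncated character, i.e. an element of the group `G^{(N)}`. -/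
structure IsTruncatedCharacter {d : ℕ} (N : ℕ) (g : Word d → ℝ) : Prop where
  map_one : g [] = 1
  map_shuffle : ∀ u v : Word d, u.length + v.length ≤ N →
    ((shuffle u v).map g).sum = g u * g v

/-- The sub-additive homogeneous norm `max_{1 ≤ |w| ≤ N} (|w|! |⟨g, e_w⟩|)^{1/|w|}`
on `G^{(N)}`. -/
noncomputable def homNorm {d : ℕ} (N : ℕ) (g : Word d → ℝ) : NNReal :=
  (nonemptyWords d N).sup fun w =>
    ((w.length.factorial : NNReal) * ‖g w‖₊) ^ (1 / (w.length : ℝ))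

/-- The left invariant metric `d_N(g, h) = ‖h⁻¹ ⋆ g‖_N` on `G^{(N)}`. -/
noncomputable def homDist {d : ℕ} (N : ℕ) (g h : Word d → ℝ) : ℝ :=
  homNorm N (conv (charInv h) g)

/-! ### Rough paths -/

/-- `N_γ = ⌊1/γ⌋`. -/
noncomputable def level (γ : ℝ) : ℕ := ⌊γ⁻¹⌋₊

/-- A (weakly) geometric rough path of regularity `γ`: a `γ`-Hölder path
`[0, T] → (G^{(N_γ)}, d_{N_γ})`. -/
structure IsGeometricRoughPath {d : ℕ} (T γ : ℝ) (W : ℝ → Word d → ℝ) : Prop where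
  character : ∀ t ∈ Set.Icc 0 T, IsTruncatedCharacter (level γ) (W t)
  holder : ∃ C : ℝ, ∀ s ∈ Set.Icc 0 T, ∀ t ∈ Set.Icc 0 T,
    homDist (level γ) (W s) (W t) ≤ C * |t - s| ^ γ

/-- The increment `W_{st} = W_s⁻¹ ⋆ W_t`. -/
def increment {d : ℕ} (W : ℝ → Word d → ℝ) (s t : ℝ) : Word d → ℝ :=
  conv (charInv (W s)) (W t)

/-- `a_{st} = b_{st}` up to an error of order `β`: `|a_{st} - b_{st}| ≤ C |t - s|^β` for all
`0 ≤ s < t ≤ T`, with `C` independent of `s, t`. -/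
def EqUpTo {E : Type*} [NormedAddCommGroup E] (T β : ℝ) (a b : ℝ → ℝ → E) : Prop :=
  ∃ C : ℝ, ∀ s t : ℝ, 0 ≤ s → s < t → t ≤ T → ‖a s t - b s t‖ ≤ C * |t - s| ^ β

/-- The path `t ↦ Z t` with values in `(H_{M-1})^n` is controlled by `W`, i.e. it belongs to
`(𝒟_W^{Mγ})^n`: for `|w| ≤ M - 1` its coefficients are `γ`-Hölder on `[0, T]` and
`⟨e_w^*, Z_t⟩ = ⟨W_{st} ⋆ e_w^*, Z_s⟩` up to an error of order `(M - |w|)γ`. -/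
def IsControlled {d : ℕ} {E : Type*} [NormedAddCommGroup E] [NormedSpace ℝ E]
    (T γ : ℝ) (W : ℝ → Word d → ℝ) (M : ℕ) (Z : ℝ → Word d → E) : Prop :=
  ∀ w : Word d, w.length < M →
    (∃ C : NNReal, HolderOnWith C γ.toNNReal (fun t => Z t w) (Set.Icc 0 T)) ∧
    EqUpTo T (((M : ℝ) - w.length) * γ) (fun _ t => Z t w)
      (fun s t => pairing (M - 1) (conv (increment W s t) (dualBasis w)) (Z s))

/-- The lift `Φ(Z)` of the composition `φ(X)` of a function `φ` with a controlled path `Z` above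
`X`: the coefficient at `[]` is `φ(X_t)`, and the one at a non-empty word `w` is
`∑_{k=1}^{|w|} 1/k! ∑_{u₁,…,u_k} ⟨e_w^*, e_{u₁} ⧢ ⋯ ⧢ e_{u_k}⟩ D^kφ(X_t)(Z_t^{u₁}, …, Z_t^{u_k})`,
the inner sum being over non-empty words. -/
noncomputable def compLift {d : ℕ} {E F : Type*} [NormedAddCommGroup E] [NormedSpace ℝ E]
    [NormedAddCommGroup F] [NormedSpace ℝ F]
    (φ : E → F) (Z : ℝ → Word d → E) (t : ℝ) (w : Word d) : F :=
  if w = [] then φ (Z t [])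
  else ∑ k ∈ Finset.Icc 1 w.length, ((k.factorial : ℝ)⁻¹) •
    ∑ u ∈ Fintype.piFinset (fun _ : Fin k => nonemptyWords d w.length),
      (shuffleCoeff u w : ℝ) • iteratedFDeriv ℝ k φ (Z t []) (fun j => Z t (u j))

/-- `I` is the limit, as the mesh of the partition `0 = τ₀ < τ₁ < ⋯ < τ_m = t` tends to zero, of
the compensated Riemann sums `∑_{[a,b]} ∑_{|w| ≤ N_γ - 1} ⟨e_w^*, Y_a⟩ ⟨W_{ab}, e_{wi}⟩`. -/
def IsRoughIntegral {d : ℕ} {E : Type*} [NormedAddCommGroup E] [NormedSpace ℝ E]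
    (γ : ℝ) (W : ℝ → Word d → ℝ) (i : Fin d) (Y : ℝ → Word d → E) (t : ℝ) (I : E) : Prop :=
  ∀ ε > 0, ∃ δ > 0, ∀ (m : ℕ) (τ : Fin (m + 1) → ℝ),
    StrictMono τ → τ 0 = 0 → τ (Fin.last m) = t →
    (∀ j : Fin m, τ j.succ - τ j.castSucc < δ) →
    ‖(∑ j : Fin m, ∑ w ∈ words d (level γ - 1),
        increment W (τ j.castSucc) (τ j.succ) (w ++ [i]) • Y (τ j.castSucc) w) - I‖ < ε

/-- `J t = ∫_0^t Y dW^i` for `t ∈ [0, T]`, as a path with values in `(H_{N_γ})^n`: the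
coefficient at `[]` is the rough integral, the one at `wi` is `⟨e_w^*, Y_t⟩`, and all
others are zero. -/
def IsRoughIntegralLift {d : ℕ} {E : Type*} [NormedAddCommGroup E] [NormedSpace ℝ E]
    (T γ : ℝ) (W : ℝ → Word d → ℝ) (i : Fin d) (Y J : ℝ → Word d → E) : Prop :=
  ∀ t ∈ Set.Icc 0 T,
    IsRoughIntegral γ W i Y t (J t []) ∧
    ∀ w : Word d, w.length < level γ →
      J t (w ++ [i]) = Y t w ∧ ∀ j : Fin d, j ≠ i → J t (w ++ [j]) = 0

/-! ### Rough differential equations -/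

/-- The path `Z` in `(𝒟_W^{Mγ})^n` solves `Z_t = x 𝟏 + ∑_i ∫_0^t F_i(Z)_u dW^i_u`, for all
`t ∈ [0, T]`, as an identity in `(H_{M-1})^n`; here `F_i(Z)` is the lift of `f_i(X)`. -/
def IsRDELift {d : ℕ} {E : Type*} [NormedAddCommGroup E] [NormedSpace ℝ E]
    (T γ : ℝ) (W : ℝ → Word d → ℝ) (f : Fin d → E → E) (M : ℕ) (x : E)
    (Z : ℝ → Word d → E) : Prop :=
  IsControlled T γ W M Z ∧
  ∃ J : Fin d → ℝ → Word d → E,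
    (∀ i, IsRoughIntegralLift T γ W i (compLift (f i) Z) (J i)) ∧
    ∀ t ∈ Set.Icc 0 T, ∀ w : Word d, w.length < M →
      Z t w = (if w = [] then x else 0) + ∑ i, J i t w

/-- `X : [0, T] → E` solves `dX = ∑_i f_i(X) dW^i`, `X_0 = x`: there is a controlled path `Z`
in `(𝒟_W^{N_γ γ})^n` above `X` that solves the lifted equation. -/
def IsRDESolution {d : ℕ} {E : Type*} [NormedAddCommGroup E] [NormedSpace ℝ E]
    (T γ : ℝ) (W : ℝ → Word d → ℝ) (f : Fin d → E → E) (x : E) (X : ℝ → E) : Prop :=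
  ∃ Z : ℝ → Word d → E, (∀ t ∈ Set.Icc 0 T, Z t [] = X t) ∧
    IsRDELift T γ W f (level γ) x Z

/-- The functions `F_w`: `F_ε = id` and `F_{iw}(x) = DF_w(x) f_i(x)`. -/
noncomputable def wordField {d : ℕ} {E : Type*} [NormedAddCommGroup E] [NormedSpace ℝ E]
    (f : Fin d → E → E) : Word d → E → E
  | [] => id
  | i :: w => fun x => fderiv ℝ (wordField f w) x (f i x)

/-- The expansion `X_t = ∑_{|w| ≤ N_γ} F_w(X_s) ⟨W_{st}, e_w⟩` up to an error of order
`(N_γ + 1)γ`. -/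
def HasDavieExpansion {d : ℕ} {E : Type*} [NormedAddCommGroup E] [NormedSpace ℝ E]
    (T γ : ℝ) (W : ℝ → Word d → ℝ) (f : Fin d → E → E) (X : ℝ → E) : Prop :=
  EqUpTo T (((level γ : ℝ) + 1) * γ) (fun _ t => X t)
    (fun s t => pairing (level γ) (increment W s t) (fun w => wordField f w (X s)))

/-- `g` is of class `C^k_b`: it is `C^k`, and it and its derivatives up to order `k` are
bounded. -/
def IsCkBounded {E F : Type*} [NormedAddCommGroup E] [NormedSpace ℝ E]
    [NormedAddCommGroup F] [NormedSpace ℝ F] (k : ℕ) (g : E → F) : Prop :=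
  ContDiff ℝ k g ∧ ∀ j ≤ k, ∃ C : ℝ, ∀ x, ‖iteratedFDeriv ℝ j g x‖ ≤ C

end RoughPath

namespace RoughPath

/-! ### Shuffle combinatorics: removing first letters -/

section Shuffle

variable {d : ℕ}

/-! Write `N` for `N_γ` and `θ = (N+1)γ`, so that `θ > 1`. The coefficients of a lifted solution are
forced: at the word `wi` the lifted equation reads off the `w`-coefficient of the lift of `f_i(X)`.
Since `F_{wi}` is the iterated Lie derivative of `f_i` along `w`, induction on the length reduces
everything to one algebraic fact (`compLift_eq_lieD`): along coefficients `F_u(X)`, the lift of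
`φ(X)` has the Lie derivatives of `φ` as coefficients. This is a Faà di Bruno formula in shuffle
form (`lieD_eq_shuffleSum`). Differentiating `D^kφ(F_{u₁},…,F_{u_k})` along `f_i` either adds a new
argument `F_i` or prepends `i` to one `u_j`, which is dual to how removing a first letter acts on
shuffle products.

On the analytic side, a character turns products of coefficients into sums over shuffles. Taylor's
formula together with Faà di Bruno therefore compares `F_w` at the truncated expansion of `X` with
the Lie derivatives of `F_w` (`exists_norm_sub_sum_lieD_le`). Hence an expansion of `X` with error
of order `Nγ` already yields expansions of all `F_w(X)`, `w ≠ ε`, with error of order `(N+1-|w|)γ`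
(`exists_remainder_bound`). By Chen's relation the germs of the rough integrals are then additive up
to order `θ`, and sewing produces functions `I_i` whose increments equal the germs up to order `θ`.

If `M = N`, a lifted solution has a priori only the expansion of order `Nγ`. But `X_t - X_s` is the
sum of the increments of the `I_i`, which improves the order to `θ`. If `M = N+1`, controlledness at
`ε` is already Davie's expansion. Conversely, Davie's expansion says that `X - ∑ I_i` has increments
of order `θ > 1`, so this difference is constant; the expansions of the `F_w(X)` are the
controlledness conditions.

For uniqueness let `e` be the difference of the remainders of two solutions with equal initial
value. On a short interval, a bound `|e_{st}| ≤ q|t-s|^θ` controls the difference of the paths by a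
small multiple of `q`, hence also the additivity defect of `e`; bisecting `[s,t]` then improves `q`
by a fixed factor below 1, and iteration gives `e = 0`. The defect estimate needs remainders that
are Lipschitz in the starting point. They come from the one-step expansion for the linearized fields
`(x,v) ↦ (f_i(x), Df_i(x)v)`, at the price of one more derivative of the `f_i`. -/

@[simp] theorem shuffle_nil_left (v : Word d) : shuffle [] v = {v} := by
  rw [shuffle]

@[simp] theorem shuffle_nil_right (u : Word d) : shuffle u [] = {u} := by
  cases u <;> simp [shuffle]

theorem shuffle_cons_cons (a b : Fin d) (u v : Word d) :
    shuffle (a :: u) (b :: v) =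
      (shuffle u (b :: v)).map (List.cons a) + (shuffle (a :: u) v).map (List.cons b) := by
  rw [shuffle]

theorem length_of_mem_shuffle {u v w : Word d} (h : w ∈ shuffle u v) :
    w.length = u.length + v.length := by
  induction u generalizing v w with
  | nil => simp_all
  | cons a u ihu =>
    induction v generalizing w with
    | nil => simp_all
    | cons b v ihv =>
      rw [shuffle_cons_cons, Multiset.mem_add, Multiset.mem_map, Multiset.mem_map] at h
      rcases h with ⟨z, hz, rfl⟩ | ⟨z, hz, rfl⟩
      · have := ihu hz
        simp only [List.length_cons] at this ⊢; omega
      · have := ihv hz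
        simp only [List.length_cons] at this ⊢; omega

theorem length_of_mem_iterShuffle {k : ℕ} {u : Fin k → Word d} {w : Word d}
    (h : w ∈ iterShuffle (List.ofFn u)) : w.length = ∑ j, (u j).length := by
  induction k generalizing w with
  | zero => simp_all [iterShuffle]
  | succ k ih =>
    rw [List.ofFn_succ, iterShuffle, Multiset.mem_bind] at h
    obtain ⟨z, hz, hw⟩ := h
    rw [length_of_mem_shuffle hw, ih hz, Fin.sum_univ_succ]

theorem shuffleCoeff_eq_zero {k : ℕ} {u : Fin k → Word d} {w : Word d}
    (h : ∑ j, (u j).length ≠ w.length) : shuffleCoeff u w = 0 :=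
  Multiset.count_eq_zero.2 fun hw => h (length_of_mem_iterShuffle hw).symm

theorem le_sum_length {k : ℕ} {u : Fin k → Word d} (hu : ∀ j, u j ≠ []) :
    k ≤ ∑ j, (u j).length := by
  have := Finset.sum_le_sum (s := Finset.univ) (f := fun _ : Fin k => 1)
    (g := fun j => (u j).length) fun j _ => List.length_pos_iff.2 (hu j)
  simpa using this

/-- The words `w` such that `i :: w` occurs in `M`, with multiplicity. -/
def leftDeriv (i : Fin d) (M : Multiset (Word d)) : Multiset (Word d) :=
  M.bind fun w => if w = i :: w.tail then {w.tail} else 0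

theorem leftDeriv_add (i : Fin d) (M M' : Multiset (Word d)) :
    leftDeriv i (M + M') = leftDeriv i M + leftDeriv i M' := by
  simp [leftDeriv]

theorem leftDeriv_singleton (i : Fin d) (w : Word d) :
    leftDeriv i {w} = if w = i :: w.tail then {w.tail} else 0 := by
  simp [leftDeriv]

theorem leftDeriv_map_cons (i a : Fin d) (M : Multiset (Word d)) :
    leftDeriv i (M.map (List.cons a)) = if a = i then M else 0 := by
  induction M using Multiset.induction_on with
  | empty => simp [leftDeriv]
  | cons z M ih =>
    rw [Multiset.map_cons, ← Multiset.singleton_add, leftDeriv_add, ih, leftDeriv_singleton]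
    by_cases h : a = i <;> simp [h]

theorem leftDeriv_bind (i : Fin d) (M : Multiset (Word d)) (f : Word d → Multiset (Word d)) :
    leftDeriv i (M.bind f) = M.bind fun w => leftDeriv i (f w) := by
  simp [leftDeriv, Multiset.bind_assoc]

theorem count_leftDeriv (i : Fin d) (M : Multiset (Word d)) (w : Word d) :
    (leftDeriv i M).count w = M.count (i :: w) := by
  induction M using Multiset.induction_on with
  | empty => simp [leftDeriv]
  | cons z M ih =>
    rw [← Multiset.singleton_add, leftDeriv_add, Multiset.count_add, ih, Multiset.count_add,
      leftDeriv_singleton]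
    congr 1
    cases z with
    | nil => simp
    | cons b z =>
      by_cases h : b = i
      · subst h; simp [Multiset.count_singleton]
      · have : ¬ (i = b) := fun h' => h h'.symm
        simp [h, this]

/-- The first letter of a shuffle is the first letter of one of the two factors, so removing it is a
derivation. The test `u = i :: u.tail` fails for the empty word and otherwise says that `u` begins
with `i`. -/
theorem leftDeriv_shuffle (i : Fin d) (u v : Word d) :
    leftDeriv i (shuffle u v) =
      (if u = i :: u.tail then shuffle u.tail v else 0) +
      (if v = i :: v.tail then shuffle u v.tail else 0) := by
  cases u with
  | nil => simp [leftDeriv_singleton]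
  | cons a u =>
    cases v with
    | nil => simp [leftDeriv_singleton]
    | cons b v =>
      rw [shuffle_cons_cons, leftDeriv_add, leftDeriv_map_cons, leftDeriv_map_cons]
      simp

theorem leftDeriv_iterShuffle (i : Fin d) {k : ℕ} (u : Fin k → Word d) :
    leftDeriv i (iterShuffle (List.ofFn u)) =
      ∑ j, if u j = i :: (u j).tail then
        iterShuffle (List.ofFn (Function.update u j (u j).tail)) else 0 := by
  induction k with
  | zero => simp [iterShuffle, leftDeriv_singleton]
  | succ k ih =>
    obtain ⟨a, r, rfl⟩ : ∃ a r, u = Fin.cons a r := ⟨u 0, Fin.tail u, (Fin.cons_self_tail u).symm⟩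
    rw [List.ofFn_succ, iterShuffle, leftDeriv_bind, Fin.sum_univ_succ]
    simp only [leftDeriv_shuffle, Multiset.bind_add, Fin.cons_zero, Fin.cons_succ,
      Fin.update_cons_zero, ← Fin.cons_update, List.ofFn_succ, iterShuffle]
    congr 1
    · split_ifs <;> simp
    · have : ∀ M : Multiset (Word d), (M.bind fun w => if w = i :: w.tail then
          shuffle a w.tail else 0) = (leftDeriv i M).bind (shuffle a) := fun M => by
        rw [leftDeriv, Multiset.bind_assoc]
        refine Multiset.bind_congr fun w _ => ?_
        split_ifs <;> simp
      rw [this, ih]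
      have hsum : ∀ (s : Finset (Fin k)) (f : Fin k → Multiset (Word d)),
          (∑ j ∈ s, f j).bind (shuffle a) = ∑ j ∈ s, (f j).bind (shuffle a) := fun s f => by
        induction s using Finset.induction_on with
        | empty => simp
        | insert j s hj ih => simp [Finset.sum_insert hj, ih]
      rw [hsum]
      refine Finset.sum_congr rfl fun j _ => ?_
      split_ifs <;> simp

theorem shuffleCoeff_cons {k : ℕ} (u : Fin k → Word d) (i : Fin d) (v : Word d) :
    shuffleCoeff u (i :: v) =
      ∑ j, if u j = i :: (u j).tail then shuffleCoeff (Function.update u j (u j).tail) v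
        else 0 := by
  rw [shuffleCoeff, ← count_leftDeriv, leftDeriv_iterShuffle, Multiset.count_sum']
  refine Finset.sum_congr rfl fun j _ => ?_
  split_ifs <;> simp [shuffleCoeff]

theorem iterShuffle_insertNth_nil {k : ℕ} (j : Fin (k + 1)) (r : Fin k → Word d) :
    iterShuffle (List.ofFn (j.insertNth ([] : Word d) r : Fin (k + 1) → Word d)) =
      iterShuffle (List.ofFn r) := by
  have hbind : ∀ M : Multiset (Word d), M.bind (shuffle []) = M := fun M => by
    simpa using Multiset.bind_singleton (f := id) M
  induction k with
  | zero =>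
    obtain rfl : j = 0 := Fin.fin_one_eq_zero j
    simp [iterShuffle]
  | succ k ih =>
    refine Fin.cases ?_ (fun j => ?_) j
    · rw [Fin.insertNth_zero', List.ofFn_succ, iterShuffle, Fin.cons_zero, hbind]
      simp only [Fin.cons_succ]
    · obtain ⟨a, r, rfl⟩ : ∃ a r', r = Fin.cons a r' :=
        ⟨r 0, Fin.tail r, (Fin.cons_self_tail r).symm⟩
      rw [Fin.insertNth_succ_cons, List.ofFn_succ, List.ofFn_succ (f := Fin.cons a r)]
      simp only [Fin.cons_zero, Fin.cons_succ, iterShuffle]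
      rw [ih]

theorem shuffleCoeff_insertNth_nil {k : ℕ} (j : Fin (k + 1)) (r : Fin k → Word d) (v : Word d) :
    shuffleCoeff (j.insertNth ([] : Word d) r : Fin (k + 1) → Word d) v = shuffleCoeff r v := by
  rw [shuffleCoeff, iterShuffle_insertNth_nil, shuffleCoeff]

theorem sum_piFinset_insertNth {α M : Type*} [DecidableEq α] [AddCommMonoid M] {k : ℕ}
    (P : Finset α) (j : Fin (k + 1)) (h : (Fin (k + 1) → α) → M) :
    ∑ u ∈ Fintype.piFinset (fun _ : Fin (k + 1) => P), h u =
      ∑ r ∈ Fintype.piFinset (fun _ : Fin k => P), ∑ a ∈ P, h (j.insertNth a r) := by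
  rw [Finset.sum_comm, ← Finset.sum_product']
  refine Finset.sum_equiv (Fin.insertNthEquiv (fun _ => α) j).symm (fun u => ?_) fun u _ => ?_
  · simp [Fin.mem_piFinset_iff_pivot_removeNth j, Fin.removeNth]
  · simp [Fin.insertNthEquiv]

/-- Words beginning with `i` correspond to their tails. Tails of length `n` have no partner of
length at most `n`, which is why `g` must vanish on them. -/
theorem sum_nonemptyWords_tail {M : Type*} [AddCommMonoid M] {n : ℕ} (i : Fin d)
    (g : Word d → M) (hg : ∀ t : Word d, n ≤ t.length → g t = 0) :
    ∑ a ∈ nonemptyWords d n, (if a = i :: a.tail then g a.tail else 0) =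
      ∑ t ∈ words d n, g t := by
  rw [← Finset.sum_filter, ← Finset.sum_filter_of_ne (s := words d n) (p := fun t => t.length < n)
    fun t _ ht => by by_contra h; exact ht (hg t (by omega))]
  refine Finset.sum_nbij' List.tail (List.cons i) ?_ ?_ ?_ ?_ ?_
  · intro a ha
    simp only [nonemptyWords, Finset.mem_filter, mem_words] at ha ⊢
    have := List.length_pos_iff.2 ha.1.2
    rw [List.length_tail]; omega
  · intro t ht
    simp only [nonemptyWords, Finset.mem_filter, mem_words] at ht ⊢
    simp; omega
  · intro a ha
    exact (Finset.mem_filter.1 ha).2.symm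
  · intros; rfl
  · intros; rfl

theorem sum_words_eq {M : Type*} [AddCommMonoid M] (n : ℕ) (g : Word d → M) :
    ∑ t ∈ words d n, g t = g [] + ∑ t ∈ nonemptyWords d n, g t := by
  rw [nonemptyWords, Finset.filter_ne', Finset.add_sum_erase _ _ (by simp [mem_words])]

theorem length_le_sum_insertNth {k : ℕ} (j : Fin (k + 1)) (t : Word d) (r : Fin k → Word d) :
    t.length ≤ ∑ l, ((j.insertNth t r : Fin (k + 1) → Word d) l).length := by
  have := Finset.single_le_sum
    (f := fun l => ((j.insertNth t r : Fin (k + 1) → Word d) l).length)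
    (fun _ _ => Nat.zero_le _) (Finset.mem_univ j)
  simpa using this

variable {F : Type*} [AddCommGroup F] [Module ℝ F]

/-- Splits according to what is left of the `j`-th word once its first letter `i` is removed. If
nothing is left, the word was `[i]` and the factor disappears from the shuffle; otherwise a
non-empty word remains, to which `i` was prepended. -/
theorem sum_shuffleCoeff_update {n k : ℕ} (i : Fin d) (v : Word d) (hv : v.length < n)
    (j : Fin (k + 1)) (G : (Fin (k + 1) → Word d) → F) :
    ∑ u ∈ Fintype.piFinset (fun _ : Fin (k + 1) => nonemptyWords d n),
        ((if u j = i :: (u j).tail then shuffleCoeff (Function.update u j (u j).tail) v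
          else 0 : ℕ) : ℝ) • G u =
      ∑ r ∈ Fintype.piFinset (fun _ : Fin k => nonemptyWords d n),
        (shuffleCoeff r v : ℝ) • G (j.insertNth [i] r) +
      ∑ u ∈ Fintype.piFinset (fun _ : Fin (k + 1) => nonemptyWords d n),
        (shuffleCoeff u v : ℝ) • G (Function.update u j (i :: u j)) := by
  rw [sum_piFinset_insertNth _ j, sum_piFinset_insertNth _ j, ← Finset.sum_add_distrib]
  refine Finset.sum_congr rfl fun r _ => ?_
  simp only [Fin.insertNth_apply_same, Fin.update_insertNth]
  have := sum_nonemptyWords_tail (n := n) i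
    (fun t => (shuffleCoeff (j.insertNth t r : Fin (k + 1) → Word d) v : ℝ) •
      G (j.insertNth (i :: t) r)) fun t ht => by
        rw [shuffleCoeff_eq_zero, Nat.cast_zero, zero_smul]
        have := length_le_sum_insertNth j t r
        omega
  rw [sum_words_eq, shuffleCoeff_insertNth_nil] at this
  rw [← this]
  refine Finset.sum_congr rfl fun a _ => ?_
  by_cases h : a = i :: a.tail
  · rw [if_pos h, if_pos h, ← h]
  · rw [if_neg h, if_neg h, Nat.cast_zero, zero_smul]

/-- `∑_k 1/k! ∑_{u₁,…,u_k} ⟨e_v^*, e_{u₁} ⧢ ⋯ ⧢ e_{u_k}⟩ G_k(u₁,…,u_k)`, the inner sum being over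
non-empty words of length at most `n`. -/
noncomputable def shuffleSum (n : ℕ) (v : Word d) (G : ∀ k : ℕ, (Fin k → Word d) → F) : F :=
  ∑ k ∈ Finset.range (n + 1), ((k.factorial : ℝ)⁻¹) •
    ∑ u ∈ Fintype.piFinset (fun _ : Fin k => nonemptyWords d n), (shuffleCoeff u v : ℝ) • G k u

theorem ne_nil_of_mem_piFinset {n k : ℕ} {u : Fin k → Word d}
    (hu : u ∈ Fintype.piFinset (fun _ : Fin k => nonemptyWords d n)) (j : Fin k) : u j ≠ [] :=
  (Finset.mem_filter.1 (Fintype.mem_piFinset.1 hu j)).2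

theorem shuffleSum_nil (n : ℕ) (G : ∀ k : ℕ, (Fin k → Word d) → F) :
    shuffleSum n [] G = G 0 Fin.elim0 := by
  rw [shuffleSum, Finset.sum_range_succ', Finset.sum_eq_zero, zero_add]
  · simp only [shuffleCoeff, iterShuffle, Fintype.piFinset_of_isEmpty, List.ofFn_zero,
      Finset.univ_unique, Finset.sum_singleton, Multiset.count_singleton_self, Nat.cast_one,
      one_smul, Nat.factorial_zero, inv_one]
    exact congrArg (G 0) (Subsingleton.elim _ _)
  · intro k _
    rw [Finset.sum_eq_zero, smul_zero]
    intro u hu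
    rw [shuffleCoeff_eq_zero, Nat.cast_zero, zero_smul]
    have := le_sum_length (ne_nil_of_mem_piFinset hu)
    simp only [List.length_nil]; omega

/-- This recursion mirrors the product rule for `D^kφ(F_{u₁},…,F_{u_k})`. Symmetry in the position
of the new word `[i]` is needed only for `k ≤ |v|`, since more than `|v|` non-empty words cannot
shuffle to `v`; this keeps the differentiability required of `φ` minimal. -/
theorem shuffleSum_cons {n : ℕ} (i : Fin d) (v : Word d) (hv : v.length < n)
    (G : ∀ k : ℕ, (Fin k → Word d) → F)
    (hG : ∀ k ≤ v.length, ∀ (j : Fin (k + 1)) (r : Fin k → Word d),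
      G (k + 1) (j.insertNth [i] r) = G (k + 1) (Fin.cons [i] r)) :
    shuffleSum n (i :: v) G = shuffleSum n v fun k u =>
      G (k + 1) (Fin.cons [i] u) + ∑ j, G k (Function.update u j (i :: u j)) := by
  have hz : ∀ k, v.length < k → ∀ r ∈ Fintype.piFinset (fun _ : Fin k => nonemptyWords d n),
      shuffleCoeff r v = 0 := fun k hk r hr => shuffleCoeff_eq_zero (by
    have := le_sum_length (ne_nil_of_mem_piFinset hr); omega)
  have h0 : ∀ g : (Fin 0 → Word d) → F, ∑ u ∈ Fintype.piFinset
      (fun _ : Fin 0 => nonemptyWords d n), (shuffleCoeff u (i :: v) : ℝ) • g u = 0 := fun g => by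
    simp [shuffleCoeff, iterShuffle]
  simp only [shuffleSum, smul_add, Finset.sum_add_distrib]
  rw [Finset.sum_range_succ', h0, smul_zero, add_zero]
  -- The two sums on the right are offset by one in `k`. The term `k = n` of the first vanishes
  -- because `|v| < n`, and the term `k = 0` of the second is a sum over no positions.
  conv_rhs =>
    congr
    · rw [Finset.sum_range_succ, Finset.sum_eq_zero (s := Fintype.piFinset _)
        (fun r hr => by rw [hz n hv r hr, Nat.cast_zero, zero_smul]), smul_zero, add_zero]
    · rw [Finset.sum_range_succ']
  simp only [Finset.univ_eq_empty, Finset.sum_empty, smul_zero, Finset.sum_const_zero, add_zero]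
  rw [← Finset.sum_add_distrib]
  refine Finset.sum_congr rfl fun k _ => ?_
  simp only [shuffleCoeff_cons, Nat.cast_sum, Finset.sum_smul]
  rw [Finset.sum_comm]
  simp only [sum_shuffleCoeff_update i v hv]
  rw [Finset.sum_add_distrib, smul_add]
  congr 1
  · have : ∀ j : Fin (k + 1), ∑ r ∈ Fintype.piFinset (fun _ : Fin k => nonemptyWords d n),
        (shuffleCoeff r v : ℝ) • G (k + 1) (j.insertNth [i] r) =
        ∑ r ∈ Fintype.piFinset (fun _ : Fin k => nonemptyWords d n),
        (shuffleCoeff r v : ℝ) • G (k + 1) (Fin.cons [i] r) := fun j => by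
      refine Finset.sum_congr rfl fun r hr => ?_
      rcases lt_or_ge v.length k with h | h
      · rw [hz k h r hr, Nat.cast_zero, zero_smul, zero_smul]
      · rw [hG k h]
    -- The `k + 1` positions of `[i]` contribute equally and turn `1/(k+1)!` into `1/k!`.
    simp only [this, Finset.sum_const, Finset.card_univ, Fintype.card_fin]
    rw [← Nat.cast_smul_eq_nsmul ℝ, smul_smul, Nat.factorial_succ, Nat.cast_mul, mul_inv,
      mul_right_comm, inv_mul_cancel₀ (by positivity), one_mul]
  · simp only [Finset.smul_sum]
    rw [Finset.sum_comm]

end Shuffle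

/-! ### Iterated Lie derivatives and the Faà di Bruno formula -/

section LieDerivatives

variable {d : ℕ} {E F G : Type*} [NormedAddCommGroup E] [NormedSpace ℝ E]
  [NormedAddCommGroup F] [NormedSpace ℝ F] [NormedAddCommGroup G] [NormedSpace ℝ G]

/-- The iterated derivative of `φ` along the vector fields `f i`: `lieD f [] φ = φ` and
`lieD f (i :: w) φ = D(lieD f w φ) f_i`. -/
noncomputable def lieD (f : Fin d → E → E) : Word d → (E → F) → E → F
  | [], φ => φ
  | i :: w, φ => fun x => fderiv ℝ (lieD f w φ) x (f i x)

theorem wordField_eq_lieD (f : Fin d → E → E) (w : Word d) : wordField f w = lieD f w id := by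
  induction w with
  | nil => rfl
  | cons i w ih => simp only [wordField, lieD, ih]

theorem lieD_append (f : Fin d → E → E) (u v : Word d) (φ : E → F) :
    lieD f (u ++ v) φ = lieD f u (lieD f v φ) := by
  induction u with
  | nil => rfl
  | cons i u ih => simp only [List.cons_append, lieD, ih]

theorem lieD_singleton_id (f : Fin d → E → E) (i : Fin d) : lieD f [i] id = f i := by
  funext x
  simp [lieD]

theorem wordField_append_singleton (f : Fin d → E → E) (w : Word d) (i : Fin d) :
    wordField f (w ++ [i]) = lieD f w (f i) := by
  rw [wordField_eq_lieD, lieD_append, lieD_singleton_id]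

theorem wordField_append (f : Fin d → E → E) (u w : Word d) :
    wordField f (u ++ w) = lieD f u (wordField f w) := by
  rw [wordField_eq_lieD, lieD_append, wordField_eq_lieD]

/-- The newest letter contributes an undifferentiated field, so the fields lose one derivative fewer
than `φ`; hence the bound `N + 1` in place of `N`. -/
theorem contDiff_lieD {f : Fin d → E → E} {N p q : ℕ} (hf : ∀ i, ContDiff ℝ N (f i))
    {φ : E → F} (hφ : ContDiff ℝ p φ) (v : Word d) (hp : q + v.length ≤ p)
    (hN : q + v.length ≤ N + 1) : ContDiff ℝ q (lieD f v φ) := by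
  induction v generalizing q with
  | nil => exact hφ.of_le (by exact_mod_cast hp)
  | cons i v ih =>
    rw [List.length_cons] at hp hN
    have h1 : ContDiff ℝ (q + 1 : ℕ) (lieD f v φ) := ih (by omega) (by omega)
    exact (h1.fderiv_right (m := q) (by push_cast; rfl)).clm_apply
      ((hf i).of_le (by exact_mod_cast (by omega : q ≤ N)))

theorem contDiff_wordField {f : Fin d → E → E} {N q : ℕ} (hf : ∀ i, ContDiff ℝ N (f i))
    (v : Word d) (hN : q + v.length ≤ N + 1) : ContDiff ℝ q (wordField f v) := by
  rw [wordField_eq_lieD]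
  exact contDiff_lieD (p := q + v.length) hf contDiff_id v le_rfl hN

/-- The two leading arguments are those of the second derivative of `D^kφ`, which is symmetric. -/
theorem iteratedFDeriv_cons_cons_comm {φ : E → F} {k : ℕ} (hφ : ContDiff ℝ (k + 2 : ℕ) φ) (x : E)
    (a b : E) (r : Fin k → E) :
    iteratedFDeriv ℝ (k + 2) φ x (Fin.cons a (Fin.cons b r : Fin (k + 1) → E)) =
      iteratedFDeriv ℝ (k + 2) φ x (Fin.cons b (Fin.cons a r : Fin (k + 1) → E)) := by
  have h1 : ∀ y, DifferentiableAt ℝ (iteratedFDeriv ℝ (k + 1) φ) y := fun y =>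
    hφ.contDiffAt.differentiableAt_iteratedFDeriv (by exact_mod_cast Nat.lt_succ_self _)
  have h2 : ContDiff ℝ 2 (iteratedFDeriv ℝ k φ) :=
    hφ.iteratedFDeriv_right (by push_cast; rw [add_comm])
  have key : ∀ a b : E,
      iteratedFDeriv ℝ (k + 2) φ x (Fin.cons a (Fin.cons b r : Fin (k + 1) → E)) =
      fderiv ℝ (fderiv ℝ (iteratedFDeriv ℝ k φ)) x a b r := fun a b => by
    rw [(h1 x).iteratedFDeriv_succ_apply_left', Fin.cons_zero, Fin.tail_cons]
    have : (fun y => iteratedFDeriv ℝ (k + 1) φ y (Fin.cons b r : Fin (k + 1) → E)) =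
        fun y => fderiv ℝ (iteratedFDeriv ℝ k φ) y b r := by
      funext y
      rw [iteratedFDeriv_succ_apply_left, Fin.cons_zero, Fin.tail_cons]
    rw [this]
    have h3 : HasFDerivAt (fderiv ℝ (iteratedFDeriv ℝ k φ))
        (fderiv ℝ (fderiv ℝ (iteratedFDeriv ℝ k φ)) x) x :=
      ((h2.fderiv_right (m := 1) (by norm_num)).differentiable (by norm_num) x).hasFDerivAt
    have h4 := ((ContinuousMultilinearMap.apply ℝ (fun _ : Fin k => E) F r).hasFDerivAt
      (x := fderiv ℝ (iteratedFDeriv ℝ k φ) x b)).comp x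
        (h3.clm_apply (hasFDerivAt_const b x))
    have h5 := h4.fderiv
    simp only [Function.comp_def, ContinuousMultilinearMap.apply_apply] at h5
    rw [h5]
    simp
  rw [key, key, (h2.contDiffAt.isSymmSndFDerivAt (by simp)).eq]

theorem iteratedFDeriv_insertNth {φ : E → F} {k : ℕ} (hφ : ContDiff ℝ (k + 1 : ℕ) φ) (x : E)
    (j : Fin (k + 1)) (a : E) (r : Fin k → E) :
    iteratedFDeriv ℝ (k + 1) φ x (j.insertNth a r) =
      iteratedFDeriv ℝ (k + 1) φ x (Fin.cons a r) := by
  induction k generalizing x with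
  | zero => rw [Fin.fin_one_eq_zero j, Fin.insertNth_zero']
  | succ k ih =>
    refine Fin.cases (by rw [Fin.insertNth_zero']) (fun j => ?_) j
    obtain ⟨b, r, rfl⟩ : ∃ b r', r = Fin.cons b r' :=
      ⟨r 0, Fin.tail r, (Fin.cons_self_tail r).symm⟩
    have h1 : ∀ y, DifferentiableAt ℝ (iteratedFDeriv ℝ (k + 1) φ) y := fun y =>
      hφ.contDiffAt.differentiableAt_iteratedFDeriv (by exact_mod_cast Nat.lt_succ_self _)
    rw [iteratedFDeriv_cons_cons_comm hφ, Fin.insertNth_succ_cons,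
      (h1 x).iteratedFDeriv_succ_apply_left', (h1 x).iteratedFDeriv_succ_apply_left']
    simp only [Fin.cons_zero, Fin.tail_cons]
    simp only [ih (hφ.of_le (by exact_mod_cast Nat.le_succ _))]

theorem hasFDerivAt_iteratedFDeriv_apply {φ : E → F} {k : ℕ} (hφ : ContDiff ℝ (k + 1 : ℕ) φ)
    {g : Fin k → E → E} {x : E} (hg : ∀ j, DifferentiableAt ℝ (g j) x) :
    ∃ L : E →L[ℝ] F, HasFDerivAt (fun y => iteratedFDeriv ℝ k φ y (fun j => g j y)) L x ∧
      ∀ h, L h = iteratedFDeriv ℝ (k + 1) φ x (Fin.cons h fun j => g j x) +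
        ∑ j, iteratedFDeriv ℝ k φ x
          (Function.update (fun l => g l x) j (fderiv ℝ (g j) x h)) := by
  have h1 : DifferentiableAt ℝ (iteratedFDeriv ℝ k φ) x :=
    hφ.contDiffAt.differentiableAt_iteratedFDeriv (by exact_mod_cast Nat.lt_succ_self _)
  refine ⟨_, h1.hasFDerivAt.continuousMultilinearMap_apply fun j => (hg j).hasFDerivAt,
    fun h => ?_⟩
  rw [iteratedFDeriv_succ_apply_left]
  simp

/-- The induction step differentiates the formula for `v` along `f_i` term by term and recognizes
the right-hand side of `shuffleSum_cons`. -/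
theorem lieD_eq_shuffleSum {f : Fin d → E → E} {N p n : ℕ} (hf : ∀ i, ContDiff ℝ N (f i))
    {φ : E → F} (hφ : ContDiff ℝ p φ) (v : Word d) (hp : v.length ≤ p)
    (hN : v.length ≤ N + 1) (hn : v.length ≤ n) (x : E) :
    lieD f v φ x = shuffleSum n v fun k u =>
      iteratedFDeriv ℝ k φ x fun j => wordField f (u j) x := by
  induction v generalizing x with
  | nil => rw [shuffleSum_nil, iteratedFDeriv_zero_apply]; rfl
  | cons i v ih =>
    rw [List.length_cons] at hp hN hn
    have hcons : ∀ (k : ℕ) (a : Word d) (r : Fin k → Word d), (fun j => wordField f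
        ((Fin.cons a r : Fin (k + 1) → Word d) j) x) =
        (Fin.cons (wordField f a x) (fun j => wordField f (r j) x) : Fin (k + 1) → E) :=
      fun k a r => by funext j; refine Fin.cases ?_ (fun j => ?_) j <;> simp
    have hins : ∀ (k : ℕ) (j : Fin (k + 1)) (a : Word d) (r : Fin k → Word d),
        (fun l => wordField f ((j.insertNth a r : Fin (k + 1) → Word d) l) x) =
        (j.insertNth (wordField f a x) (fun j => wordField f (r j) x) : Fin (k + 1) → E) :=
      fun k j a r => by
        rw [Fin.eq_insertNth_iff]
        exact ⟨by simp, funext fun l => by simp [Fin.removeNth]⟩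
    have hsing : wordField f [i] x = f i x := by
      rw [wordField_eq_lieD, lieD_singleton_id]
    rw [shuffleSum_cons i v (by omega) _ fun k hk j r => by
      rw [hins, hcons, iteratedFDeriv_insertNth (hφ.of_le (by exact_mod_cast (by omega)))]]
    have hfun : lieD f v φ = fun x => shuffleSum n v fun k u =>
        iteratedFDeriv ℝ k φ x fun j => wordField f (u j) x :=
      funext fun y => ih (by omega) (by omega) (by omega) y
    have key : ∀ k, ∀ u ∈ Fintype.piFinset (fun _ : Fin k => nonemptyWords d n),
        ∃ L : E →L[ℝ] F, HasFDerivAt (fun y => (shuffleCoeff u v : ℝ) •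
          iteratedFDeriv ℝ k φ y fun j => wordField f (u j) y) L x ∧
        L (f i x) = (shuffleCoeff u v : ℝ) •
          ((iteratedFDeriv ℝ (k + 1) φ x fun j =>
            wordField f ((Fin.cons [i] u : Fin (k + 1) → Word d) j) x) +
          ∑ j, iteratedFDeriv ℝ k φ x fun l =>
            wordField f (Function.update u j (i :: u j) l) x) := by
      intro k u hu
      -- The words in `u` may be too long for `F_{u_j}` to be differentiable. A non-zero coefficient
      -- forces their total length to be `|v|`, which bounds both the `|u_j|` and `k`.
      by_cases hc : shuffleCoeff u v = 0
      · refine ⟨0, ?_, by simp [hc]⟩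
        simp only [hc, Nat.cast_zero, zero_smul]
        exact hasFDerivAt_const _ _
      have hsum : ∑ j, (u j).length = v.length := by
        by_contra h; exact hc (shuffleCoeff_eq_zero h)
      have hk := le_sum_length (ne_nil_of_mem_piFinset hu)
      have hu' : ∀ j, (u j).length ≤ v.length := fun j => by
        rw [← hsum]
        exact Finset.single_le_sum (f := fun j => (u j).length) (fun _ _ => Nat.zero_le _)
          (Finset.mem_univ j)
      obtain ⟨L, hL, hL'⟩ := hasFDerivAt_iteratedFDeriv_apply (k := k) (x := x)
        (g := fun j => wordField f (u j)) (hφ.of_le (by exact_mod_cast (by omega)))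
        fun j => (contDiff_wordField (q := 1) hf (u j) (by have := hu' j; omega)).differentiable
          (by norm_num) x
      refine ⟨(shuffleCoeff u v : ℝ) • L, hL.const_smul _, ?_⟩
      rw [smul_apply, hL', hcons, hsing]
      congr 2
      refine Finset.sum_congr rfl fun j _ => ?_
      congr 1
      funext l
      by_cases h : l = j
      · subst h; simp [wordField]
      · simp [h]
    choose! L hL hL' using key
    have hder : HasFDerivAt (lieD f v φ) (∑ k ∈ Finset.range (n + 1), ((k.factorial : ℝ)⁻¹) •
        ∑ u ∈ Fintype.piFinset (fun _ : Fin k => nonemptyWords d n), L k u) x := by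
      rw [hfun]
      exact HasFDerivAt.fun_sum fun k _ => (HasFDerivAt.fun_sum fun u hu => hL k u hu).const_smul _
    simp only [lieD, hder.fderiv, shuffleSum, sum_apply,
      smul_apply]
    refine Finset.sum_congr rfl fun k _ => ?_
    congr 1
    exact Finset.sum_congr rfl fun u hu => hL' k u hu

/-- The lift of `φ` along a path with coefficients `F_w(X)` has the coefficients `lieD f w φ`. -/
theorem compLift_eq_lieD {f : Fin d → E → E} {N p : ℕ} (hf : ∀ i, ContDiff ℝ N (f i))
    {φ : E → F} (hφ : ContDiff ℝ p φ) (v : Word d) (hp : v.length ≤ p)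
    (hN : v.length ≤ N + 1) {Z : ℝ → Word d → E} {t : ℝ}
    (hZ : ∀ u : Word d, u.length ≤ v.length → Z t u = wordField f u (Z t [])) :
    compLift φ Z t v = lieD f v φ (Z t []) := by
  rw [compLift]
  split_ifs with hv
  · subst hv; rfl
  rw [lieD_eq_shuffleSum (n := v.length) hf hφ v hp hN le_rfl, shuffleSum,
    Finset.range_eq_Ico, Finset.sum_eq_sum_Ico_succ_bot (by omega)]
  -- The term `k = 0`, absent from `compLift`, vanishes: the empty shuffle product contains only the
  -- empty word.
  have : ∑ u ∈ Fintype.piFinset (fun _ : Fin 0 => nonemptyWords d v.length),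
      (shuffleCoeff u v : ℝ) • (iteratedFDeriv ℝ 0 φ (Z t []) fun j =>
        wordField f (u j) (Z t [])) = 0 := by
    simp [shuffleCoeff, iterShuffle, hv]
  rw [this, smul_zero, zero_add]
  refine Finset.sum_congr rfl fun k _ => ?_
  congr 1
  refine Finset.sum_congr rfl fun u hu => ?_
  have : (fun j => Z t (u j)) = fun j => wordField f (u j) (Z t []) := funext fun j =>
    hZ _ (mem_words.1 (Finset.mem_filter.1 (Fintype.mem_piFinset.1 hu j)).1)
  rw [this]

end LieDerivatives

/-! ### Characters, convolution and inverses -/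

section Characters

variable {d : ℕ}

/-- The pairing `⟨g, e_u ⧢ e_v⟩`. -/
def shufflePairing (g : Word d → ℝ) (u v : Word d) : ℝ := ((shuffle u v).map g).sum

@[simp] theorem shufflePairing_nil_left (g : Word d → ℝ) (v : Word d) :
    shufflePairing g [] v = g v := by
  simp [shufflePairing]

@[simp] theorem shufflePairing_nil_right (g : Word d → ℝ) (u : Word d) :
    shufflePairing g u [] = g u := by
  simp [shufflePairing]

theorem shufflePairing_cons_cons (g : Word d → ℝ) (a b : Fin d) (u v : Word d) :
    shufflePairing g (a :: u) (b :: v) =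
      shufflePairing (fun w => g (a :: w)) u (b :: v) +
      shufflePairing (fun w => g (b :: w)) (a :: u) v := by
  simp [shufflePairing, shuffle_cons_cons]

theorem shufflePairing_add (g h : Word d → ℝ) (u v : Word d) :
    shufflePairing (fun w => g w + h w) u v = shufflePairing g u v + shufflePairing h u v := by
  simp [shufflePairing]

theorem shufflePairing_const_mul (c : ℝ) (g : Word d → ℝ) (u v : Word d) :
    shufflePairing (fun w => c * g w) u v = c * shufflePairing g u v := by
  simp [shufflePairing, Multiset.sum_map_mul_left]

theorem conv_cons (g h : Word d → ℝ) (a : Fin d) (w : Word d) :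
    conv g h (a :: w) = g [] * h (a :: w) + conv (fun z => g (a :: z)) h w := by
  rw [conv, List.length_cons, Finset.sum_range_succ', conv, add_comm]
  simp

theorem conv_nil (g h : Word d → ℝ) : conv g h [] = g [] * h [] := by
  simp [conv]

/-- Deconcatenation is multiplicative for the shuffle product: cutting a shuffle of `u` and `v`
amounts to cutting `u` and `v` and shuffling the pieces. This makes the convolution of characters a
character. -/
theorem shufflePairing_conv (g h : Word d → ℝ) (u v : Word d) :
    shufflePairing (conv g h) u v =
      ∑ p ∈ Finset.range (u.length + 1), ∑ q ∈ Finset.range (v.length + 1),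
        shufflePairing g (u.take p) (v.take q) * shufflePairing h (u.drop p) (v.drop q) := by
  induction u generalizing g v with
  | nil => simp [conv]
  | cons a u ihu =>
    induction v generalizing g with
    | nil => simp [conv]
    | cons b v ihv =>
      rw [shufflePairing_cons_cons]
      simp only [conv_cons, shufflePairing_add, shufflePairing_const_mul]
      rw [ihu, ihv]
      simp only [List.length_cons]
      rw [Finset.sum_range_succ' _ (u.length + 1), Finset.sum_range_succ' _ (u.length + 1)]
      simp only [Finset.sum_range_succ' _ (v.length + 1), List.take_succ_cons,
        List.drop_succ_cons, List.take_zero, List.drop_zero, shufflePairing_nil_left,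
        shufflePairing_nil_right, shufflePairing_cons_cons, Finset.sum_add_distrib, add_mul,
        mul_add]
      ring

/-- The shuffle recursion in the last letters. It makes reversal of words compatible with shuffles,
and hence `charInv` a character. -/
theorem shufflePairing_concat_concat (g : Word d → ℝ) (a b : Fin d) (u v : Word d) :
    shufflePairing g (u ++ [a]) (v ++ [b]) =
      shufflePairing (fun w => g (w ++ [a])) u (v ++ [b]) +
      shufflePairing (fun w => g (w ++ [b])) (u ++ [a]) v := by
  induction u generalizing g v with
  | nil =>
    induction v generalizing g with
    | nil => simp [shufflePairing_cons_cons, add_comm]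
    | cons c v ihv =>
      simp only [List.nil_append, List.cons_append, shufflePairing_cons_cons,
        shufflePairing_nil_left] at ihv ⊢
      rw [ihv]
      simp only [List.append_assoc, List.cons_append]
      ring
  | cons e u ihu =>
    induction v generalizing g with
    | nil =>
      have := ihu (fun w => g (e :: w)) []
      simp only [List.nil_append, List.cons_append, shufflePairing_cons_cons,
        shufflePairing_nil_right] at this ⊢
      rw [this]
      simp only [List.append_assoc, List.cons_append]
      ring
    | cons c v ihv =>
      have h1 := ihu (fun w => g (e :: w)) (c :: v)
      have h2 := ihv (fun w => g (c :: w))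
      simp only [List.cons_append, shufflePairing_cons_cons] at h1 h2 ⊢
      rw [h1, h2]
      ring

theorem shufflePairing_reverse (g : Word d → ℝ) (u v : Word d) :
    shufflePairing (fun w => g w.reverse) u v = shufflePairing g u.reverse v.reverse := by
  induction u generalizing g v with
  | nil => simp
  | cons a u ihu =>
    induction v generalizing g with
    | nil => simp
    | cons b v ihv =>
      have h1 := ihu (fun w => g (w ++ [a])) (b :: v)
      have h2 := ihv (fun w => g (w ++ [b]))
      simp only [List.reverse_cons] at h1 h2
      simp only [shufflePairing_cons_cons, List.reverse_cons, shufflePairing_concat_concat, h1, h2]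

theorem IsTruncatedCharacter.conv {N : ℕ} {g h : Word d → ℝ} (hg : IsTruncatedCharacter N g)
    (hh : IsTruncatedCharacter N h) : IsTruncatedCharacter N (conv g h) := by
  refine ⟨by rw [conv_nil, hg.map_one, hh.map_one, one_mul], fun u v huv => ?_⟩
  have h1 := shufflePairing_conv g h u v
  rw [shufflePairing] at h1
  rw [h1, RoughPath.conv, RoughPath.conv, Finset.sum_mul_sum]
  refine Finset.sum_congr rfl fun p hp => Finset.sum_congr rfl fun q hq => ?_
  rw [shufflePairing, shufflePairing, hg.map_shuffle, hh.map_shuffle]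
  · ring
  · simp only [List.length_drop]; omega
  · simp only [List.length_take]; omega

theorem IsTruncatedCharacter.charInv {N : ℕ} {g : Word d → ℝ} (hg : IsTruncatedCharacter N g) :
    IsTruncatedCharacter N (charInv g) := by
  refine ⟨by simp [RoughPath.charInv, hg.map_one], fun u v huv => ?_⟩
  have h1 : (shuffle u v).map (RoughPath.charInv g) =
      (shuffle u v).map fun w => (-1) ^ (u.length + v.length) * g w.reverse :=
    Multiset.map_congr rfl fun w hw => by
      rw [RoughPath.charInv, length_of_mem_shuffle hw]
  have h2 := shufflePairing_const_mul ((-1) ^ (u.length + v.length)) (fun w => g w.reverse) u v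
  rw [shufflePairing_reverse, shufflePairing, shufflePairing, hg.map_shuffle _ _ (by simpa)] at h2
  rw [h1, h2, RoughPath.charInv, RoughPath.charInv, pow_add]
  ring

theorem IsTruncatedCharacter.map_iterShuffle {N : ℕ} {g : Word d → ℝ}
    (hg : IsTruncatedCharacter N g) {k : ℕ} (u : Fin k → Word d)
    (hu : ∑ j, (u j).length ≤ N) :
    ((iterShuffle (List.ofFn u)).map g).sum = ∏ j, g (u j) := by
  induction k with
  | zero => simp [iterShuffle, hg.map_one]
  | succ k ih =>
    rw [Fin.sum_univ_succ] at hu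
    rw [List.ofFn_succ, iterShuffle, Multiset.map_bind, Multiset.sum_bind, Fin.prod_univ_succ,
      ← ih _ (by omega), ← Multiset.sum_map_mul_left]
    refine congrArg _ (Multiset.map_congr rfl fun z hz => hg.map_shuffle _ _ ?_)
    rw [length_of_mem_iterShuffle hz]
    exact hu

/-- All words of a shuffle have the total length of its factors, so truncation at `m` keeps either
the whole shuffle or none of it. -/
theorem IsTruncatedCharacter.sum_shuffleCoeff {N : ℕ} {g : Word d → ℝ}
    (hg : IsTruncatedCharacter N g) {m : ℕ} (hm : m ≤ N) {k : ℕ} (u : Fin k → Word d) :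
    ∑ v ∈ words d m, (shuffleCoeff u v : ℝ) * g v =
      if ∑ j, (u j).length ≤ m then ∏ j, g (u j) else 0 := by
  split_ifs with hu
  · rw [← hg.map_iterShuffle u (hu.trans hm), Finset.sum_multiset_map_count]
    symm
    refine (Finset.sum_subset (fun v hv => ?_) fun v _ hv => ?_).trans
      (Finset.sum_congr rfl fun v _ => (nsmul_eq_mul _ _))
    · rw [mem_words, length_of_mem_iterShuffle (Multiset.mem_toFinset.1 hv)]
      exact hu
    · rw [Multiset.count_eq_zero.2 (fun h => hv (Multiset.mem_toFinset.2 h)), zero_smul]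
  · refine Finset.sum_eq_zero fun v hv => ?_
    rw [shuffleCoeff_eq_zero, Nat.cast_zero, zero_mul]
    have := mem_words.1 hv
    omega

theorem conv_add_left (f g h : Word d → ℝ) (w : Word d) :
    conv (fun z => f z + g z) h w = conv f h w + conv g h w := by
  simp [conv, add_mul, Finset.sum_add_distrib]

theorem conv_const_mul_left (c : ℝ) (g h : Word d → ℝ) (w : Word d) :
    conv (fun z => c * g z) h w = c * conv g h w := by
  simp [conv, mul_assoc, Finset.mul_sum]

theorem conv_assoc (f g h : Word d → ℝ) (w : Word d) :
    conv (conv f g) h w = conv f (conv g h) w := by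
  induction w generalizing f g with
  | nil => simp only [conv_nil]; ring
  | cons a w ih =>
    simp only [conv_cons, conv_nil, conv_add_left, conv_const_mul_left, ih]
    ring

theorem conv_congr {f f' g g' : Word d → ℝ} {w : Word d}
    (hf : ∀ u : Word d, u.length ≤ w.length → f u = f' u)
    (hg : ∀ u : Word d, u.length ≤ w.length → g u = g' u) : conv f g w = conv f' g' w := by
  refine Finset.sum_congr rfl fun p _ => ?_
  rw [hf, hg]
  · simp
  · simp

/-- The unit of the convolution product. -/
def convOne (w : Word d) : ℝ := if w = [] then 1 else 0

theorem convOne_conv (g : Word d → ℝ) (w : Word d) : conv convOne g w = g w := by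
  rw [conv, Finset.sum_range_succ', Finset.sum_eq_zero]
  · simp [convOne]
  · intro p hp
    have : w.take (p + 1) ≠ [] := by
      rw [← List.length_pos_iff, List.length_take]
      have := Finset.mem_range.1 hp
      omega
    simp [convOne, this]

/-- A left inverse for the convolution product is a right inverse. -/
theorem conv_eq_convOne_of_conv_eq_convOne {N : ℕ} {a g : Word d → ℝ} (ha : a [] = 1)
    (hg : g [] = 1) (h : ∀ w : Word d, w.length ≤ N → conv a g w = convOne w) (w : Word d)
    (hw : w.length ≤ N) : conv g a w = convOne w := by
  induction hn : w.length using Nat.strong_induction_on generalizing w with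
  | _ n ih =>
    rcases eq_or_ne w [] with rfl | hne
    · simp [conv_nil, ha, hg, convOne]
    have h1 : conv (conv g a) g w = g w := by
      rw [conv_assoc]
      have : conv g (conv a g) w = conv g convOne w :=
        conv_congr (fun _ _ => rfl) fun u hu => h u (hu.trans hw)
      rw [this, conv, Finset.sum_range_succ, Finset.sum_eq_zero]
      · simp [convOne]
      · intro p hp
        have : w.drop p ≠ [] := by
          rw [← List.length_pos_iff, List.length_drop]
          have := Finset.mem_range.1 hp
          omega
        simp [convOne, this]
    -- By induction `g ⋆ a` vanishes on the proper non-empty prefixes of `w`, so only the two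
    -- extreme cuts survive.
    have h2 : conv (conv g a) g w = conv g a w + g w := by
      have hpos := List.length_pos_iff.2 hne
      rw [RoughPath.conv, Finset.sum_range_succ]
      rw [Finset.sum_eq_single_of_mem 0 (Finset.mem_range.2 hpos)]
      · simp [conv_nil, ha, hg, add_comm]
      · intro p hp hp0
        have := Finset.mem_range.1 hp
        rw [ih p (by omega) (w.take p) (by simp; omega) (by simp; omega)]
        have : w.take p ≠ [] := by
          rw [← List.length_pos_iff, List.length_take]
          omega
        simp [convOne, this]
    rw [h1] at h2
    simp [convOne, hne]
    linarith

end Characters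

/-! ### Increments of the rough path and Chen's relation -/

section Increments

variable {d : ℕ} {T γ : ℝ} {W : ℝ → Word d → ℝ}

theorem abs_le_homNorm_pow {N : ℕ} (g : Word d → ℝ) {w : Word d} (hw : w ≠ [])
    (hN : w.length ≤ N) : |g w| ≤ (homNorm N g : ℝ) ^ w.length := by
  have hpos := List.length_pos_iff.2 hw
  have h1 : ((w.length.factorial : NNReal) * ‖g w‖₊) ^ (1 / (w.length : ℝ)) ≤ homNorm N g :=
    Finset.le_sup (f := fun w : Word d =>
      ((w.length.factorial : NNReal) * ‖g w‖₊) ^ (1 / (w.length : ℝ)))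
      (Finset.mem_filter.2 ⟨mem_words.2 hN, hw⟩)
  have h2 : (w.length.factorial : NNReal) * ‖g w‖₊ ≤ homNorm N g ^ w.length := by
    have := pow_le_pow_left₀ zero_le h1 w.length
    rwa [← NNReal.rpow_natCast, ← NNReal.rpow_mul, one_div,
      inv_mul_cancel₀ (by exact_mod_cast hpos.ne'), NNReal.rpow_one] at this
  have h3 : ‖g w‖₊ ≤ homNorm N g ^ w.length := by
    refine le_trans ?_ h2
    exact le_mul_of_one_le_left zero_le (by exact_mod_cast Nat.factorial_pos _)
  exact_mod_cast h3

theorem increment_isTruncatedCharacter (hW : IsGeometricRoughPath T γ W) {s t : ℝ}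
    (hs : s ∈ Set.Icc 0 T) (ht : t ∈ Set.Icc 0 T) :
    IsTruncatedCharacter (level γ) (increment W s t) :=
  (hW.character s hs).charInv.conv (hW.character t ht)

theorem exists_abs_increment_le (hW : IsGeometricRoughPath T γ W) :
    ∃ C : ℝ, 1 ≤ C ∧ ∀ s ∈ Set.Icc 0 T, ∀ t ∈ Set.Icc 0 T, ∀ w : Word d,
      w.length ≤ level γ → |increment W s t w| ≤ C * (|t - s| ^ γ) ^ w.length := by
  obtain ⟨C, hC⟩ := hW.holder
  refine ⟨max C 1 ^ level γ, one_le_pow₀ (le_max_right _ _), fun s hs t ht w hw => ?_⟩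
  rcases eq_or_ne w [] with rfl | hne
  · rw [(increment_isTruncatedCharacter hW hs ht).map_one]
    simpa using one_le_pow₀ (le_max_right C 1)
  -- The points are exchanged because `homDist N g h` is the norm of `h⁻¹ ⋆ g`.
  have h1 := hC t ht s hs
  rw [homDist, abs_sub_comm] at h1
  have hpos : 0 ≤ |t - s| ^ γ := Real.rpow_nonneg (abs_nonneg _) _
  calc |increment W s t w| ≤ (homNorm (level γ) (increment W s t) : ℝ) ^ w.length :=
        abs_le_homNorm_pow _ hne hw
    _ ≤ (max C 1 * |t - s| ^ γ) ^ w.length := by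
        refine pow_le_pow_left₀ (NNReal.coe_nonneg _) (h1.trans ?_) _
        exact mul_le_mul_of_nonneg_right (le_max_left _ _) hpos
    _ ≤ _ := by
        rw [mul_pow]
        exact mul_le_mul_of_nonneg_right (pow_le_pow_right₀ (le_max_right _ _) hw)
          (pow_nonneg hpos _)

/-- The Hölder bound at equal times kills every non-empty word. This supplies `W_s⁻¹ ⋆ W_s = 1`
without the algebraic antipode identity. -/
theorem increment_self (hγ : 0 < γ) (hW : IsGeometricRoughPath T γ W) {s : ℝ}
    (hs : s ∈ Set.Icc 0 T) {w : Word d} (hw : w.length ≤ level γ) :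
    increment W s s w = convOne w := by
  rcases eq_or_ne w [] with rfl | hne
  · rw [(increment_isTruncatedCharacter hW hs hs).map_one, convOne, if_pos rfl]
  obtain ⟨C, -, hC⟩ := exists_abs_increment_le hW
  have := hC s hs s hs w hw
  rw [sub_self, abs_zero, Real.zero_rpow hγ.ne', zero_pow (List.length_pos_iff.2 hne).ne',
    mul_zero] at this
  rw [abs_nonpos_iff.1 this, convOne, if_neg hne]

/-- Chen's relation. -/
theorem conv_increment (hγ : 0 < γ) (hW : IsGeometricRoughPath T γ W) {s u t : ℝ}
    (hu : u ∈ Set.Icc 0 T) {w : Word d} (hw : w.length ≤ level γ) :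
    conv (increment W s u) (increment W u t) w = increment W s t w := by
  have h1 : ∀ z : Word d, z.length ≤ w.length →
      conv (W u) (increment W u t) z = W t z := fun z hz => by
    rw [increment, ← conv_assoc, ← convOne_conv (W t) z]
    refine conv_congr (fun v hv => ?_) fun _ _ => rfl
    -- `increment_self` makes `charInv (W u)` a left inverse; here it is needed as a right inverse.
    exact conv_eq_convOne_of_conv_eq_convOne (hW.character u hu).charInv.map_one
      (hW.character u hu).map_one (fun y hy => increment_self hγ hW hu hy) v
      (hv.trans (hz.trans hw))
  rw [increment, conv_assoc]
  exact conv_congr (fun _ _ => rfl) h1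

end Increments

/-! ### Reindexing sums over words -/

section WordSums

variable {d : ℕ}

theorem sum_words_splits {M : Type*} [AddCommMonoid M] (N : ℕ) (G : Word d → Word d → M) :
    ∑ v ∈ words d N, ∑ p ∈ Finset.range (v.length + 1), G (v.take p) (v.drop p) =
      ∑ w ∈ words d N, ∑ u ∈ words d (N - w.length), G u w := by
  rw [Finset.sum_sigma', Finset.sum_sigma']
  refine Finset.sum_bij' (fun a _ => ⟨a.1.drop a.2, a.1.take a.2⟩)
    (fun b _ => ⟨b.2 ++ b.1, b.2.length⟩) ?_ ?_ ?_ ?_ ?_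
  · rintro ⟨v, p⟩ h
    simp only [Finset.mem_sigma, mem_words, Finset.mem_range, List.length_drop,
      List.length_take] at h ⊢
    omega
  · rintro ⟨w, u⟩ h
    simp only [Finset.mem_sigma, mem_words, Finset.mem_range, List.length_append] at h ⊢
    omega
  · rintro ⟨v, p⟩ h
    simp only [Finset.mem_sigma, mem_words, Finset.mem_range] at h
    simp; omega
  · rintro ⟨w, u⟩ h
    simp
  · intros; rfl

/-- Combined with Chen's relation, this rewrites an expansion around `s` as an expansion over
`[u,t]` of coefficients that are themselves expanded around `s`. -/
theorem sum_conv_smul {E : Type*} [AddCommGroup E] [Module ℝ E] (N : ℕ) (g h : Word d → ℝ)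
    (Y : Word d → E) :
    ∑ v ∈ words d N, conv g h v • Y v =
      ∑ w ∈ words d N, h w • ∑ u ∈ words d (N - w.length), g u • Y (u ++ w) := by
  simp only [Finset.smul_sum]
  rw [← sum_words_splits N fun u w => h w • g u • Y (u ++ w)]
  refine Finset.sum_congr rfl fun v _ => ?_
  rw [conv, Finset.sum_smul]
  refine Finset.sum_congr rfl fun p _ => ?_
  rw [List.take_append_drop, smul_smul, mul_comm]

theorem pairing_conv_dualBasis {E : Type*} [AddCommGroup E] [Module ℝ E] {N : ℕ}
    (g : Word d → ℝ) {w : Word d} (hw : w.length ≤ N) (Z : Word d → E) :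
    pairing N (conv g (dualBasis w)) Z =
      ∑ u ∈ words d (N - w.length), g u • Z (u ++ w) := by
  rw [pairing, sum_conv_smul, Finset.sum_eq_single_of_mem w (mem_words.2 hw)]
  · simp [dualBasis]
  · intro v _ hv
    simp [dualBasis, Pi.single_eq_of_ne hv]

theorem words_mono {m n : ℕ} (h : m ≤ n) : words d m ⊆ words d n := fun _ hw =>
  mem_words.2 ((mem_words.1 hw).trans h)

theorem sum_words_getLast {M : Type*} [AddCommMonoid M] {N : ℕ} (hN : 1 ≤ N) (i : Fin d)
    (H : Word d → M) :
    ∑ v ∈ words d N, (if v.getLast? = some i then H v else 0) =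
      ∑ w ∈ words d (N - 1), H (w ++ [i]) := by
  rw [← Finset.sum_filter]
  refine Finset.sum_nbij' List.dropLast (fun w => w ++ [i]) ?_ ?_ ?_ ?_ ?_
  · intro v hv
    simp only [Finset.mem_filter, mem_words] at hv ⊢
    rw [List.length_dropLast]; omega
  · intro w hw
    simp only [Finset.mem_filter, mem_words] at hw ⊢
    simp; omega
  · intro v hv
    exact List.dropLast_append_getLast? _ (Finset.mem_filter.1 hv).2
  · intro w _; simp
  · intro v hv
    rw [List.dropLast_append_getLast? _ (Finset.mem_filter.1 hv).2]

end WordSums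

/-! ### One step of the expansion: Taylor's formula meets characters -/

section LocalExpansion

theorem exists_bound_closedBall {E F ι : Type*} [NormedAddCommGroup E] [ProperSpace E]
    [NormedAddCommGroup F] (s : Finset ι) {g : ι → E → F}
    (hg : ∀ i ∈ s, Continuous (g i)) (R : ℝ) :
    ∃ K : ℝ, 0 ≤ K ∧ ∀ i ∈ s, ∀ x, ‖x‖ ≤ R → ‖g i x‖ ≤ K := by
  have : ∀ i, ∃ K : ℝ, 0 ≤ K ∧ (i ∈ s → ∀ x, ‖x‖ ≤ R → ‖g i x‖ ≤ K) := fun i => by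
    by_cases hi : i ∈ s
    · obtain ⟨K, hK⟩ := (isCompact_closedBall (0 : E) R).exists_bound_of_continuousOn
        (hg i hi).continuousOn
      exact ⟨max K 0, le_max_right _ _, fun _ x hx =>
        (hK x (by simpa using hx)).trans (le_max_left _ _)⟩
    · exact ⟨0, le_rfl, fun h => absurd h hi⟩
  choose K hK0 hK using this
  exact ⟨∑ i ∈ s, K i, Finset.sum_nonneg fun i _ => hK0 i, fun i hi x hx =>
    (hK i hi x hx).trans (Finset.single_le_sum (fun j _ => hK0 j) hi)⟩

variable {d : ℕ} {E F : Type*} [NormedAddCommGroup E] [NormedSpace ℝ E]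
  [NormedAddCommGroup F] [NormedSpace ℝ F]

theorem norm_sub_taylor_le [CompleteSpace F] {φ : E → F} {n : ℕ}
    (hφ : ContDiff ℝ (n + 1 : ℕ) φ) {x a : E} {M : ℝ}
    (hM : ∀ t ∈ Set.Icc (0 : ℝ) 1, ‖iteratedFDeriv ℝ (n + 1) φ (x + t • a)‖ ≤ M) :
    ‖φ (x + a) - ∑ k ∈ Finset.range (n + 1),
      ((k.factorial : ℝ)⁻¹) • iteratedFDeriv ℝ k φ x (fun _ => a)‖ ≤ M * ‖a‖ ^ (n + 1) := by
  have hM0 : 0 ≤ M := (norm_nonneg _).trans (hM 0 (by simp))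
  rw [map_add_eq_sum_add_integral_iteratedFDeriv (f := φ) (x := x) (y := a) (n := n) fun t _ => by
    exact_mod_cast hφ.contDiffAt, add_sub_cancel_left, norm_smul]
  have h1 : ‖∫ t in (0 : ℝ)..1, (1 - t) ^ n •
      iteratedFDeriv ℝ (n + 1) φ (x + t • a) (fun _ => a)‖ ≤ M * ‖a‖ ^ (n + 1) * |1 - 0| := by
    refine intervalIntegral.norm_integral_le_of_norm_le_const fun t ht => ?_
    rw [Set.uIoc_of_le zero_le_one] at ht
    rw [norm_smul]
    have h2 : ‖(1 - t) ^ n‖ ≤ 1 := by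
      rw [norm_pow, Real.norm_of_nonneg (by linarith [ht.2])]
      exact pow_le_one₀ (by linarith [ht.2]) (by linarith [ht.1])
    have h3 := (iteratedFDeriv ℝ (n + 1) φ (x + t • a)).le_of_opNorm_le
      (hM t ⟨ht.1.le, ht.2⟩) (fun _ => a)
    simp only [Finset.prod_const, Finset.card_univ, Fintype.card_fin] at h3
    exact (mul_le_mul h2 h3 (norm_nonneg _) zero_le_one).trans (one_mul _).le
  rw [sub_zero, abs_one, mul_one] at h1
  refine (mul_le_mul ?_ h1 (norm_nonneg _) zero_le_one).trans (one_mul _).le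
  rw [norm_inv, Real.norm_natCast]
  exact inv_le_one_of_one_le₀ (by exact_mod_cast Nat.factorial_pos _)

/-- Faà di Bruno summed against a character: shuffle coefficients become products of values of `g`.
Apart from the cutoff at total length `m - 1`, the result is the Taylor polynomial of `φ` at the
increment `∑ g_u F_u(x)`. -/
theorem sum_smul_lieD_eq {f : Fin d → E → E} {N m : ℕ} (hf : ∀ i, ContDiff ℝ N (f i))
    (hm1 : 1 ≤ m) (hm : m ≤ N) {φ : E → F} (hφ : ContDiff ℝ m φ) {g : Word d → ℝ}
    (hg : IsTruncatedCharacter N g) (x : E) :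
    ∑ v ∈ words d (m - 1), g v • lieD f v φ x =
      ∑ k ∈ Finset.range m, ((k.factorial : ℝ)⁻¹) •
        ∑ u ∈ Fintype.piFinset (fun _ : Fin k => nonemptyWords d N),
          (if ∑ j, (u j).length ≤ m - 1 then ∏ j, g (u j) else 0) •
            iteratedFDeriv ℝ k φ x fun j => wordField f (u j) x := by
  have h1 : ∀ v ∈ words d (m - 1), g v • lieD f v φ x =
      ∑ k ∈ Finset.range m, ((k.factorial : ℝ)⁻¹) •
        ∑ u ∈ Fintype.piFinset (fun _ : Fin k => nonemptyWords d N),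
          ((shuffleCoeff u v : ℝ) * g v) •
            iteratedFDeriv ℝ k φ x fun j => wordField f (u j) x := by
    intro v hv
    rw [mem_words] at hv
    rw [lieD_eq_shuffleSum (n := N) hf hφ v (by omega) (by omega) (by omega), shuffleSum,
      ← Finset.sum_subset (Finset.range_mono (by omega : m ≤ N + 1)), Finset.smul_sum]
    · refine Finset.sum_congr rfl fun k _ => ?_
      rw [smul_comm, Finset.smul_sum]
      congr 1
      refine Finset.sum_congr rfl fun u _ => ?_
      rw [smul_smul, mul_comm]
    · intro k _ hk
      rw [Finset.sum_eq_zero, smul_zero]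
      intro u hu
      have := le_sum_length (ne_nil_of_mem_piFinset hu)
      rw [Finset.mem_range] at hk
      rw [shuffleCoeff_eq_zero (by omega), Nat.cast_zero, zero_smul]
  rw [Finset.sum_congr rfl h1, Finset.sum_comm]
  refine Finset.sum_congr rfl fun k _ => ?_
  rw [← Finset.smul_sum, Finset.sum_comm]
  congr 1
  refine Finset.sum_congr rfl fun u _ => ?_
  rw [← Finset.sum_smul, hg.sum_shuffleCoeff (by omega)]

theorem iteratedFDeriv_sum_smul (φ : E → F) (x : E) (k : ℕ) (S : Finset (Word d))
    (g : Word d → ℝ) (V : Word d → E) :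
    iteratedFDeriv ℝ k φ x (fun _ => ∑ u ∈ S, g u • V u) =
      ∑ u ∈ Fintype.piFinset (fun _ : Fin k => S),
        (∏ j, g (u j)) • iteratedFDeriv ℝ k φ x fun j => V (u j) := by
  have := (iteratedFDeriv ℝ k φ x).toMultilinearMap.map_sum_finset
    (fun (_ : Fin k) u => g u • V u) (fun _ => S)
  simp only [ContinuousMultilinearMap.coe_coe] at this
  rw [this]
  refine Finset.sum_congr rfl fun u _ => ?_
  exact (iteratedFDeriv ℝ k φ x).toMultilinearMap.map_smul_univ (fun j => g (u j))
    (fun j => V (u j))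

/-- One step of the expansion: up to an error of order `m`, `φ` evaluated at the truncated
expansion driven by a character `g` is given by the Lie derivatives of `φ`. -/
theorem exists_norm_sub_sum_lieD_le [ProperSpace E] [CompleteSpace F] {f : Fin d → E → E}
    {N m : ℕ} (hf : ∀ i, ContDiff ℝ N (f i)) (hm1 : 1 ≤ m) (hm : m ≤ N) {φ : E → F}
    (hφ : ContDiff ℝ m φ) (R B H : ℝ) (hB : 0 ≤ B) :
    ∃ C : ℝ, 0 ≤ C ∧ ∀ x, ‖x‖ ≤ R → ∀ h, 0 ≤ h → h ≤ H → ∀ g : Word d → ℝ,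
      IsTruncatedCharacter N g → (∀ w : Word d, w.length ≤ N → |g w| ≤ B * h ^ w.length) →
      ‖φ (∑ u ∈ words d N, g u • wordField f u x) -
        ∑ u ∈ words d (m - 1), g u • lieD f u φ x‖ ≤ C * h ^ m := by
  obtain ⟨K, hK0, hK⟩ := exists_bound_closedBall (words d N) (g := fun u => wordField f u)
    (fun u hu => (contDiff_wordField (q := 1) hf u
      (by have := mem_words.1 hu; omega)).continuous) R
  -- A bound that is at least 1 allows surplus powers of `h` to be replaced by a common power of
  -- `H'`.
  set H' := max H 1 with hH'
  have hH'1 : 1 ≤ H' := le_max_right _ _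
  have hH'0 : 0 ≤ H' := zero_le_one.trans hH'1
  set A : ℝ := (nonemptyWords d N).card * (B * H' ^ N * K) with hA
  have hA0 : 0 ≤ A := by positivity
  obtain ⟨M, hM0, hM⟩ := exists_bound_closedBall (Finset.range (m + 1))
    (g := fun k x => ‖iteratedFDeriv ℝ k φ x‖)
    (fun k hk => (hφ.continuous_iteratedFDeriv (by
      have := Finset.mem_range.1 hk; exact_mod_cast (by omega : k ≤ m))).norm) (R + A * H')
  simp only [norm_norm, Finset.mem_range] at hM
  -- The first summand bounds Taylor's remainder, using `‖a‖ ≤ A * h` below; the sum bounds the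
  -- products of total length at least `m` that the cutoff removes.
  refine ⟨M * A ^ m + ∑ k ∈ Finset.range m,
    ∑ u ∈ Fintype.piFinset (fun _ : Fin k => nonemptyWords d N),
      (∏ j, B * H' ^ (u j).length) * (M * K ^ k), by positivity, ?_⟩
  intro x hx h hh0 hhH g hg hgB
  have hhH' : h ≤ H' := hhH.trans (le_max_left _ _)
  set a := ∑ u ∈ nonemptyWords d N, g u • wordField f u x with ha
  have hxa : ∑ u ∈ words d N, g u • wordField f u x = x + a := by
    rw [sum_words_eq, hg.map_one, one_smul]; rfl
  have hKx : ∀ u ∈ nonemptyWords d N, ‖wordField f u x‖ ≤ K := fun u hu =>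
    hK u (Finset.mem_filter.1 hu).1 x hx
  have haA : ‖a‖ ≤ A * h := by
    have : ∀ u ∈ nonemptyWords d N, ‖g u • wordField f u x‖ ≤ B * H' ^ N * K * h := by
      intro u hu
      have hu' := Finset.mem_filter.1 hu
      have hlen := mem_words.1 hu'.1
      have hpos := List.length_pos_iff.2 hu'.2
      have h1 : h ^ u.length ≤ H' ^ N * h := by
        obtain ⟨l, hl⟩ : ∃ l, u.length = l + 1 := ⟨u.length - 1, by omega⟩
        rw [hl, pow_succ]
        refine mul_le_mul_of_nonneg_right ?_ hh0
        exact (pow_le_pow_left₀ hh0 hhH' l).trans (pow_le_pow_right₀ hH'1 (by omega))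
      rw [norm_smul, Real.norm_eq_abs]
      calc |g u| * ‖wordField f u x‖ ≤ (B * (H' ^ N * h)) * K :=
            mul_le_mul ((hgB u hlen).trans (mul_le_mul_of_nonneg_left h1 hB)) (hKx u hu)
              (norm_nonneg _) (by positivity)
        _ = _ := by ring
    calc ‖a‖ ≤ ∑ u ∈ nonemptyWords d N, B * H' ^ N * K * h := norm_sum_le_of_le _ this
      _ = A * h := by rw [Finset.sum_const, nsmul_eq_mul, hA]; ring
  obtain ⟨n, rfl⟩ : ∃ n, m = n + 1 := ⟨m - 1, by omega⟩
  have hR : ∀ t ∈ Set.Icc (0 : ℝ) 1, ‖x + t • a‖ ≤ R + A * H' := fun t ht => by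
    refine (norm_add_le _ _).trans (add_le_add hx ?_)
    rw [norm_smul, Real.norm_of_nonneg ht.1]
    calc t * ‖a‖ ≤ 1 * (A * H') :=
          mul_le_mul ht.2 (haA.trans (mul_le_mul_of_nonneg_left hhH' hA0)) (norm_nonneg _)
            zero_le_one
      _ = _ := one_mul _
  have h1 := norm_sub_taylor_le hφ (x := x) (a := a) (M := M)
    fun t ht => hM _ (by omega) _ (hR t ht)
  have h2 : ‖∑ k ∈ Finset.range (n + 1),
      ((k.factorial : ℝ)⁻¹) • iteratedFDeriv ℝ k φ x (fun _ => a) -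
      ∑ u ∈ words d (n + 1 - 1), g u • lieD f u φ x‖ ≤
      (∑ k ∈ Finset.range (n + 1),
        ∑ u ∈ Fintype.piFinset (fun _ : Fin k => nonemptyWords d N),
        (∏ j, B * H' ^ (u j).length) * (M * K ^ k)) * h ^ (n + 1) := by
    rw [sum_smul_lieD_eq hf hm1 hm hφ hg, ← Finset.sum_sub_distrib, Finset.sum_mul]
    refine norm_sum_le_of_le _ fun k hk => ?_
    rw [← smul_sub, iteratedFDeriv_sum_smul, ← Finset.sum_sub_distrib, norm_smul, norm_inv,
      Real.norm_natCast]
    refine (mul_le_of_le_one_left (norm_nonneg _)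
      (inv_le_one_of_one_le₀ (by exact_mod_cast Nat.factorial_pos _))).trans ?_
    rw [Finset.sum_mul]
    refine norm_sum_le_of_le _ fun u hu => ?_
    rw [← sub_smul, norm_smul]
    rw [Fintype.mem_piFinset] at hu
    -- Below the cutoff the terms cancel; above it the product carries at least `m = n + 1` powers
    -- of `h`.
    split_ifs with hlen
    · rw [sub_self, norm_zero, zero_mul]
      positivity
    rw [sub_zero, norm_prod]
    have h3 : ∏ j, ‖g (u j)‖ ≤ (∏ j, B * H' ^ (u j).length) * h ^ (n + 1) := by
      calc ∏ j, ‖g (u j)‖ ≤ ∏ j, B * h ^ (u j).length :=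
            Finset.prod_le_prod (fun _ _ => norm_nonneg _) fun j _ => by
              rw [Real.norm_eq_abs]
              exact hgB _ (mem_words.1 (Finset.mem_filter.1 (hu j)).1)
        _ = B ^ k * h ^ (∑ j, (u j).length) := by
            rw [Finset.prod_mul_distrib, Finset.prod_pow_eq_pow_sum]; simp
        _ ≤ B ^ k * (H' ^ (∑ j, (u j).length) * h ^ (n + 1)) := by
            refine mul_le_mul_of_nonneg_left ?_ (pow_nonneg hB _)
            obtain ⟨l, hl⟩ : ∃ l, ∑ j, (u j).length = l + (n + 1) :=
              ⟨∑ j, (u j).length - (n + 1), by omega⟩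
            rw [hl, pow_add h]
            refine mul_le_mul_of_nonneg_right ?_ (pow_nonneg hh0 _)
            exact (pow_le_pow_left₀ hh0 hhH' l).trans (pow_le_pow_right₀ hH'1 (by omega))
        _ = _ := by
            rw [Finset.prod_mul_distrib, Finset.prod_pow_eq_pow_sum]; simp; ring
    have h4 : ‖iteratedFDeriv ℝ k φ x fun j => wordField f (u j) x‖ ≤ M * K ^ k := by
      have hx' : ‖x‖ ≤ R + A * H' := hx.trans (le_add_of_nonneg_right (by positivity))
      refine ((iteratedFDeriv ℝ k φ x).le_of_opNorm_le
        (hM k (by have := Finset.mem_range.1 hk; omega) x hx') _).trans ?_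
      refine mul_le_mul_of_nonneg_left ?_ hM0
      calc ∏ j, ‖wordField f (u j) x‖ ≤ ∏ _j : Fin k, K :=
            Finset.prod_le_prod (fun _ _ => norm_nonneg _) fun j _ => hKx _ (hu j)
        _ = K ^ k := by simp
    calc (∏ j, ‖g (u j)‖) * ‖iteratedFDeriv ℝ k φ x fun j => wordField f (u j) x‖
        ≤ ((∏ j, B * H' ^ (u j).length) * h ^ (n + 1)) * (M * K ^ k) :=
          mul_le_mul h3 h4 (norm_nonneg _) (by positivity)
      _ = _ := by ring
  rw [hxa]
  have h5 := (norm_sub_le_norm_sub_add_norm_sub _ _ _).trans (add_le_add h1 h2)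
  refine h5.trans ?_
  rw [add_mul, mul_assoc M, ← mul_pow]
  gcongr

end LocalExpansion

/-! ### The sewing lemma -/

section Sewing

open Filter Topology

variable {E : Type*} [NormedAddCommGroup E]

theorem eq_zero_of_almost_additive {Ξ : ℝ → ℝ → E} {T C θ : ℝ} (hθ : 1 < θ)
    (hΞ : ∀ s u t, 0 ≤ s → s ≤ u → u ≤ t → t ≤ T →
      ‖Ξ s t - Ξ s u - Ξ u t‖ ≤ C * (t - s) ^ θ) {r : ℝ} (h0 : 0 ≤ r) (h1 : r ≤ T) :
    Ξ r r = 0 := by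
  have := hΞ r r r h0 le_rfl le_rfl h1
  rw [sub_self (Ξ r r), zero_sub, norm_neg, sub_self, Real.zero_rpow (by linarith),
    mul_zero] at this
  exact norm_le_zero_iff.1 this

/-- The maximal inequality for almost additive functions of two parameters. -/
theorem norm_sum_sub_le_of_almost_additive {Ξ : ℝ → ℝ → E} {T C θ : ℝ} (hC : 0 ≤ C) (hθ : 1 < θ)
    (hΞ : ∀ s u t, 0 ≤ s → s ≤ u → u ≤ t → t ≤ T →
      ‖Ξ s t - Ξ s u - Ξ u t‖ ≤ C * (t - s) ^ θ)
    {τ : ℕ → ℝ} (hτ : Monotone τ) (hτ0 : ∀ k, 0 ≤ τ k) (hτT : ∀ k, τ k ≤ T) (n p : ℕ) :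
    ‖∑ k ∈ Finset.range n, Ξ (τ (p + k)) (τ (p + k + 1)) - Ξ (τ p) (τ (p + n))‖ ≤
      2 * C / (1 - 2 ^ (1 - θ)) * (τ (p + n) - τ p) ^ θ := by
  have h2 : (2 : ℝ) ^ (1 - θ) < 1 := Real.rpow_lt_one_of_one_lt_of_neg (by norm_num) (by linarith)
  set K := 2 * C / (1 - 2 ^ (1 - θ)) with hK
  have hK0 : 0 ≤ K := div_nonneg (by linarith) (by linarith)
  -- `K` is the fixed point of the bisection estimate: the two parts contribute at most `K * 2 ^ (1
  -- - θ)` together, and the two splittings cost `2 * C`.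
  have hKeq : K * 2 ^ (1 - θ) + 2 * C = K := by
    have : K * (1 - 2 ^ (1 - θ)) = 2 * C := div_mul_cancel₀ _ (by linarith)
    linarith
  induction n using Nat.strong_induction_on generalizing p with
  | _ n ih =>
    rcases Nat.eq_zero_or_pos n with rfl | hn
    · rw [Finset.range_zero, Finset.sum_empty, add_zero,
        eq_zero_of_almost_additive hθ hΞ (hτ0 p) (hτT p), sub_self, sub_self, norm_zero,
        Real.zero_rpow (by linarith), mul_zero]
    set a := τ p
    set b := τ (p + n)
    have hab : a ≤ b := hτ (by omega)
    -- The cell containing the midpoint is singled out, so the parts on either side have at most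
    -- half the length and fewer cells.
    obtain ⟨r, hrn, hr1, hr2⟩ : ∃ r, r < n ∧ τ (p + r) ≤ (a + b) / 2 ∧
        (a + b) / 2 ≤ τ (p + r + 1) := by
      have h0 : τ (p + 0) ≤ (a + b) / 2 := by rw [add_zero]; linarith
      refine ⟨Nat.findGreatest (fun r => τ (p + r) ≤ (a + b) / 2) (n - 1), ?_,
        Nat.findGreatest_spec (P := fun r => τ (p + r) ≤ (a + b) / 2) (Nat.zero_le _) h0, ?_⟩
      · have := Nat.findGreatest_le (P := fun r => τ (p + r) ≤ (a + b) / 2) (n - 1)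
        omega
      · rcases lt_or_eq_of_le
          (Nat.findGreatest_le (P := fun r => τ (p + r) ≤ (a + b) / 2) (n - 1)) with h | h
        · exact (not_le.1 (Nat.findGreatest_is_greatest
            (P := fun r => τ (p + r) ≤ (a + b) / 2) (Nat.lt_succ_self _) h)).le
        · rw [h, show p + (n - 1) + 1 = p + n by omega]
          linarith
    obtain ⟨l, rfl⟩ : ∃ l, n = r + (1 + l) := ⟨n - r - 1, by omega⟩
    have e1 := ih r (by omega) p
    have e2 := ih l (by omega) (p + r + 1)
    rw [Finset.sum_range_add, Finset.sum_range_add, Finset.sum_range_one]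
    have hsum : ∑ x ∈ Finset.range l, Ξ (τ (p + (r + (1 + x)))) (τ (p + (r + (1 + x)) + 1)) =
        ∑ x ∈ Finset.range l, Ξ (τ (p + r + 1 + x)) (τ (p + r + 1 + x + 1)) :=
      Finset.sum_congr rfl fun x _ => by
        rw [show p + (r + (1 + x)) = p + r + 1 + x by ring]
    have hpl : p + r + 1 + l = p + (r + (1 + l)) := by ring
    rw [hsum, add_zero]
    rw [hpl] at e2
    set x := τ (p + r)
    set y := τ (p + r + 1)
    have hax : a ≤ x := hτ (by omega)
    have hxy : x ≤ y := hτ (by omega)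
    have hyb : y ≤ b := hτ (by omega)
    have e3 := hΞ a x b (hτ0 _) hax (hxy.trans hyb) (hτT _)
    have e4 := hΞ x y b (hτ0 _) hxy hyb (hτT _)
    have hL : ((b - a) / 2) ^ θ = 2 ^ (1 - θ) / 2 * (b - a) ^ θ := by
      rw [Real.div_rpow (by linarith) (by norm_num), Real.rpow_sub (by norm_num), Real.rpow_one]
      field_simp
    have e1' : K * (x - a) ^ θ ≤ K * (2 ^ (1 - θ) / 2 * (b - a) ^ θ) := by
      rw [← hL]
      exact mul_le_mul_of_nonneg_left
        (Real.rpow_le_rpow (by linarith) (by linarith) (by linarith)) hK0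
    have e2' : K * (b - y) ^ θ ≤ K * (2 ^ (1 - θ) / 2 * (b - a) ^ θ) := by
      rw [← hL]
      exact mul_le_mul_of_nonneg_left
        (Real.rpow_le_rpow (by linarith) (by linarith) (by linarith)) hK0
    have e4' : C * (b - x) ^ θ ≤ C * (b - a) ^ θ :=
      mul_le_mul_of_nonneg_left
        (Real.rpow_le_rpow (by linarith) (by linarith) (by linarith)) hC
    set S1 := ∑ k ∈ Finset.range r, Ξ (τ (p + k)) (τ (p + k + 1))
    set S2 := ∑ k ∈ Finset.range l, Ξ (τ (p + r + 1 + k)) (τ (p + r + 1 + k + 1))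
    have hdec : S1 + (Ξ x y + S2) - Ξ a b =
        (S1 - Ξ a x) + (S2 - Ξ y b) - (Ξ a b - Ξ a x - Ξ x b) - (Ξ x b - Ξ x y - Ξ y b) := by
      abel
    calc ‖S1 + (Ξ x y + S2) - Ξ a b‖
        ≤ ‖S1 - Ξ a x‖ + ‖S2 - Ξ y b‖ + ‖Ξ a b - Ξ a x - Ξ x b‖ + ‖Ξ x b - Ξ x y - Ξ y b‖ := by
          rw [hdec]
          exact (norm_sub_le _ _).trans (add_le_add_left ((norm_sub_le _ _).trans
            (add_le_add_left (norm_add_le _ _) _)) _)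
      _ ≤ K * (2 ^ (1 - θ) / 2 * (b - a) ^ θ) + K * (2 ^ (1 - θ) / 2 * (b - a) ^ θ) +
          C * (b - a) ^ θ + C * (b - a) ^ θ := by linarith
      _ = (K * 2 ^ (1 - θ) + 2 * C) * (b - a) ^ θ := by ring
      _ = K * (b - a) ^ θ := by rw [hKeq]

/-- The cell `[x,y]` is clipped to `[0,t]`, `[0,s]` and `[s,t]`. The clipped germs add up exactly
unless `s` lies inside the cell, where one additivity defect appears. -/
theorem norm_clamp_defect_le {Ξ : ℝ → ℝ → E} {T C θ : ℝ} (hC : 0 ≤ C) (hθ : 1 < θ)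
    (hΞ : ∀ s u t, 0 ≤ s → s ≤ u → u ≤ t → t ≤ T →
      ‖Ξ s t - Ξ s u - Ξ u t‖ ≤ C * (t - s) ^ θ) {s t x y : ℝ} (hs : 0 ≤ s) (hst : s ≤ t)
    (ht : t ≤ T) (hx : 0 ≤ x) (hxy : x ≤ y) :
    ‖Ξ (min x t) (min y t) - Ξ (min x s) (min y s) -
      Ξ (max s (min x t)) (max s (min y t))‖ ≤ C * (y - x) ^ θ := by
  have hself := eq_zero_of_almost_additive hθ hΞ hs (hst.trans ht)
  have hpos : 0 ≤ C * (y - x) ^ θ := mul_nonneg hC (Real.rpow_nonneg (by linarith) _)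
  rcases le_or_gt y s with h1 | h1
  · rw [min_eq_left (h1.trans hst), min_eq_left h1, min_eq_left (hxy.trans h1),
      min_eq_left (hxy.trans (h1.trans hst)), max_eq_left h1, max_eq_left (hxy.trans h1), sub_self,
      hself]
    simpa using hpos
  rcases le_or_gt s x with h2 | h2
  · rw [min_eq_right h2, min_eq_right h1.le, hself,
      max_eq_right (le_min h2 hst), max_eq_right (le_min h1.le hst)]
    simpa using hpos
  · rw [min_eq_left (h2.le.trans hst), min_eq_left h2.le, min_eq_right h1.le,
      max_eq_left h2.le, max_eq_right (le_min h1.le hst)]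
    refine (hΞ x s (min y t) hx h2.le (le_min h1.le hst) ((min_le_right _ _).trans ht)).trans ?_
    refine mul_le_mul_of_nonneg_left (Real.rpow_le_rpow ?_ ?_ (by linarith)) hC
    · linarith [le_min h1.le hst]
    · linarith [min_le_left y t]

/-- The sewing lemma. -/
theorem exists_sewing [ProperSpace E] {Ξ : ℝ → ℝ → E} {T C θ : ℝ} (hT : 0 ≤ T) (hC : 0 ≤ C)
    (hθ : 1 < θ) (hΞ : ∀ s u t, 0 ≤ s → s ≤ u → u ≤ t → t ≤ T →
      ‖Ξ s t - Ξ s u - Ξ u t‖ ≤ C * (t - s) ^ θ) :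
    ∃ (J : ℝ → E) (K : ℝ), 0 ≤ K ∧ ∀ s t, 0 ≤ s → s ≤ t → t ≤ T →
      ‖J t - J s - Ξ s t‖ ≤ K * (t - s) ^ θ := by
  have h2 : (2 : ℝ) ^ (1 - θ) < 1 := Real.rpow_lt_one_of_one_lt_of_neg (by norm_num) (by linarith)
  set K := 2 * C / (1 - 2 ^ (1 - θ)) with hK
  have hK0 : 0 ≤ K := div_nonneg (by linarith) (by linarith)
  set h : ℕ → ℝ := fun n => T / (n + 1)
  have hh0 : ∀ n, 0 ≤ h n := fun n => div_nonneg hT (by positivity)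
  -- Riemann sums on a uniform grid clipped at `t`, additive up to `ε n`.
  set J : ℕ → ℝ → E := fun n t => ∑ k ∈ Finset.range (n + 1),
    Ξ (min (k * h n) t) (min ((k + 1 : ℕ) * h n) t) with hJ
  set ε : ℕ → ℝ := fun n => (n + 1) * (C * h n ^ θ) with hε
  have hmain : ∀ n s t, 0 ≤ s → s ≤ t → t ≤ T →
      ‖J n t - J n s - Ξ s t‖ ≤ ε n + K * (t - s) ^ θ := by
    intro n s t hs hst ht
    set τ : ℕ → ℝ := fun k => max s (min (k * h n) t) with hτ
    have hmono : Monotone τ := fun i j hij => max_le_max_left _ (min_le_min_right _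
      (mul_le_mul_of_nonneg_right (by exact_mod_cast hij) (hh0 n)))
    have h3 := norm_sum_sub_le_of_almost_additive hC hθ hΞ hmono
      (fun k => hs.trans (le_max_left _ _))
      (fun k => max_le (hst.trans ht) ((min_le_right _ _).trans ht)) (n + 1) 0
    have hτ0 : τ 0 = s := by
      simp only [hτ, Nat.cast_zero, zero_mul]
      rw [min_eq_left (hs.trans hst), max_eq_left hs]
    have hτn : τ (n + 1) = t := by
      have : ((n + 1 : ℕ) : ℝ) * h n = T := by
        simp only [h]; push_cast; field_simp
      simp only [hτ]
      rw [this, min_eq_right ht, max_eq_right hst]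
    simp only [zero_add, hτ0, hτn] at h3
    have h4 : ‖J n t - J n s - ∑ k ∈ Finset.range (n + 1), Ξ (τ k) (τ (k + 1))‖ ≤ ε n := by
      simp only [hJ]
      rw [← Finset.sum_sub_distrib, ← Finset.sum_sub_distrib]
      refine (norm_sum_le_of_le (f := _) _ fun k _ => norm_clamp_defect_le hC hθ hΞ hs hst ht
        (mul_nonneg (Nat.cast_nonneg k) (hh0 n)) (mul_le_mul_of_nonneg_right
          (by exact_mod_cast Nat.le_succ k) (hh0 n))).trans ?_
      have : ∀ k : ℕ, ((k + 1 : ℕ) : ℝ) * h n - k * h n = h n := fun k => by push_cast; ring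
      simp only [this, Finset.sum_const, Finset.card_range, nsmul_eq_mul, hε]
      push_cast
      exact le_rfl
    exact (norm_sub_le_norm_sub_add_norm_sub _ _ _).trans (add_le_add h4 h3)
  have hεlim : Tendsto ε atTop (𝓝 0) := by
    have h5 : ∀ n : ℕ, ε n = C * T ^ θ * ((n : ℝ) + 1) ^ (-(θ - 1)) := fun n => by
      have hn : (0 : ℝ) < n + 1 := by positivity
      simp only [hε, h]
      rw [Real.div_rpow hT hn.le, neg_sub, Real.rpow_sub hn, Real.rpow_one]
      field_simp
    have h6 := ((tendsto_rpow_neg_atTop (y := θ - 1) (by linarith)).comp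
      (tendsto_atTop_add_const_right _ (1 : ℝ) tendsto_natCast_atTop_atTop)).const_mul (C * T ^ θ)
    rw [mul_zero] at h6
    exact h6.congr fun n => (h5 n).symm
  -- The Riemann sums stay in a compact ball, so they converge along an ultrafilter and no Cauchy
  -- estimate is needed. One ultrafilter serves all `t`, so the increment estimate passes to the
  -- limit.
  have hlim : ∀ t, ∃ x, 0 ≤ t → t ≤ T →
      Tendsto (fun n => J n t) (hyperfilter ℕ : Filter ℕ) (𝓝 x) := by
    intro t
    by_cases ht : 0 ≤ t ∧ t ≤ T
    · obtain ⟨M, hM⟩ := hεlim.bddAbove_range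
      have hJ0 : ∀ n, J n 0 = 0 := fun n => Finset.sum_eq_zero fun k _ => by
        rw [min_eq_right (mul_nonneg (Nat.cast_nonneg _) (hh0 n)),
          min_eq_right (mul_nonneg (Nat.cast_nonneg _) (hh0 n)),
          eq_zero_of_almost_additive hθ hΞ le_rfl hT]
      have hb : ∀ n, J n t ∈ Metric.closedBall (Ξ 0 t) (M + K * (t - 0) ^ θ) := fun n => by
        rw [mem_closedBall_iff_norm]
        have := hmain n 0 t le_rfl ht.1 ht.2
        rw [hJ0, sub_zero] at this
        exact this.trans (add_le_add_left (hM ⟨n, rfl⟩) _)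
      obtain ⟨x, -, hx⟩ := (isCompact_closedBall (Ξ 0 t) (M + K * (t - 0) ^ θ)).ultrafilter_le_nhds
        ((hyperfilter ℕ).map fun n => J n t) (by
          rw [le_principal_iff]
          exact Filter.mem_map.2 (Filter.univ_mem' hb))
      exact ⟨x, fun _ _ => hx⟩
    · exact ⟨0, fun h0 h1 => absurd ⟨h0, h1⟩ ht⟩
  choose I hI using hlim
  refine ⟨I, K, hK0, fun s t hs hst ht => ?_⟩
  have h7 : Tendsto (fun n => ‖J n t - J n s - Ξ s t‖) (hyperfilter ℕ : Filter ℕ)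
      (𝓝 ‖I t - I s - Ξ s t‖) :=
    (((hI t (hs.trans hst) ht).sub (hI s hs (hst.trans ht))).sub_const _).norm
  have h8 : Tendsto (fun n => ε n + K * (t - s) ^ θ) (hyperfilter ℕ : Filter ℕ)
      (𝓝 (0 + K * (t - s) ^ θ)) :=
    (hεlim.mono_left (Nat.hyperfilter_le_atTop)).add_const _
  rw [zero_add] at h8
  exact le_of_tendsto_of_tendsto' h7 h8 fun n => hmain n s t hs hst ht

theorem sum_fin_succ_sub_castSucc {M : Type*} [AddCommGroup M] {m : ℕ} (g : Fin (m + 1) → M) :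
    ∑ j : Fin m, (g j.succ - g j.castSucc) = g (Fin.last m) - g 0 := by
  induction m with
  | zero => simp
  | succ m ih =>
    rw [Fin.sum_univ_castSucc]
    have := ih fun j => g j.castSucc
    simp only [Fin.castSucc_zero] at this
    simp only [Fin.succ_castSucc] at this ⊢
    rw [this, Fin.succ_last]
    abel

end Sewing

/-! ### Rough integrals as limits of compensated Riemann sums -/

section RoughIntegral

variable {d : ℕ} {E : Type*} [NormedAddCommGroup E] [NormedSpace ℝ E] {T γ θ : ℝ}
  {W : ℝ → Word d → ℝ} {i : Fin d} {Y : ℝ → Word d → E}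

/-- Each cell of length `l < δ` costs at most `K * δ ^ (θ - 1) * l`, and these errors sum to `K * δ
^ (θ - 1) * t`, which tends to zero with the mesh. -/
theorem isRoughIntegral_of_norm_sub_le (hθ : 1 < θ) {J : ℝ → E} {K : ℝ} (hK : 0 ≤ K)
    (hJ : ∀ s t, 0 ≤ s → s ≤ t → t ≤ T → ‖J t - J s - ∑ w ∈ words d (level γ - 1),
      increment W s t (w ++ [i]) • Y s w‖ ≤ K * (t - s) ^ θ) {t : ℝ} (ht : t ≤ T) :
    IsRoughIntegral γ W i Y t (J t - J 0) := by
  intro ε hε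
  obtain ⟨δ, hδ0, hδ⟩ : ∃ δ > 0, K * δ ^ (θ - 1) * t < ε := by
    have h1 : Filter.Tendsto (fun δ : ℝ => K * δ ^ (θ - 1) * t) (nhdsWithin 0 (Set.Ioi 0))
        (nhds (K * 0 ^ (θ - 1) * t)) :=
      (((Real.continuousAt_rpow_const 0 (θ - 1) (Or.inr (by linarith))).tendsto.const_mul
        K).mul_const t).mono_left nhdsWithin_le_nhds
    rw [Real.zero_rpow (by linarith), mul_zero, zero_mul] at h1
    obtain ⟨δ, h2, h3⟩ := ((h1.eventually (gt_mem_nhds hε)).and self_mem_nhdsWithin).exists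
    exact ⟨δ, h3, h2⟩
  refine ⟨δ, hδ0, fun m τ hτ hτ0 hτt hmesh => lt_of_le_of_lt ?_ hδ⟩
  have hpos : ∀ j, 0 ≤ τ j := fun j => hτ0 ▸ hτ.monotone (Fin.zero_le j)
  have hle : ∀ j, τ j ≤ T := fun j => (hτt ▸ hτ.monotone (Fin.le_last j)).trans ht
  rw [show J t - J 0 = ∑ j : Fin m, (J (τ j.succ) - J (τ j.castSucc)) by
    rw [sum_fin_succ_sub_castSucc fun j => J (τ j), hτ0, hτt], ← Finset.sum_sub_distrib]
  calc _ ≤ ∑ j : Fin m, K * δ ^ (θ - 1) * (τ j.succ - τ j.castSucc) := by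
        refine norm_sum_le_of_le _ fun j _ => ?_
        have hlt : τ j.castSucc < τ j.succ := hτ (Fin.castSucc_lt_succ)
        rw [norm_sub_rev]
        refine (hJ _ _ (hpos _) hlt.le (hle _)).trans ?_
        rw [mul_assoc]
        refine mul_le_mul_of_nonneg_left ?_ hK
        have h1 : 0 < τ j.succ - τ j.castSucc := by linarith
        calc (τ j.succ - τ j.castSucc) ^ θ
            = (τ j.succ - τ j.castSucc) ^ (θ - 1) * (τ j.succ - τ j.castSucc) := by
              rw [← Real.rpow_add_one h1.ne']; congr 1; ring
          _ ≤ _ := mul_le_mul_of_nonneg_right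
              (Real.rpow_le_rpow h1.le (hmesh j).le (by linarith)) h1.le
    _ = K * δ ^ (θ - 1) * t := by
        rw [← Finset.mul_sum, sum_fin_succ_sub_castSucc, hτ0, hτt, sub_zero]

theorem IsRoughIntegral.unique {t : ℝ} (ht : 0 ≤ t) {I I' : E} (h : IsRoughIntegral γ W i Y t I)
    (h' : IsRoughIntegral γ W i Y t I') : I = I' := by
  by_contra hne
  have hpos : 0 < ‖I - I'‖ / 2 := half_pos (norm_pos_iff.2 (sub_ne_zero.2 hne))
  obtain ⟨δ, hδ0, hδ⟩ := h _ hpos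
  obtain ⟨δ', hδ0', hδ'⟩ := h' _ hpos
  obtain ⟨m, τ, hτ, h0, h1, hmesh⟩ : ∃ (m : ℕ) (τ : Fin (m + 1) → ℝ), StrictMono τ ∧ τ 0 = 0 ∧
      τ (Fin.last m) = t ∧ ∀ j : Fin m, τ j.succ - τ j.castSucc < min δ δ' := by
    rcases ht.eq_or_lt with rfl | ht
    · exact ⟨0, fun _ => 0, Subsingleton.strictMono (α := Fin 1) _, rfl, rfl, fun j => j.elim0⟩
    obtain ⟨m, hm⟩ := exists_nat_gt (t / min δ δ')
    have hδm : 0 < min δ δ' := lt_min hδ0 hδ0'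
    have hm0 : (0 : ℝ) < m := lt_trans (by positivity) hm
    refine ⟨m, fun j => t / m * (j : ℕ), fun a b hab => ?_, by simp, ?_, fun j => ?_⟩
    · exact mul_lt_mul_of_pos_left (by exact_mod_cast hab) (by positivity)
    · simp only [Fin.val_last]
      exact div_mul_cancel₀ _ hm0.ne'
    · simp only [Fin.val_succ, Fin.val_castSucc]
      push_cast
      rw [div_lt_iff₀ hδm] at hm
      rw [← mul_sub, add_sub_cancel_left, mul_one, div_lt_iff₀ hm0]
      linarith
  have e1 := hδ m τ hτ h0 h1 fun j => (hmesh j).trans_le (min_le_left _ _)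
  have e2 := hδ' m τ hτ h0 h1 fun j => (hmesh j).trans_le (min_le_right _ _)
  rw [norm_sub_rev] at e1
  have := (norm_sub_le_norm_sub_add_norm_sub _ _ _).trans_lt (add_lt_add e1 e2)
  linarith

end RoughIntegral

/-! ### Expansions of the fields along a path, and their germs -/

section Expansions

variable {d : ℕ} {E : Type*} [NormedAddCommGroup E] [NormedSpace ℝ E] {T γ : ℝ}
  {W : ℝ → Word d → ℝ} {f : Fin d → E → E}

theorem one_le_level (hγ : 0 < γ) (hγ' : γ ≤ 1) : 1 ≤ level γ :=
  Nat.le_floor (by simpa using one_le_inv_iff₀.2 ⟨hγ, hγ'⟩)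

theorem one_lt_level_add_one_mul (hγ : 0 < γ) : 1 < ((level γ : ℝ) + 1) * γ := by
  have := Nat.lt_floor_add_one γ⁻¹
  rw [inv_lt_iff_one_lt_mul₀ hγ] at this
  exact this

theorem rpow_natCast_mul_eq {x : ℝ} (hx : 0 ≤ x) (q : ℕ) : x ^ ((q : ℝ) * γ) = (x ^ γ) ^ q := by
  rw [mul_comm, Real.rpow_mul hx, Real.rpow_natCast]

/-- Puts the estimates in working form: natural powers of `(t - s) ^ γ`, a non-negative constant,
and the diagonal included. -/
theorem eqUpTo_iff {E : Type*} [NormedAddCommGroup E] {a b : ℝ → ℝ → E} {q : ℕ}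
    (hab : ∀ s, 0 ≤ s → s ≤ T → a s s = b s s) :
    EqUpTo T ((q : ℝ) * γ) a b ↔ ∃ C, 0 ≤ C ∧ ∀ s t, 0 ≤ s → s ≤ t → t ≤ T →
      ‖a s t - b s t‖ ≤ C * ((t - s) ^ γ) ^ q := by
  constructor
  · rintro ⟨C, hC⟩
    refine ⟨max C 0, le_max_right _ _, fun s t hs hst ht => ?_⟩
    have hpos : 0 ≤ ((t - s) ^ γ) ^ q := pow_nonneg (Real.rpow_nonneg (by linarith) _) _
    rcases hst.eq_or_lt with rfl | hlt
    · rw [hab s hs ht, sub_self, norm_zero]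
      exact mul_nonneg (le_max_right _ _) hpos
    · refine (hC s t hs hlt ht).trans ?_
      rw [abs_of_nonneg (by linarith), rpow_natCast_mul_eq (by linarith)]
      exact mul_le_mul_of_nonneg_right (le_max_left _ _) hpos
  · rintro ⟨C, -, hC⟩
    refine ⟨C, fun s t hs hst ht => ?_⟩
    rw [abs_of_nonneg (by linarith), rpow_natCast_mul_eq (by linarith)]
    exact hC s t hs hst.le ht

theorem exists_uniform_const {ι : Type*} (S : Finset ι) {P : ι → ℝ → Prop}
    (hP : ∀ i ∈ S, ∃ C, 0 ≤ C ∧ P i C) (hmono : ∀ i C C', C ≤ C' → P i C → P i C') :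
    ∃ C, 0 ≤ C ∧ ∀ i ∈ S, P i C := by
  choose! C hC0 hC using hP
  refine ⟨∑ i ∈ S, |C i|, Finset.sum_nonneg fun _ _ => abs_nonneg _, fun i hi =>
    hmono i _ _ ?_ (hC i hi)⟩
  exact (le_abs_self _).trans (Finset.single_le_sum (f := fun i => |C i|)
    (fun _ _ => abs_nonneg _) hi)

theorem pow_le_mul_pow {x H : ℝ} (hx : 0 ≤ x) (hxH : x ≤ H) {p q : ℕ} (hpq : q ≤ p) :
    x ^ p ≤ H ^ (p - q) * x ^ q := by
  obtain ⟨l, rfl⟩ := Nat.exists_eq_add_of_le hpq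
  rw [Nat.add_sub_cancel_left, add_comm, pow_add]
  exact mul_le_mul_of_nonneg_right (pow_le_pow_left₀ hx hxH _) (pow_nonneg hx _)

theorem exists_lipschitz_closedBall {E F : Type*} [NormedAddCommGroup E] [NormedSpace ℝ E]
    [ProperSpace E] [NormedAddCommGroup F] [NormedSpace ℝ F] {φ : E → F} (hφ : ContDiff ℝ 1 φ)
    (R : ℝ) : ∃ L, 0 ≤ L ∧ ∀ x y, ‖x‖ ≤ R → ‖y‖ ≤ R → ‖φ x - φ y‖ ≤ L * ‖x - y‖ := by
  obtain ⟨L, hL0, hL⟩ := exists_bound_closedBall (E := E) {()} (g := fun _ => fderiv ℝ φ)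
    (fun _ _ => hφ.continuous_fderiv (by norm_num)) R
  refine ⟨L, hL0, fun x y hx hy => ?_⟩
  exact (convex_closedBall (0 : E) R).norm_image_sub_le_of_norm_fderiv_le
    (fun z _ => hφ.differentiable (by norm_num) z)
    (fun z hz => hL () (by simp) z (by simpa using hz)) (by simpa using hy) (by simpa using hx)

/-- The remainder of the expansion of `F_w(X_t)` around `s`. -/
noncomputable def remainder (γ : ℝ) (W : ℝ → Word d → ℝ) (f : Fin d → E → E) (X : ℝ → E)
    (w : Word d) (s t : ℝ) : E :=
  wordField f w (X t) - ∑ u ∈ words d (level γ - w.length),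
    increment W s t u • wordField f (u ++ w) (X s)

theorem sum_convOne_smul (n : ℕ) (Y : Word d → E) :
    ∑ u ∈ words d n, convOne u • Y u = Y [] := by
  rw [Finset.sum_eq_single_of_mem [] (by simp [mem_words])]
  · simp [convOne]
  · intro u _ hu
    simp [convOne, hu]

theorem sum_increment_self_smul (hγ : 0 < γ) (hW : IsGeometricRoughPath T γ W) {s : ℝ}
    (hs : s ∈ Set.Icc 0 T) {n : ℕ} (hn : n ≤ level γ) (Y : Word d → E) :
    ∑ u ∈ words d n, increment W s s u • Y u = Y [] := by
  rw [← sum_convOne_smul n Y]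
  refine Finset.sum_congr rfl fun u hu => ?_
  rw [increment_self hγ hW hs ((mem_words.1 hu).trans hn)]

theorem hasDavieExpansion_iff (hγ : 0 < γ) (hW : IsGeometricRoughPath T γ W) (X : ℝ → E) :
    HasDavieExpansion T γ W f X ↔ ∃ C, 0 ≤ C ∧ ∀ s t, 0 ≤ s → s ≤ t → t ≤ T →
      ‖remainder γ W f X [] s t‖ ≤ C * ((t - s) ^ γ) ^ (level γ + 1) := by
  have h := eqUpTo_iff (T := T) (γ := γ) (q := level γ + 1) (a := fun _ t => X t)
    (b := fun s t => pairing (level γ) (increment W s t) (fun w => wordField f w (X s)))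
    fun s hs hsT => by
      rw [pairing, sum_increment_self_smul hγ hW ⟨hs, hsT⟩ le_rfl]
      rfl
  rw [HasDavieExpansion, ← Nat.cast_succ, h]
  simp [remainder, pairing, wordField]

/-- The discarded words have length at least `m + 1`, and their increments are correspondingly
small. -/
theorem norm_sum_increment_sub_le {B K : ℝ} (hK : 0 ≤ K) {s t : ℝ} (hB : 0 ≤ B)
    (hinc : ∀ w : Word d, w.length ≤ level γ →
      |increment W s t w| ≤ B * ((t - s) ^ γ) ^ w.length) (hst : s ≤ t) {H : ℝ}
    (hH1 : 1 ≤ H) (hH : (t - s) ^ γ ≤ H) {m n : ℕ} (hmn : m ≤ n) (hn : n ≤ level γ)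
    (Y : Word d → E) (hY : ∀ u ∈ words d n, ‖Y u‖ ≤ K) :
    ‖∑ u ∈ words d n, increment W s t u • Y u - ∑ u ∈ words d m, increment W s t u • Y u‖ ≤
      (words d n).card * (B * H ^ level γ * K) * ((t - s) ^ γ) ^ (m + 1) := by
  have hpos : 0 ≤ (t - s) ^ γ := Real.rpow_nonneg (by linarith) _
  rw [← Finset.sum_sdiff_eq_sub (words_mono hmn), mul_assoc, ← nsmul_eq_mul, ← Finset.sum_const]
  refine (norm_sum_le_of_le _ (f := _) fun u hu => ?_).trans (Finset.sum_le_sum_of_subset_of_nonneg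
    Finset.sdiff_subset fun _ _ _ => by positivity)
  rw [Finset.mem_sdiff, mem_words, mem_words] at hu
  rw [norm_smul, Real.norm_eq_abs]
  calc |increment W s t u| * ‖Y u‖
      ≤ (B * (H ^ level γ * ((t - s) ^ γ) ^ (m + 1))) * K := by
        refine mul_le_mul ((hinc u (by omega)).trans (mul_le_mul_of_nonneg_left ?_ hB))
          (hY u (mem_words.2 hu.1)) (norm_nonneg _) (by positivity)
        refine (pow_le_mul_pow hpos hH (by omega : m + 1 ≤ u.length)).trans ?_
        exact mul_le_mul_of_nonneg_right (pow_le_pow_right₀ hH1 (by omega)) (by positivity)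
    _ = _ := by ring

theorem exists_increment_bounds (hγ : 0 < γ) (hW : IsGeometricRoughPath T γ W) :
    ∃ B H : ℝ, 1 ≤ B ∧ 1 ≤ H ∧ ∀ s t, 0 ≤ s → s ≤ t → t ≤ T → (t - s) ^ γ ≤ H ∧
      ∀ w : Word d, w.length ≤ level γ → |increment W s t w| ≤ B * ((t - s) ^ γ) ^ w.length := by
  obtain ⟨B, hB1, hB⟩ := exists_abs_increment_le hW
  refine ⟨B, max (T ^ γ) 1, hB1, le_max_right _ _, fun s t hs hst ht => ⟨?_, fun w hw => ?_⟩⟩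
  · exact (Real.rpow_le_rpow (by linarith) (by linarith) hγ.le).trans (le_max_left _ _)
  · have := hB s ⟨hs, hst.trans ht⟩ t ⟨hs.trans hst, ht⟩ w hw
    rwa [abs_of_nonneg (by linarith : 0 ≤ t - s)] at this

theorem continuous_wordField (hf : ∀ i, ContDiff ℝ (level γ) (f i)) {w : Word d}
    (hw : w.length ≤ level γ) : Continuous (wordField f w) :=
  (contDiff_wordField (q := 1) hf w (by omega)).continuous

/-- An expansion of order `N_γ` of `X` yields expansions of all `F_w(X)`. -/
theorem exists_remainder_bound [ProperSpace E] (hγ : 0 < γ) (hW : IsGeometricRoughPath T γ W)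
    (hf : ∀ i, ContDiff ℝ (level γ) (f i)) {X : ℝ → E} {R C : ℝ}
    (hX : ∀ t, 0 ≤ t → t ≤ T → ‖X t‖ ≤ R) (hC : 0 ≤ C)
    (hrem : ∀ s t, 0 ≤ s → s ≤ t → t ≤ T →
      ‖remainder γ W f X [] s t‖ ≤ C * ((t - s) ^ γ) ^ level γ) :
    ∃ K, 0 ≤ K ∧ ∀ w ∈ nonemptyWords d (level γ), ∀ s t, 0 ≤ s → s ≤ t → t ≤ T →
      ‖remainder γ W f X w s t‖ ≤ K * ((t - s) ^ γ) ^ (level γ + 1 - w.length) := by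
  obtain ⟨B, H, hB1, hH1, hBH⟩ := exists_increment_bounds hγ hW
  refine exists_uniform_const _ (fun w hw => ?_) fun w C C' hCC' h s t hs hst ht =>
    (h s t hs hst ht).trans (mul_le_mul_of_nonneg_right hCC'
      (pow_nonneg (Real.rpow_nonneg (by linarith) _) _))
  rw [nonemptyWords, Finset.mem_filter, mem_words] at hw
  have hpos := List.length_pos_iff.2 hw.2
  obtain ⟨C1, hC10, hC1⟩ := exists_norm_sub_sum_lieD_le (m := level γ + 1 - w.length) hf (by omega)
    (by omega) (contDiff_wordField hf w (by omega)) R B H (by linarith)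
  -- The ball must contain `X t` and its truncated expansion `μ`.
  obtain ⟨L, hL0, hL⟩ := exists_lipschitz_closedBall (φ := wordField f w)
    (contDiff_wordField (q := 1) hf w (by omega)) (R + C * H ^ level γ)
  refine ⟨L * (C * H ^ (w.length - 1)) + C1, by positivity, fun s t hs hst ht => ?_⟩
  obtain ⟨hH, hB⟩ := hBH s t hs hst ht
  have hω : 0 ≤ (t - s) ^ γ := Real.rpow_nonneg (by linarith) _
  have hr := hrem s t hs hst ht
  simp only [remainder, List.length_nil, Nat.sub_zero, List.append_nil] at hr
  -- Passing from `F_w(X_t)` to `F_w(μ)` costs order `N`, enough because `|w| ≥ 1`; the one-step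
  -- expansion of `F_w(μ)` has order `N + 1 - |w|`.
  set μ := ∑ u ∈ words d (level γ), increment W s t u • wordField f u (X s) with hμ
  have h1 := hC1 (X s) (hX s hs (hst.trans ht)) _ hω hH _
    (increment_isTruncatedCharacter hW ⟨hs, hst.trans ht⟩ ⟨hs.trans hst, ht⟩) hB
  rw [← hμ, show level γ + 1 - w.length - 1 = level γ - w.length by omega] at h1
  simp only [← wordField_append] at h1
  change ‖X t - μ‖ ≤ _ at hr
  have hXt := hX t (hs.trans hst) ht
  have hCH : 0 ≤ C * H ^ level γ := by positivity
  have hμR : ‖μ‖ ≤ R + C * H ^ level γ := by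
    have h2 : C * ((t - s) ^ γ) ^ level γ ≤ C * H ^ level γ :=
      mul_le_mul_of_nonneg_left (pow_le_pow_left₀ hω hH _) hC
    have := norm_le_norm_add_norm_sub' μ (X t)
    rw [norm_sub_rev] at this
    linarith
  have h3 := hL (X t) μ (by linarith) hμR
  have h4 : ((t - s) ^ γ) ^ level γ ≤
      H ^ (w.length - 1) * ((t - s) ^ γ) ^ (level γ + 1 - w.length) := by
    have := pow_le_mul_pow hω hH (by omega : level γ + 1 - w.length ≤ level γ)
    rwa [show level γ - (level γ + 1 - w.length) = w.length - 1 by omega] at this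
  calc ‖remainder γ W f X w s t‖
      ≤ ‖wordField f w (X t) - wordField f w μ‖ + _ := norm_sub_le_norm_sub_add_norm_sub _ _ _
    _ ≤ L * (C * (H ^ (w.length - 1) * ((t - s) ^ γ) ^ (level γ + 1 - w.length))) +
        C1 * ((t - s) ^ γ) ^ (level γ + 1 - w.length) :=
      add_le_add (h3.trans (mul_le_mul_of_nonneg_left
        (hr.trans (mul_le_mul_of_nonneg_left h4 hC)) hL0)) h1
    _ = _ := by ring

/-- By Chen's relation the defect is a sum of `W_{ut}`-coefficients times remainders of `Y` from `s`
to `u`, and the orders `|w|` and `N + 1 - |w|` add up. The empty word has coefficient 1, with no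
smallness, hence the requirement `Y r [] = 0`. -/
theorem norm_germ_defect_le (hγ : 0 < γ) (hW : IsGeometricRoughPath T γ W) {B K : ℝ}
    (hB : 0 ≤ B) (hK : 0 ≤ K) {s u t : ℝ} (hs : 0 ≤ s) (hsu : s ≤ u) (hut : u ≤ t) (ht : t ≤ T)
    (hinc : ∀ w : Word d, w.length ≤ level γ →
      |increment W u t w| ≤ B * ((t - u) ^ γ) ^ w.length)
    {Y : ℝ → Word d → E} (hY0 : ∀ r, Y r [] = 0)
    (hY : ∀ w ∈ nonemptyWords d (level γ),
      ‖Y u w - ∑ v ∈ words d (level γ - w.length), increment W s u v • Y s (v ++ w)‖ ≤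
        K * ((u - s) ^ γ) ^ (level γ + 1 - w.length)) :
    ‖∑ w ∈ words d (level γ), increment W s t w • Y s w -
      ∑ w ∈ words d (level γ), increment W s u w • Y s w -
      ∑ w ∈ words d (level γ), increment W u t w • Y u w‖ ≤
      (nonemptyWords d (level γ)).card * (B * K) * (t - s) ^ (((level γ : ℝ) + 1) * γ) := by
  have h1 : ∑ w ∈ words d (level γ), increment W s t w • Y s w =
      ∑ w ∈ words d (level γ), increment W u t w •
        ∑ v ∈ words d (level γ - w.length), increment W s u v • Y s (v ++ w) := by
    rw [← sum_conv_smul]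
    refine Finset.sum_congr rfl fun w hw => ?_
    rw [conv_increment hγ hW ⟨hs.trans hsu, hut.trans ht⟩ (mem_words.1 hw)]
  have hone : increment W u t [] = 1 := (increment_isTruncatedCharacter hW
    ⟨hs.trans hsu, hut.trans ht⟩ ⟨hs.trans (hsu.trans hut), ht⟩).map_one
  rw [h1, sum_words_eq _ fun w => increment W u t w • _,
    sum_words_eq _ fun w => increment W u t w • Y u w, hY0, hone]
  simp only [List.append_nil, List.length_nil, Nat.sub_zero, one_smul, smul_zero, zero_add]
  rw [add_sub_cancel_left, ← Finset.sum_sub_distrib, ← Nat.cast_succ,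
    rpow_natCast_mul_eq (by linarith), mul_assoc, ← nsmul_eq_mul, ← Finset.sum_const]
  refine norm_sum_le_of_le _ fun w hw => ?_
  have hlen := mem_words.1 (Finset.mem_filter.1 hw).1
  rw [← smul_sub, norm_smul, Real.norm_eq_abs, norm_sub_rev]
  have e0 : 0 ≤ (t - u) ^ γ := Real.rpow_nonneg (by linarith) _
  have e0' : 0 ≤ (u - s) ^ γ := Real.rpow_nonneg (by linarith) _
  have e0'' : 0 ≤ (t - s) ^ γ := Real.rpow_nonneg (by linarith) _
  have e1 : (t - u) ^ γ ≤ (t - s) ^ γ := Real.rpow_le_rpow (by linarith) (by linarith) hγ.le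
  have e2 : (u - s) ^ γ ≤ (t - s) ^ γ := Real.rpow_le_rpow (by linarith) (by linarith) hγ.le
  calc _ ≤ (B * ((t - s) ^ γ) ^ w.length) * (K * ((t - s) ^ γ) ^ (level γ + 1 - w.length)) :=
        mul_le_mul ((hinc w hlen).trans (mul_le_mul_of_nonneg_left
          (pow_le_pow_left₀ e0 e1 _) hB)) ((hY w hw).trans (mul_le_mul_of_nonneg_left
          (pow_le_pow_left₀ e0' e2 _) hK)) (norm_nonneg _) (by positivity)
    _ = B * K * (((t - s) ^ γ) ^ w.length * ((t - s) ^ γ) ^ (level γ + 1 - w.length)) := by ring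
    _ = _ := by rw [← pow_add, show w.length + (level γ + 1 - w.length) = level γ + 1 by omega]

theorem exists_sewing_wordField [ProperSpace E] (hT : 0 ≤ T) (hγ : 0 < γ) (hγ' : γ ≤ 1)
    (hW : IsGeometricRoughPath T γ W)
    (hf : ∀ i, ContDiff ℝ (level γ) (f i)) {X : ℝ → E} {R C : ℝ}
    (hX : ∀ t, 0 ≤ t → t ≤ T → ‖X t‖ ≤ R) (hC : 0 ≤ C)
    (hrem : ∀ s t, 0 ≤ s → s ≤ t → t ≤ T →
      ‖remainder γ W f X [] s t‖ ≤ C * ((t - s) ^ γ) ^ level γ) (i : Fin d) :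
    ∃ (J : ℝ → E) (K : ℝ), 0 ≤ K ∧ ∀ s t, 0 ≤ s → s ≤ t → t ≤ T →
      ‖J t - J s - ∑ w ∈ words d (level γ - 1),
        increment W s t (w ++ [i]) • wordField f (w ++ [i]) (X s)‖ ≤
          K * (t - s) ^ (((level γ : ℝ) + 1) * γ) := by
  obtain ⟨B, H, hB1, -, hBH⟩ := exists_increment_bounds hγ hW
  obtain ⟨K, hK0, hK⟩ := exists_remainder_bound hγ hW hf hX hC hrem
  -- Only words ending in `i` are kept. Prepending letters to a non-empty word preserves this, so
  -- each remainder of `Y` is one of `F_w(X)` or zero.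
  set Y : ℝ → Word d → E := fun s w => if w.getLast? = some i then wordField f w (X s) else 0
    with hYdef
  have hY : ∀ w ∈ nonemptyWords d (level γ), ∀ s u, 0 ≤ s → s ≤ u → u ≤ T →
      ‖Y u w - ∑ v ∈ words d (level γ - w.length), increment W s u v • Y s (v ++ w)‖ ≤
        K * ((u - s) ^ γ) ^ (level γ + 1 - w.length) := by
    intro w hw s u hs hsu hu
    have hlast : ∀ v : Word d, (v ++ w).getLast? = w.getLast? := fun v =>
      List.getLast?_append_of_ne_nil _ (Finset.mem_filter.1 hw).2
    simp only [hYdef, hlast]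
    split_ifs with h
    · exact hK w hw s u hs hsu hu
    · simp only [smul_zero, Finset.sum_const_zero, sub_self, norm_zero]
      exact mul_nonneg hK0 (pow_nonneg (Real.rpow_nonneg (by linarith) _) _)
  obtain ⟨J, K', hK'0, hJ⟩ := exists_sewing
    (Ξ := fun s t => ∑ w ∈ words d (level γ), increment W s t w • Y s w) hT
    (by positivity) (one_lt_level_add_one_mul hγ) fun s u t hs hsu hut ht =>
      norm_germ_defect_le hγ hW (zero_le_one.trans hB1) hK0 hs hsu hut ht
        (hBH u t (hs.trans hsu) hut ht).2 (fun r => by simp [hYdef])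
        fun w hw => hY w hw s u hs hsu (hut.trans ht)
  refine ⟨J, K', hK'0, fun s t hs hst ht => ?_⟩
  rw [← sum_words_getLast (one_le_level hγ hγ') i
    fun w => increment W s t w • wordField f w (X s)]
  have := hJ s t hs hst ht
  simp only [hYdef, smul_ite, smul_zero] at this
  exact this

theorem sum_sum_words_append_singleton {M : Type*} [AddCommMonoid M] (hγ : 0 < γ) (hγ' : γ ≤ 1)
    (H : Word d → M) :
    ∑ i, ∑ w ∈ words d (level γ - 1), H (w ++ [i]) = ∑ w ∈ nonemptyWords d (level γ), H w := by
  simp only [← sum_words_getLast (one_le_level hγ hγ')]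
  rw [Finset.sum_comm, sum_words_eq]
  simp only [List.getLast?_nil, reduceCtorEq, if_false, Finset.sum_const_zero, zero_add]
  refine Finset.sum_congr rfl fun w hw => ?_
  rw [List.getLast?_eq_some_getLast (Finset.mem_filter.1 hw).2]
  simp

theorem norm_sub_sub_sum_eq_remainder (hW : IsGeometricRoughPath T γ W) (X : ℝ → E) {s t : ℝ}
    (hs : s ∈ Set.Icc 0 T) (ht : t ∈ Set.Icc 0 T) :
    X t - X s - ∑ w ∈ nonemptyWords d (level γ), increment W s t w • wordField f w (X s) =
      remainder γ W f X [] s t := by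
  simp only [remainder, List.length_nil, Nat.sub_zero, List.append_nil]
  rw [sum_words_eq, (increment_isTruncatedCharacter hW hs ht).map_one, one_smul]
  simp only [wordField, id]
  abel

end Expansions

/-! ### Contraction by bisection -/

section Contraction

theorem exists_bound_of_holderOnWith {E : Type*} [NormedAddCommGroup E] {T : ℝ} {X : ℝ → E} {C : NNReal} {r : NNReal}
    (hX : HolderOnWith C r X (Set.Icc 0 T)) : ∃ R, ∀ t, 0 ≤ t → t ≤ T → ‖X t‖ ≤ R := by
  refine ⟨‖X 0‖ + C * T ^ (r : ℝ), fun t ht0 ht => ?_⟩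
  have h0 : (0 : ℝ) ∈ Set.Icc 0 T := ⟨le_rfl, ht0.trans ht⟩
  have h1 := hX.dist_le (show t ∈ Set.Icc 0 T from ⟨ht0, ht⟩) h0
  rw [dist_eq_norm, Real.dist_eq, sub_zero, abs_of_nonneg ht0] at h1
  have h2 : (C : ℝ) * t ^ (r : ℝ) ≤ C * T ^ (r : ℝ) :=
    mul_le_mul_of_nonneg_left (Real.rpow_le_rpow ht0 ht r.2) C.2
  have h3 := norm_le_norm_add_norm_sub' (X t) (X 0)
  linarith

theorem exists_le_of_contraction {P : ℝ → Prop} {κ Q : ℝ} (hκ0 : 0 ≤ κ) (hκ1 : κ < 1)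
    (hQ : 0 ≤ Q) (hP : P Q) (h : ∀ q, 0 ≤ q → P q → P (κ * q)) {ε : ℝ} (hε : 0 < ε) :
    ∃ q, q < ε ∧ P q := by
  have h1 : ∀ n : ℕ, P (κ ^ n * Q) := fun n => by
    induction n with
    | zero => simpa using hP
    | succ n ih =>
      rw [pow_succ', mul_assoc]
      exact h _ (by positivity) ih
  have h2 : Filter.Tendsto (fun n : ℕ => κ ^ n * Q) Filter.atTop (nhds 0) := by
    simpa using (tendsto_pow_atTop_nhds_zero_of_lt_one hκ0 hκ1).mul_const Q
  obtain ⟨n, hn⟩ := (h2.eventually (gt_mem_nhds hε)).exists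
  exact ⟨_, hn, h1 n⟩

/-- Bisection: two halves give `2 * 2 ^ (-θ) * Q`, and the defect adds `A`. -/
theorem norm_le_of_almost_additive {E : Type*} [NormedAddCommGroup E] {e : ℝ → ℝ → E}
    {a b Q A θ : ℝ}
    (he : ∀ s u t, a ≤ s → s ≤ u → u ≤ t → t ≤ b → ‖e s t - e s u - e u t‖ ≤ A * (t - s) ^ θ)
    (hbound : ∀ s t, a ≤ s → s ≤ t → t ≤ b → ‖e s t‖ ≤ Q * (t - s) ^ θ) {s t : ℝ} (hs : a ≤ s)
    (hst : s ≤ t) (ht : t ≤ b) : ‖e s t‖ ≤ (2 ^ (1 - θ) * Q + A) * (t - s) ^ θ := by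
  have h1 := he s ((s + t) / 2) t hs (by linarith) (by linarith) ht
  have h2 := hbound s ((s + t) / 2) hs (by linarith) (by linarith)
  have h3 := hbound ((s + t) / 2) t (by linarith) (by linarith) ht
  have hL : ((t - s) / 2) ^ θ = 2 ^ (1 - θ) / 2 * (t - s) ^ θ := by
    rw [Real.div_rpow (by linarith) (by norm_num), Real.rpow_sub (by norm_num), Real.rpow_one]
    field_simp
  rw [show (s + t) / 2 - s = (t - s) / 2 by ring, hL] at h2
  rw [show t - (s + t) / 2 = (t - s) / 2 by ring, hL] at h3
  have h4 : ‖e s t‖ ≤ ‖e s t - e s ((s + t) / 2) - e ((s + t) / 2) t‖ +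
      ‖e s ((s + t) / 2)‖ + ‖e ((s + t) / 2) t‖ := by
    have : e s t = (e s t - e s ((s + t) / 2) - e ((s + t) / 2) t) +
      e s ((s + t) / 2) + e ((s + t) / 2) t := by abel
    conv_lhs => rw [this]
    exact norm_add₃_le
  calc ‖e s t‖ ≤ A * (t - s) ^ θ + Q * (2 ^ (1 - θ) / 2 * (t - s) ^ θ) +
        Q * (2 ^ (1 - θ) / 2 * (t - s) ^ θ) := by linarith
    _ = _ := by ring

theorem two_rpow_one_sub_lt_one {θ : ℝ} (hθ : 1 < θ) : (2 : ℝ) ^ (1 - θ) < 1 :=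
  Real.rpow_lt_one_of_one_lt_of_neg (by norm_num) (by linarith)

/-- Increments are exactly additive, so each bisection improves the constant by the factor `2 ^ (1 -
θ) < 1`. -/
theorem eq_of_norm_sub_le_rpow {E : Type*} [NormedAddCommGroup E] {g : ℝ → E} {a b K θ : ℝ}
    (hK : 0 ≤ K) (hθ : 1 < θ)
    (hg : ∀ s t, a ≤ s → s ≤ t → t ≤ b → ‖g t - g s‖ ≤ K * (t - s) ^ θ) (hab : a ≤ b) :
    g b = g a := by
  rw [← sub_eq_zero, ← norm_le_zero_iff]
  have hpos : 0 ≤ (b - a) ^ θ := Real.rpow_nonneg (by linarith) _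
  refine le_of_forall_pos_le_add fun ε hε => ?_
  obtain ⟨q, hq, hP⟩ := exists_le_of_contraction
    (P := fun q => ∀ s t, a ≤ s → s ≤ t → t ≤ b → ‖g t - g s‖ ≤ q * (t - s) ^ θ)
    (by positivity) (two_rpow_one_sub_lt_one hθ) hK hg (fun q hq hP s t hs hst ht => by
      have := norm_le_of_almost_additive (e := fun s t => g t - g s) (A := 0)
        (fun s u t _ _ _ _ => by
          rw [show g t - g s - (g u - g s) - (g t - g u) = 0 by abel]; simp) hP hs hst ht
      rwa [add_zero] at this) (ε := ε / ((b - a) ^ θ + 1)) (by positivity)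
  have := hP a b le_rfl hab le_rfl
  rw [lt_div_iff₀ (by positivity)] at hq
  rcases le_or_gt 0 q with h0 | h0
  · nlinarith
  · nlinarith [mul_nonpos_of_nonpos_of_nonneg h0.le hpos]

end Contraction

/-! ### Lifted solutions versus Davie's expansion -/

section Solutions

variable {d : ℕ} {E : Type*} [NormedAddCommGroup E] [NormedSpace ℝ E] {T γ : ℝ}
  {W : ℝ → Word d → ℝ} {f : Fin d → E → E}

theorem HasDavieExpansion.congr {X Y : ℝ → E} (h : HasDavieExpansion T γ W f X)
    (hXY : ∀ t ∈ Set.Icc 0 T, X t = Y t) : HasDavieExpansion T γ W f Y := by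
  obtain ⟨C, hC⟩ := h
  refine ⟨C, fun s t hs hst ht => ?_⟩
  have h1 := hC s t hs hst ht
  simp only [hXY s ⟨hs, hst.le.trans ht⟩, hXY t ⟨hs.trans hst.le, ht⟩] at h1
  exact h1

/-- The expansion from `s = 0` alone bounds the path, with no prior regularity. -/
theorem exists_bound_of_hasDavieExpansion (hγ : 0 < γ)
    (hW : IsGeometricRoughPath T γ W) {X : ℝ → E} (h : HasDavieExpansion T γ W f X) :
    ∃ R, ∀ t, 0 ≤ t → t ≤ T → ‖X t‖ ≤ R := by
  obtain ⟨C, hC0, hC⟩ := (hasDavieExpansion_iff hγ hW X).1 h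
  obtain ⟨B, H, hB1, hH1, hBH⟩ := exists_increment_bounds hγ hW
  refine ⟨C * H ^ (level γ + 1) +
    ∑ u ∈ words d (level γ), B * H ^ u.length * ‖wordField f u (X 0)‖, fun t ht0 ht => ?_⟩
  obtain ⟨hH, hB⟩ := hBH 0 t le_rfl ht0 ht
  have hω : 0 ≤ (t - 0) ^ γ := Real.rpow_nonneg (by linarith) _
  have h1 := hC 0 t le_rfl ht0 ht
  simp only [remainder, List.length_nil, Nat.sub_zero, List.append_nil] at h1
  set μ := ∑ u ∈ words d (level γ), increment W 0 t u • wordField f u (X 0) with hμ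
  change ‖X t - μ‖ ≤ _ at h1
  have h2 : ‖μ‖ ≤ ∑ u ∈ words d (level γ), B * H ^ u.length * ‖wordField f u (X 0)‖ := by
    refine norm_sum_le_of_le _ fun u hu => ?_
    rw [norm_smul, Real.norm_eq_abs]
    refine mul_le_mul_of_nonneg_right ((hB u (mem_words.1 hu)).trans ?_) (norm_nonneg _)
    exact mul_le_mul_of_nonneg_left (pow_le_pow_left₀ hω hH _) (by linarith)
  have h3 : C * ((t - 0) ^ γ) ^ (level γ + 1) ≤ C * H ^ (level γ + 1) :=
    mul_le_mul_of_nonneg_left (pow_le_pow_left₀ hω hH _) hC0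
  have h4 := norm_le_norm_add_norm_sub' (X t) μ
  linarith

theorem exists_remainder_nil_bound (hγ : 0 < γ) (hW : IsGeometricRoughPath T γ W) {X : ℝ → E}
    (h : HasDavieExpansion T γ W f X) :
    ∃ C, 0 ≤ C ∧ ∀ s t, 0 ≤ s → s ≤ t → t ≤ T →
      ‖remainder γ W f X [] s t‖ ≤ C * ((t - s) ^ γ) ^ level γ := by
  obtain ⟨C, hC0, hC⟩ := (hasDavieExpansion_iff hγ hW X).1 h
  obtain ⟨B, H, hB1, hH1, hBH⟩ := exists_increment_bounds hγ hW
  refine ⟨C * H, by positivity, fun s t hs hst ht => (hC s t hs hst ht).trans ?_⟩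
  have h1 := pow_le_mul_pow (Real.rpow_nonneg (by linarith : 0 ≤ t - s) γ)
    (hBH s t hs hst ht).1 (Nat.le_succ (level γ))
  rw [Nat.succ_sub le_rfl, Nat.sub_self, pow_one] at h1
  rw [mul_assoc]
  exact mul_le_mul_of_nonneg_left h1 hC0

theorem IsRDELift.initial {x : E} {M : ℕ} (hT : 0 ≤ T) (hM : 1 ≤ M) {Z : ℝ → Word d → E}
    (hZ : IsRDELift T γ W f M x Z) : Z 0 [] = x := by
  obtain ⟨-, J, hJ, hZJ⟩ := hZ
  have h0 : (0 : ℝ) ∈ Set.Icc 0 T := ⟨le_rfl, hT⟩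
  have hJ0 : ∀ i, J i 0 [] = 0 := fun i => by
    by_contra hne
    obtain ⟨δ, -, hδ⟩ := ((hJ i) 0 h0).1 _ (norm_pos_iff.2 hne)
    -- The one-point partition of `[0,0]` has an empty Riemann sum.
    have := hδ 0 (fun _ => 0) (Subsingleton.strictMono (α := Fin 1) _) rfl rfl fun j => j.elim0
    simp at this
  rw [hZJ 0 h0 [] (by simp; omega), if_pos rfl, Finset.sum_eq_zero fun i _ => hJ0 i, add_zero]

/-- The coefficient at `vi` is that of a lift at `v`, which involves only coefficients of length at
most `|v|`; induction and Faà di Bruno identify it. -/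
theorem IsRDELift.coeff_eq {x : E} {M : ℕ} (hM : M ≤ level γ + 1)
    (hf : ∀ i, ContDiff ℝ (level γ) (f i)) {Z : ℝ → Word d → E}
    (hZ : IsRDELift T γ W f M x Z) {t : ℝ} (ht : t ∈ Set.Icc 0 T) (w : Word d)
    (hw : w.length < M) : Z t w = wordField f w (Z t []) := by
  obtain ⟨-, J, hJ, hZJ⟩ := hZ
  induction hn : w.length using Nat.strong_induction_on generalizing w with
  | _ n ih =>
    rcases List.eq_nil_or_concat w with rfl | ⟨v, i, rfl⟩
    · rfl
    rw [List.concat_eq_append] at hw hn ⊢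
    rw [List.length_append, List.length_singleton] at hw hn
    rw [hZJ t ht _ (by simpa using hw), if_neg (by simp), zero_add,
      Finset.sum_eq_single_of_mem i (Finset.mem_univ i)]
    · rw [((hJ i t ht).2 v (by omega)).1, wordField_append_singleton]
      exact compLift_eq_lieD hf (hf i) v (by omega) (by omega)
        fun u hu => ih u.length (by omega) u (by omega) rfl
    · intro j _ hj
      exact ((hJ j t ht).2 v (by omega)).2 i hj.symm

theorem compLift_eq_wordField (hf : ∀ i, ContDiff ℝ (level γ) (f i)) {M : ℕ}
    (hM : level γ ≤ M) {Z : ℝ → Word d → E}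
    {t : ℝ} (hZ : ∀ w : Word d, w.length < M → Z t w = wordField f w (Z t [])) (i : Fin d)
    {w : Word d} (hw : w.length < level γ) :
    compLift (f i) Z t w = wordField f (w ++ [i]) (Z t []) := by
  rw [wordField_append_singleton]
  exact compLift_eq_lieD hf (hf i) w (by omega) (by omega) fun u hu => hZ u (by omega)

theorem IsRDELift.hasDavieExpansion [ProperSpace E] {x : E} {M : ℕ} (hT : 0 ≤ T) (hγ : 0 < γ)
    (hγ' : γ ≤ 1) (hW : IsGeometricRoughPath T γ W) (hM : M = level γ ∨ M = level γ + 1)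
    (hf : ∀ i, ContDiff ℝ (level γ) (f i)) {Z : ℝ → Word d → E}
    (hZ : IsRDELift T γ W f M x Z) : HasDavieExpansion T γ W f fun t => Z t [] := by
  have hN := one_le_level hγ hγ'
  have hcoeff := fun t (ht : t ∈ Set.Icc 0 T) w (hw : w.length < M) =>
    hZ.coeff_eq (by omega) hf ht w hw
  obtain ⟨⟨C0, hC0⟩, hexp⟩ := hZ.1 [] (by simp; omega)
  obtain ⟨R, hR⟩ := exists_bound_of_holderOnWith hC0
  have hM1 : (((M : ℝ) - ([] : Word d).length) * γ) = (M : ℝ) * γ := by simp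
  have hpair : ∀ s, 0 ≤ s → s ≤ T → ∀ t,
      pairing (M - 1) (conv (increment W s t) (dualBasis [])) (Z s) =
      ∑ u ∈ words d (M - 1), increment W s t u • wordField f u (Z s []) := by
    intro s hs hsT t
    rw [pairing_conv_dualBasis _ (Nat.zero_le _)]
    refine Finset.sum_congr rfl fun u hu => ?_
    rw [List.append_nil, hcoeff s ⟨hs, hsT⟩ u (by
      have := mem_words.1 hu
      omega)]
  rw [hM1, eqUpTo_iff fun s hs hsT => by
    rw [hpair s hs hsT, sum_increment_self_smul hγ hW ⟨hs, hsT⟩ (by omega)]; rfl] at hexp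
  obtain ⟨C, hC, hexp⟩ := hexp
  rw [hasDavieExpansion_iff hγ hW]
  rcases hM with rfl | rfl
  · obtain ⟨B, H, hB1, hH1, hBH⟩ := exists_increment_bounds hγ hW
    obtain ⟨K, hK0, hK⟩ := exists_bound_closedBall (words d (level γ))
      (g := fun u => wordField f u)
      (fun u hu => continuous_wordField hf (mem_words.1 hu)) R
    -- Controlledness stops at words of length `N - 1`. Adding those of length `N` costs order `N`,
    -- the accuracy at hand and all that sewing requires.
    have hrem : ∀ s t, 0 ≤ s → s ≤ t → t ≤ T →
        ‖remainder γ W f (fun t => Z t []) [] s t‖ ≤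
          (C + (words d (level γ)).card * (B * H ^ level γ * K)) * ((t - s) ^ γ) ^ level γ := by
      intro s t hs hst ht
      obtain ⟨hH, hB⟩ := hBH s t hs hst ht
      have h1 := hexp s t hs hst ht
      rw [hpair s hs (hst.trans ht)] at h1
      have h2 := norm_sum_increment_sub_le hK0 (zero_le_one.trans hB1) hB hst hH1 hH
        (Nat.sub_le (level γ) 1) le_rfl (fun u => wordField f u (Z s []))
        fun u hu => hK u hu _ (hR s hs (hst.trans ht))
      rw [Nat.sub_add_cancel hN, norm_sub_rev] at h2
      rw [add_mul]
      simp only [remainder, List.length_nil, Nat.sub_zero, List.append_nil]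
      exact (norm_sub_le_norm_sub_add_norm_sub _ _ _).trans (add_le_add h1 h2)
    obtain ⟨-, J, hJ, hZJ⟩ := hZ
    have hsew := fun i => exists_sewing_wordField hT hγ hγ' hW hf hR (by positivity) hrem i
    choose I K' hK'0 hI using hsew
    -- The integral in the equation is known only as a limit of Riemann sums; uniqueness of that
    -- limit transfers the sewing estimate to it.
    have hJI : ∀ i t, 0 ≤ t → t ≤ T → J i t [] = I i t - I i 0 := by
      intro i t ht0 ht
      refine ((hJ i) t ⟨ht0, ht⟩).1.unique ht0 (isRoughIntegral_of_norm_sub_le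
        (one_lt_level_add_one_mul hγ) (hK'0 i) (fun a b ha hab hb => ?_) ht)
      rw [Finset.sum_congr rfl fun w hw => by
        rw [compLift_eq_wordField hf le_rfl (hcoeff a ⟨ha, hab.trans hb⟩) i
          (by have := mem_words.1 hw; omega)]]
      exact hI i a b ha hab hb
    refine ⟨∑ i, K' i, Finset.sum_nonneg fun i _ => hK'0 i, fun s t hs hst ht => ?_⟩
    have hst' : Z t [] - Z s [] = ∑ i, (I i t - I i s) := by
      rw [hZJ t ⟨hs.trans hst, ht⟩ [] (by simp; omega),
        hZJ s ⟨hs, hst.trans ht⟩ [] (by simp; omega), add_sub_add_left_eq_sub,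
        ← Finset.sum_sub_distrib]
      refine Finset.sum_congr rfl fun i _ => ?_
      rw [hJI i t (hs.trans hst) ht, hJI i s hs (hst.trans ht)]
      abel
    rw [← norm_sub_sub_sum_eq_remainder hW _ ⟨hs, hst.trans ht⟩ ⟨hs.trans hst, ht⟩, hst',
      ← sum_sum_words_append_singleton hγ hγ', ← Finset.sum_sub_distrib, Finset.sum_mul]
    refine norm_sum_le_of_le _ fun i _ => ?_
    rw [← rpow_natCast_mul_eq (by linarith), Nat.cast_succ]
    exact hI i s t hs hst ht
  · refine ⟨C, hC, fun s t hs hst ht => ?_⟩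
    have h1 := hexp s t hs hst ht
    rw [hpair s hs (hst.trans ht), Nat.add_sub_cancel] at h1
    simp only [remainder, List.length_nil, Nat.sub_zero, List.append_nil]
    exact h1

theorem isRDELift_of_hasDavieExpansion [ProperSpace E] {M : ℕ} (hT : 0 ≤ T) (hγ : 0 < γ)
    (hγ' : γ ≤ 1) (hW : IsGeometricRoughPath T γ W) (hM : M = level γ ∨ M = level γ + 1)
    (hf : ∀ i, ContDiff ℝ (level γ) (f i)) {Z : ℝ → Word d → E}
    (hZ : HasDavieExpansion T γ W f fun t => Z t [])
    (hcoeff : ∀ t ∈ Set.Icc 0 T, ∀ w : Word d, w.length < M → Z t w = wordField f w (Z t [])) :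
    IsRDELift T γ W f M (Z 0 []) Z := by
  have hN := one_le_level hγ hγ'
  obtain ⟨R, hR⟩ := exists_bound_of_hasDavieExpansion hγ hW hZ
  obtain ⟨C, hC0, hC⟩ := exists_remainder_nil_bound hγ hW hZ
  obtain ⟨B, H, hB1, hH1, hBH⟩ := exists_increment_bounds hγ hW
  obtain ⟨K, hK0, hK⟩ := exists_bound_closedBall (words d (level γ))
    (g := fun u => wordField f u) (fun u hu => continuous_wordField hf (mem_words.1 hu)) R
  have hrem : ∀ w : Word d, w.length ≤ level γ → ∃ L, 0 ≤ L ∧ ∀ s t, 0 ≤ s → s ≤ t → t ≤ T →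
      ‖remainder γ W f (fun t => Z t []) w s t‖ ≤ L * ((t - s) ^ γ) ^ (level γ + 1 - w.length) := by
    intro w hw
    rcases eq_or_ne w [] with rfl | hne
    · exact (hasDavieExpansion_iff hγ hW _).1 hZ
    obtain ⟨L, hL0, hL⟩ := exists_remainder_bound hγ hW hf hR hC0 hC
    exact ⟨L, hL0, hL w (Finset.mem_filter.2 ⟨mem_words.2 hw, hne⟩)⟩
  -- Truncating at length `m` leaves order `m + 1`. Below, `m = 0` gives Hölder continuity and `m =
  -- M - 1 - |w|` gives controlledness.
  have htrunc : ∀ w : Word d, w.length ≤ level γ → ∀ m ≤ level γ - w.length, ∃ L, 0 ≤ L ∧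
      ∀ s t, 0 ≤ s → s ≤ t → t ≤ T →
      ‖wordField f w (Z t []) - ∑ u ∈ words d m, increment W s t u • wordField f (u ++ w) (Z s [])‖
        ≤ L * ((t - s) ^ γ) ^ (m + 1) := by
    intro w hw m hm
    obtain ⟨L, hL0, hL⟩ := hrem w hw
    refine ⟨L * H ^ (level γ + 1 - w.length - (m + 1)) +
      (words d (level γ - w.length)).card * (B * H ^ level γ * K), by positivity,
      fun s t hs hst ht => ?_⟩
    obtain ⟨hH, hB⟩ := hBH s t hs hst ht
    have h1 := hL s t hs hst ht
    have h2 := norm_sum_increment_sub_le hK0 (zero_le_one.trans hB1) hB hst hH1 hH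
      hm (Nat.sub_le _ _) (fun u => wordField f (u ++ w) (Z s [])) fun u hu =>
        hK (u ++ w) (mem_words.2 (by have := mem_words.1 hu; simp; omega)) _
          (hR s hs (hst.trans ht))
    have h3 := mul_le_mul_of_nonneg_left (pow_le_mul_pow
      (Real.rpow_nonneg (by linarith : 0 ≤ t - s) γ) hH
      (by omega : m + 1 ≤ level γ + 1 - w.length)) hL0
    rw [add_mul, mul_assoc]
    exact (norm_sub_le_norm_sub_add_norm_sub _ _ _).trans (add_le_add (h1.trans h3) h2)
  refine ⟨fun w hw => ⟨?_, ?_⟩, ?_⟩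
  · obtain ⟨L, hL0, hL⟩ := htrunc w (by omega) 0 (Nat.zero_le _)
    have hL' : ∀ s t, 0 ≤ s → s ≤ t → t ≤ T → ‖Z t w - Z s w‖ ≤ L * (t - s) ^ γ := by
      intro s t hs hst ht
      have h1 := hL s t hs hst ht
      have hw0 : words d 0 = {[]} := by
        ext u; simp [mem_words]
      rw [hw0, Finset.sum_singleton, (increment_isTruncatedCharacter hW ⟨hs, hst.trans ht⟩
        ⟨hs.trans hst, ht⟩).map_one, one_smul, List.nil_append, zero_add, pow_one] at h1
      rwa [hcoeff t ⟨hs.trans hst, ht⟩ w hw, hcoeff s ⟨hs, hst.trans ht⟩ w hw]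
    refine ⟨⟨L, hL0⟩, ?_⟩
    intro s hs t ht
    have key : dist (Z s w) (Z t w) ≤ L * dist s t ^ γ := by
      rcases le_total s t with hst | hst
      · rw [dist_comm, dist_eq_norm, dist_comm, Real.dist_eq, abs_of_nonneg (by linarith)]
        exact hL' s t hs.1 hst ht.2
      · rw [dist_eq_norm, Real.dist_eq, abs_of_nonneg (by linarith)]
        exact hL' t s ht.1 hst hs.2
    rw [Real.coe_toNNReal _ hγ.le, edist_dist, edist_dist,
      ENNReal.ofReal_rpow_of_nonneg dist_nonneg hγ.le]
    refine (ENNReal.ofReal_le_ofReal key).trans ?_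
    rw [ENNReal.ofReal_mul hL0, ENNReal.ofReal_eq_coe_nnreal hL0]
    exact le_rfl
  · rw [show ((M : ℝ) - w.length) * γ = ((M - w.length : ℕ) : ℝ) * γ by
      rw [Nat.cast_sub hw.le]]
    have hpair : ∀ s, 0 ≤ s → s ≤ T → ∀ t,
        pairing (M - 1) (conv (increment W s t) (dualBasis w)) (Z s) =
        ∑ u ∈ words d (M - 1 - w.length), increment W s t u • wordField f (u ++ w) (Z s []) := by
      intro s hs hsT t
      rw [pairing_conv_dualBasis _ (by omega)]
      refine Finset.sum_congr rfl fun u hu => ?_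
      rw [hcoeff s ⟨hs, hsT⟩ (u ++ w) (by have := mem_words.1 hu; simp; omega)]
    rw [eqUpTo_iff fun s hs hsT => by
      rw [hpair s hs hsT, sum_increment_self_smul hγ hW ⟨hs, hsT⟩ (by omega),
        hcoeff s ⟨hs, hsT⟩ w hw, List.nil_append]]
    obtain ⟨L, hL0, hL⟩ := htrunc w (by omega) (M - 1 - w.length) (by omega)
    refine ⟨L, hL0, fun s t hs hst ht => ?_⟩
    rw [hpair s hs (hst.trans ht), hcoeff t ⟨hs.trans hst, ht⟩ w hw,
      show M - w.length = M - 1 - w.length + 1 by omega]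
    exact hL s t hs hst ht
  · have hsew := fun i => exists_sewing_wordField hT hγ hγ' hW hf hR hC0 hC i
    choose I K' hK'0 hI using hsew
    have hθ := one_lt_level_add_one_mul hγ
    refine ⟨fun i t w => if w = [] then I i t - I i 0 else
      if w.getLast? = some i then compLift (f i) Z t w.dropLast else 0, fun i t ht => ⟨?_, ?_⟩, ?_⟩
    · simp only [if_true]
      refine isRoughIntegral_of_norm_sub_le hθ (hK'0 i) (fun a b ha hab hb => ?_) ht.2
      rw [Finset.sum_congr rfl fun w hw => by
        rw [compLift_eq_wordField hf (by omega) (hcoeff a ⟨ha, hab.trans hb⟩) i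
          (by have := mem_words.1 hw; omega)]]
      exact hI i a b ha hab hb
    · intro w _
      refine ⟨by simp, fun j hj => by simp [hj]⟩
    · intro t ht w hw
      rcases List.eq_nil_or_concat w with rfl | ⟨v, i, rfl⟩
      · simp only [if_true]
        obtain ⟨D, hD0, hD⟩ := (hasDavieExpansion_iff hγ hW _).1 hZ
        -- The path and the sum of the `I i` share the same germ up to order `θ > 1`, so their
        -- difference is constant.
        have h1 := eq_of_norm_sub_le_rpow (g := fun t => Z t [] - ∑ i, I i t) (a := 0) (b := t)
          (K := D + ∑ i, K' i) (add_nonneg hD0 (Finset.sum_nonneg fun i _ => hK'0 i)) hθ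
          (fun s u hs hsu hu => ?_) ht.1
        · rw [Finset.sum_sub_distrib, add_sub_left_comm, ← sub_eq_iff_eq_add', ← h1]
        have hu := hu.trans ht.2
        have h2 := hD s u hs hsu hu
        rw [← rpow_natCast_mul_eq (by linarith), Nat.cast_succ,
          ← norm_sub_sub_sum_eq_remainder hW _ ⟨hs, hsu.trans hu⟩ ⟨hs.trans hsu, hu⟩,
          ← sum_sum_words_append_singleton hγ hγ'] at h2
        have h3 := norm_sum_le_of_le Finset.univ fun i _ => hI i s u hs hsu hu
        rw [Finset.sum_sub_distrib, Finset.sum_sub_distrib, ← Finset.sum_mul] at h3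
        rw [add_mul]
        refine le_trans (le_of_eq ?_) ((norm_sub_le _ _).trans (add_le_add h2 h3))
        congr 1
        abel
      · rw [List.concat_eq_append] at hw ⊢
        rw [List.length_append, List.length_singleton] at hw
        rw [if_neg (by simp), zero_add, Finset.sum_eq_single_of_mem i (Finset.mem_univ i)]
        · simp only [List.append_eq_nil_iff, List.cons_ne_self, and_false, if_false,
            List.getLast?_append, List.dropLast_concat]
          rw [compLift_eq_wordField hf (by omega) (hcoeff t ht) i (by omega),
            hcoeff t ht _ (by simpa using hw)]
          simp
        · intro j _ hj
          simp [hj.symm]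

end Solutions

/-! ### Linearized fields and Lipschitz dependence of remainders -/

section Tangent

variable {d : ℕ} {E F : Type*} [NormedAddCommGroup E] [NormedSpace ℝ E]
  [NormedAddCommGroup F] [NormedSpace ℝ F]

/-- The linearized vector fields `(x, v) ↦ (f_i(x), Df_i(x) v)`. -/
noncomputable def tangentField (f : Fin d → E → E) (i : Fin d) (p : E × E) : E × E :=
  (f i p.1, fderiv ℝ (f i) p.1 p.2)

theorem contDiff_fderiv_prod {n : ℕ} {φ : E → F} (hφ : ContDiff ℝ (n + 1 : ℕ) φ) :
    ContDiff ℝ n fun p : E × E => fderiv ℝ φ p.1 p.2 :=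
  ((hφ.fderiv_right (m := n) (by push_cast; rfl)).comp contDiff_fst).clm_apply contDiff_snd

theorem contDiff_tangentField {n : ℕ} {f : Fin d → E → E}
    (hf : ∀ i, ContDiff ℝ (n + 1 : ℕ) (f i)) (i : Fin d) : ContDiff ℝ n (tangentField f i) :=
  (((hf i).of_le (by exact_mod_cast Nat.le_succ n)).comp contDiff_fst).prodMk
    (contDiff_fderiv_prod (hf i))

theorem hasFDerivAt_fderiv_prod {φ : E → F} (hφ : ContDiff ℝ 2 φ) (p : E × E) :
    ∃ L : E × E →L[ℝ] F, HasFDerivAt (fun p : E × E => fderiv ℝ φ p.1 p.2) L p ∧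
      ∀ q, L q = fderiv ℝ (fderiv ℝ φ) p.1 q.1 p.2 + fderiv ℝ φ p.1 q.2 := by
  have h1 : HasFDerivAt (fderiv ℝ φ) (fderiv ℝ (fderiv ℝ φ) p.1) p.1 :=
    ((hφ.fderiv_right (m := 1) (by norm_num)).differentiable (by norm_num) p.1).hasFDerivAt
  refine ⟨_, (h1.comp p hasFDerivAt_fst).clm_apply hasFDerivAt_snd, fun q => ?_⟩
  simp [add_comm]

/-- Symmetry of `D²φ` makes linearization commute with Lie derivatives. Consequently the expansion
along the tangent fields is the derivative of the original one in its starting point. -/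
theorem fderiv_fderiv_prod_tangentField {f : Fin d → E → E} {i : Fin d}
    (hf : Differentiable ℝ (f i)) {φ : E → F} (hφ : ContDiff ℝ 2 φ) (p : E × E) :
    fderiv ℝ (fun p : E × E => fderiv ℝ φ p.1 p.2) p (tangentField f i p) =
      fderiv ℝ (fun x => fderiv ℝ φ x (f i x)) p.1 p.2 := by
  obtain ⟨L, hL, hL'⟩ := hasFDerivAt_fderiv_prod hφ p
  have h1 : HasFDerivAt (fderiv ℝ φ) (fderiv ℝ (fderiv ℝ φ) p.1) p.1 :=
    ((hφ.fderiv_right (m := 1) (by norm_num)).differentiable (by norm_num) p.1).hasFDerivAt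
  rw [hL.fderiv, hL', (h1.clm_apply (hf p.1).hasFDerivAt).fderiv]
  simp [tangentField, (hφ.contDiffAt.isSymmSndFDerivAt (by simp)).eq p.2 (f i p.1), add_comm]

theorem lieD_tangentField {f : Fin d → E → E} {N p : ℕ}
    (hf : ∀ i, ContDiff ℝ (N + 1 : ℕ) (f i)) {φ : E → F} (hφ : ContDiff ℝ p φ) (u : Word d)
    (hp : u.length + 1 ≤ p) (hN : u.length ≤ N + 1) :
    lieD (tangentField f) u (fun p : E × E => fderiv ℝ φ p.1 p.2) =
      fun p : E × E => fderiv ℝ (lieD f u φ) p.1 p.2 := by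
  induction u with
  | nil => rfl
  | cons i u ih =>
    rw [List.length_cons] at hp hN
    funext q
    simp only [lieD]
    rw [ih (by omega) (by omega), fderiv_fderiv_prod_tangentField
      ((hf i).differentiable (by exact_mod_cast Nat.succ_ne_zero N))
      (contDiff_lieD (q := 2) hf hφ u (by omega) (by omega))]

theorem wordField_tangentField {f : Fin d → E → E} {N : ℕ}
    (hf : ∀ i, ContDiff ℝ (N + 1 : ℕ) (f i)) (u : Word d) (hN : u.length ≤ N + 1) :
    wordField (tangentField f) u =
      fun p : E × E => (wordField f u p.1, fderiv ℝ (wordField f u) p.1 p.2) := by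
  induction u with
  | nil =>
    funext p
    simp [wordField]
  | cons i u ih =>
    rw [List.length_cons] at hN
    have h2 : ContDiff ℝ 2 (wordField f u) := contDiff_wordField (q := 2) hf u (by omega)
    funext p
    obtain ⟨L, hL, -⟩ := hasFDerivAt_fderiv_prod h2 p
    have h3 : HasFDerivAt (fun p : E × E => wordField f u p.1)
        ((fderiv ℝ (wordField f u) p.1).comp (ContinuousLinearMap.fst ℝ E E)) p :=
      ((h2.differentiable (by norm_num)) p.1).hasFDerivAt.comp p hasFDerivAt_fst
    simp only [wordField]
    rw [ih (by omega), (h3.prodMk hL).fderiv]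
    refine Prod.ext (by simp [tangentField]) ?_
    rw [← fderiv_fderiv_prod_tangentField
      ((hf i).differentiable (by exact_mod_cast Nat.succ_ne_zero N)) h2, hL.fderiv]
    rfl

/-- The remainder of one step of the expansion depends on the initial point in a Lipschitz way. -/
theorem exists_norm_sub_sub_sum_lieD_le [ProperSpace E] [CompleteSpace F] {f : Fin d → E → E}
    {N m : ℕ} (hf : ∀ i, ContDiff ℝ (N + 1 : ℕ) (f i)) (hm1 : 1 ≤ m) (hm : m ≤ N) {φ : E → F}
    (hφ : ContDiff ℝ (m + 1 : ℕ) φ) (R B H : ℝ) (hB : 0 ≤ B) :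
    ∃ C : ℝ, 0 ≤ C ∧ ∀ x y, ‖x‖ ≤ R → ‖y‖ ≤ R → ∀ h, 0 ≤ h → h ≤ H → ∀ g : Word d → ℝ,
      IsTruncatedCharacter N g → (∀ w : Word d, w.length ≤ N → |g w| ≤ B * h ^ w.length) →
      ‖(φ (∑ u ∈ words d N, g u • wordField f u x) -
          ∑ u ∈ words d (m - 1), g u • lieD f u φ x) -
        (φ (∑ u ∈ words d N, g u • wordField f u y) -
          ∑ u ∈ words d (m - 1), g u • lieD f u φ y)‖ ≤ C * h ^ m * ‖x - y‖ := by
  obtain ⟨C, hC0, hC⟩ := exists_norm_sub_sum_lieD_le (contDiff_tangentField hf) hm1 hm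
    (contDiff_fderiv_prod hφ) (max R 1) B H hB
  refine ⟨C, hC0, fun x y hx hy h hh0 hhH g hg hgB => ?_⟩
  have hμ : ∀ z, HasFDerivAt (fun z => ∑ u ∈ words d N, g u • wordField f u z)
      (∑ u ∈ words d N, g u • fderiv ℝ (wordField f u) z) z := fun z =>
    HasFDerivAt.fun_sum fun u hu => (((contDiff_wordField (q := 1) hf u (by
      have := mem_words.1 hu; omega)).differentiable (by norm_num) z).hasFDerivAt).const_smul _
  have hP : ∀ z, HasFDerivAt (fun z => φ (∑ u ∈ words d N, g u • wordField f u z) -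
      ∑ u ∈ words d (m - 1), g u • lieD f u φ z)
      ((fderiv ℝ φ (∑ u ∈ words d N, g u • wordField f u z)).comp
        (∑ u ∈ words d N, g u • fderiv ℝ (wordField f u) z) -
        ∑ u ∈ words d (m - 1), g u • fderiv ℝ (lieD f u φ) z) z := fun z =>
    ((hφ.differentiable (by exact_mod_cast Nat.succ_ne_zero m) _).hasFDerivAt.comp z (hμ z)).sub
      (HasFDerivAt.fun_sum fun u hu => (((contDiff_lieD (q := 1) hf hφ u (by
        have := mem_words.1 hu; omega) (by
        have := mem_words.1 hu; omega)).differentiable (by norm_num) z).hasFDerivAt).const_smul _)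
  -- By the mean value inequality it suffices to bound the derivative at `z` in unit directions `v`;
  -- this is the one-step remainder of the tangent fields at `(z, v)`, whose norm is at most `max R
  -- 1`.
  refine (convex_closedBall (0 : E) R).norm_image_sub_le_of_norm_hasFDerivWithin_le
    (fun z _ => (hP z).hasFDerivWithinAt) (fun z hz => ?_) (by simpa using hy) (by simpa using hx)
  refine ContinuousLinearMap.opNorm_le_of_unit_norm (by positivity) fun v hv => ?_
  have h1 := hC (z, v) (by
    rw [Prod.norm_def, hv]
    exact max_le_max_right _ (by simpa using hz)) h hh0 hhH g hg hgB
  rw [Finset.sum_congr rfl fun u hu => by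
      rw [wordField_tangentField hf u (by have := mem_words.1 hu; omega)],
    Finset.sum_congr (s₁ := words d (m - 1)) rfl fun u hu => by
      rw [lieD_tangentField hf hφ u (by have := mem_words.1 hu; omega) (by
        have := mem_words.1 hu; omega)]] at h1
  simp only [Prod.smul_mk, Prod.fst_sum, Prod.snd_sum] at h1
  simpa using h1

/-- With `r = p' - p`, the mean value inequality for `z ↦ φ(z + r) - φ(z)` gives the product term,
and comparing `q + r` with `q'` gives the other. Since `‖r‖ ≤ 2R`, all points stay in the ball of
radius `3R`. -/
theorem exists_norm_sub_sub_sub_le [ProperSpace E] {φ : E → F} (hφ : ContDiff ℝ 2 φ) (R : ℝ) :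
    ∃ L, 0 ≤ L ∧ ∀ p p' q q', ‖p‖ ≤ R → ‖p'‖ ≤ R → ‖q‖ ≤ R → ‖q'‖ ≤ R →
      ‖(φ p' - φ p) - (φ q' - φ q)‖ ≤
        L * (‖(p' - p) - (q' - q)‖ + ‖p' - p‖ * ‖p - q‖) := by
  obtain ⟨L1, hL10, hL1⟩ := exists_lipschitz_closedBall
    (hφ.of_le (by norm_num : (1 : WithTop ℕ∞) ≤ 2)) (3 * R)
  obtain ⟨L2, hL20, hL2⟩ := exists_lipschitz_closedBall
    (hφ.fderiv_right (m := 1) (by norm_num)) (3 * R)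
  refine ⟨L1 + L2, by positivity, fun p p' q q' hp hp' hq hq' => ?_⟩
  have hR : 0 ≤ R := (norm_nonneg p).trans hp
  set r := p' - p with hr
  have hr2 : ‖r‖ ≤ 2 * R := (norm_sub_le _ _).trans (by linarith)
  have hdiff := hφ.differentiable (by norm_num : (2 : WithTop ℕ∞) ≠ 0)
  have h1 : ‖(φ (p + r) - φ p) - (φ (q + r) - φ q)‖ ≤ L2 * ‖r‖ * ‖p - q‖ := by
    refine (convex_closedBall (0 : E) R).norm_image_sub_le_of_norm_hasFDerivWithin_le
      (f := fun z => φ (z + r) - φ z) (f' := fun z => fderiv ℝ φ (z + r) - fderiv ℝ φ z)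
      (fun z _ => ?_) (fun z hz => ?_) (by simpa using hq) (by simpa using hp)
    · have h2 : HasFDerivAt (fun z => φ (z + r)) (fderiv ℝ φ (z + r)) z :=
        (hasFDerivAt_comp_add_right r).2 (hdiff (z + r)).hasFDerivAt
      exact (h2.sub (hdiff z).hasFDerivAt).hasFDerivWithinAt
    · have hz' : ‖z‖ ≤ R := by simpa using hz
      have := hL2 (z + r) z ((norm_add_le _ _).trans (by linarith)) (by linarith)
      rwa [add_sub_cancel_left] at this
  have h3 := hL1 (q + r) q' ((norm_add_le _ _).trans (by linarith)) (by linarith)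
  have h4 : (φ p' - φ p) - (φ q' - φ q) =
      ((φ (p + r) - φ p) - (φ (q + r) - φ q)) + (φ (q + r) - φ q') := by
    rw [hr, add_sub_cancel]; abel
  have h5 : q + r - q' = r - (q' - q) := by abel
  rw [h5] at h3
  rw [h4]
  have h6 := (norm_add_le _ _).trans (add_le_add h1 h3)
  have h7 : 0 ≤ L2 * ‖r - (q' - q)‖ := by positivity
  have h8 : 0 ≤ L1 * (‖r‖ * ‖p - q‖) := by positivity
  linarith

end Tangent

/-! ### Comparing the remainders of two paths -/

section Uniqueness

variable {d : ℕ} {E : Type*} [NormedAddCommGroup E] [NormedSpace ℝ E] [ProperSpace E] {T γ : ℝ}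
  {W : ℝ → Word d → ℝ} {f : Fin d → E → E}

/-- The difference version of `exists_remainder_bound`: the four-point estimate replaces the
Lipschitz bound between the path and its truncated expansion, and the Lipschitz one-step remainder
handles the rest. -/
theorem exists_remainder_sub_bound (hγ : 0 < γ) (hW : IsGeometricRoughPath T γ W)
    (hf : ∀ i, ContDiff ℝ (level γ + 1 : ℕ) (f i)) {X Y : ℝ → E} {R C : ℝ}
    (hX : ∀ t, 0 ≤ t → t ≤ T → ‖X t‖ ≤ R) (hY : ∀ t, 0 ≤ t → t ≤ T → ‖Y t‖ ≤ R) (hC : 0 ≤ C)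
    (hremX : ∀ s t, 0 ≤ s → s ≤ t → t ≤ T →
      ‖remainder γ W f X [] s t‖ ≤ C * ((t - s) ^ γ) ^ level γ)
    (hremY : ∀ s t, 0 ≤ s → s ≤ t → t ≤ T →
      ‖remainder γ W f Y [] s t‖ ≤ C * ((t - s) ^ γ) ^ level γ) :
    ∃ K, 0 ≤ K ∧ ∀ w ∈ nonemptyWords d (level γ), ∀ s t, 0 ≤ s → s ≤ t → t ≤ T →
      ‖remainder γ W f X w s t - remainder γ W f Y w s t‖ ≤
        K * (((t - s) ^ γ) ^ (level γ + 1 - w.length) * ‖X s - Y s‖ +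
          ‖remainder γ W f X [] s t - remainder γ W f Y [] s t‖) := by
  obtain ⟨B, H, hB1, hH1, hBH⟩ := exists_increment_bounds hγ hW
  refine exists_uniform_const _ (fun w hw => ?_) fun w C C' hCC' h s t hs hst ht =>
    (h s t hs hst ht).trans (mul_le_mul_of_nonneg_right hCC' (by
      have := Real.rpow_nonneg (by linarith : 0 ≤ t - s) γ
      positivity))
  rw [nonemptyWords, Finset.mem_filter, mem_words] at hw
  have hpos := List.length_pos_iff.2 hw.2
  obtain ⟨C1, hC10, hC1⟩ := exists_norm_sub_sub_sum_lieD_le (m := level γ + 1 - w.length) hf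
    (by omega) (by omega) (contDiff_wordField hf w (by omega)) R B H (by linarith)
  obtain ⟨L, hL0, hL⟩ := exists_norm_sub_sub_sub_le (φ := wordField f w)
    (contDiff_wordField (q := 2) hf w (by omega)) (R + C * H ^ level γ)
  have hlip := exists_uniform_const (words d (level γ)) (P := fun u L => ∀ x y : E, ‖x‖ ≤ R →
    ‖y‖ ≤ R → ‖wordField f u x - wordField f u y‖ ≤ L * ‖x - y‖) (fun u hu =>
      exists_lipschitz_closedBall (contDiff_wordField (q := 1) hf u (by
        have := mem_words.1 hu; omega)) R) fun u L L' hLL' h x y hx hy =>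
      (h x y hx hy).trans (mul_le_mul_of_nonneg_right hLL' (norm_nonneg _))
  obtain ⟨L', hL'0, hL'⟩ := hlip
  set A := (words d (level γ)).card * (B * H ^ level γ * L') with hA
  have hH0 : 0 ≤ H := zero_le_one.trans hH1
  have hA0 : 0 ≤ A := by positivity
  refine ⟨C1 + L * (1 + C * H ^ (w.length - 1) * A), by positivity, fun s t hs hst ht => ?_⟩
  obtain ⟨hH, hB⟩ := hBH s t hs hst ht
  have hω : 0 ≤ (t - s) ^ γ := Real.rpow_nonneg (by linarith) _
  have hrX := hremX s t hs hst ht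
  have hrY := hremY s t hs hst ht
  have hXs := hX s hs (hst.trans ht)
  have hYs := hY s hs (hst.trans ht)
  have hXt := hX t (hs.trans hst) ht
  have hYt := hY t (hs.trans hst) ht
  have h1 := hC1 (X s) (Y s) hXs hYs _ hω hH _
    (increment_isTruncatedCharacter hW ⟨hs, hst.trans ht⟩ ⟨hs.trans hst, ht⟩) hB
  have hRX : ∀ Z : ℝ → E, remainder γ W f Z [] s t =
      Z t - ∑ u ∈ words d (level γ), increment W s t u • wordField f u (Z s) := fun Z => by
    simp [remainder, wordField]
  rw [hRX] at hrX hrY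
  rw [hRX, hRX]
  simp only [remainder]
  rw [show level γ + 1 - w.length - 1 = level γ - w.length by omega] at h1
  simp only [← wordField_append] at h1
  have hμ : ‖∑ u ∈ words d (level γ), increment W s t u • wordField f u (X s) -
      ∑ u ∈ words d (level γ), increment W s t u • wordField f u (Y s)‖ ≤ A * ‖X s - Y s‖ := by
    rw [← Finset.sum_sub_distrib, hA, mul_assoc, ← nsmul_eq_mul, ← Finset.sum_const]
    refine norm_sum_le_of_le _ fun u hu => ?_
    rw [← smul_sub, norm_smul, Real.norm_eq_abs]
    calc _ ≤ (B * H ^ level γ) * (L' * ‖X s - Y s‖) := by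
          refine mul_le_mul ((hB u (mem_words.1 hu)).trans (mul_le_mul_of_nonneg_left
            ((pow_le_pow_left₀ hω hH _).trans (pow_le_pow_right₀ hH1 (mem_words.1 hu)))
            (by linarith))) (hL' u hu _ _ hXs hYs) (norm_nonneg _) (by positivity)
      _ = _ := by ring
  set μ := ∑ u ∈ words d (level γ), increment W s t u • wordField f u (X s)
  set ν := ∑ u ∈ words d (level γ), increment W s t u • wordField f u (Y s)
  have hCH : 0 ≤ C * H ^ level γ := by positivity
  have h2 : C * ((t - s) ^ γ) ^ level γ ≤ C * H ^ level γ :=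
    mul_le_mul_of_nonneg_left (pow_le_pow_left₀ hω hH _) hC
  have hμR : ‖μ‖ ≤ R + C * H ^ level γ := by
    have := norm_le_norm_add_norm_sub' μ (X t)
    rw [norm_sub_rev] at this
    linarith
  have hνR : ‖ν‖ ≤ R + C * H ^ level γ := by
    have := norm_le_norm_add_norm_sub' ν (Y t)
    rw [norm_sub_rev] at this
    linarith
  have h3 := hL μ (X t) ν (Y t) hμR (by linarith) hνR (by linarith)
  have h4 : ((t - s) ^ γ) ^ level γ ≤
      H ^ (w.length - 1) * ((t - s) ^ γ) ^ (level γ + 1 - w.length) := by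
    have := pow_le_mul_pow hω hH (by omega : level γ + 1 - w.length ≤ level γ)
    rwa [show level γ - (level γ + 1 - w.length) = w.length - 1 by omega] at this
  set ω := ((t - s) ^ γ) ^ (level γ + 1 - w.length)
  have hω0 : 0 ≤ ω := by positivity
  have h5 : ‖X t - μ‖ * ‖μ - ν‖ ≤ (C * (H ^ (w.length - 1) * ω)) * (A * ‖X s - Y s‖) :=
    mul_le_mul (hrX.trans (mul_le_mul_of_nonneg_left h4 hC)) hμ (norm_nonneg _) (by positivity)
  set SX := ∑ u ∈ words d (level γ - w.length), increment W s t u • wordField f (u ++ w) (X s)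
  set SY := ∑ u ∈ words d (level γ - w.length), increment W s t u • wordField f (u ++ w) (Y s)
  set D := ‖X t - μ - (Y t - ν)‖
  have hD0 : 0 ≤ D := norm_nonneg _
  calc ‖wordField f w (X t) - SX - (wordField f w (Y t) - SY)‖
      = ‖(wordField f w (X t) - wordField f w μ - (wordField f w (Y t) - wordField f w ν)) +
          (wordField f w μ - SX - (wordField f w ν - SY))‖ := by congr 1; abel
    _ ≤ L * (D + (C * (H ^ (w.length - 1) * ω)) * (A * ‖X s - Y s‖)) + C1 * ω * ‖X s - Y s‖ := by
        refine (norm_add_le _ _).trans (add_le_add (h3.trans ?_) h1)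
        exact mul_le_mul_of_nonneg_left (by linarith) hL0
    _ ≤ _ := by
        have e1 : 0 ≤ C1 * D := by positivity
        have e2 : 0 ≤ L * (C * H ^ (w.length - 1) * A) * D := by positivity
        have e3 : 0 ≤ L * (ω * ‖X s - Y s‖) := by positivity
        linear_combination e1 + e2 + e3

end Uniqueness

/-! ### Uniqueness and the characterization of solutions -/

section Uniqueness

variable {d : ℕ} {E : Type*} [NormedAddCommGroup E] [NormedSpace ℝ E] [ProperSpace E] {T γ : ℝ}
  {W : ℝ → Word d → ℝ} {f : Fin d → E → E}

/-- Two paths with the expansion that agree at `a` agree on a short interval `[a, b]`, whose length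
does not depend on `a`. -/
theorem exists_delta_eq_of_hasDavieExpansion (hγ : 0 < γ) (hW : IsGeometricRoughPath T γ W)
    (hf : ∀ i, ContDiff ℝ (level γ + 1 : ℕ) (f i)) {X Y : ℝ → E}
    (hX : HasDavieExpansion T γ W f X) (hY : HasDavieExpansion T γ W f Y) :
    ∃ δ > 0, ∀ a b, 0 ≤ a → a ≤ b → b ≤ T → b - a ≤ δ → X a = Y a → X b = Y b := by
  obtain ⟨RX, hRX⟩ := exists_bound_of_hasDavieExpansion hγ hW hX
  obtain ⟨RY, hRY⟩ := exists_bound_of_hasDavieExpansion hγ hW hY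
  obtain ⟨CX, hCX0, hCX⟩ := exists_remainder_nil_bound hγ hW hX
  obtain ⟨CY, hCY0, hCY⟩ := exists_remainder_nil_bound hγ hW hY
  obtain ⟨DX, hDX0, hDX⟩ := (hasDavieExpansion_iff hγ hW X).1 hX
  obtain ⟨DY, hDY0, hDY⟩ := (hasDavieExpansion_iff hγ hW Y).1 hY
  have hpos : ∀ s t : ℝ, s ≤ t → 0 ≤ ((t - s) ^ γ) ^ level γ := fun s t hst =>
    pow_nonneg (Real.rpow_nonneg (by linarith) _) _
  obtain ⟨K, hK0, hK⟩ := exists_remainder_sub_bound hγ hW hf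
    (fun t h0 h1 => (hRX t h0 h1).trans (le_max_left RX RY))
    (fun t h0 h1 => (hRY t h0 h1).trans (le_max_right RX RY)) (hCX0.trans (le_max_left CX CY))
    (fun s t hs hst ht => (hCX s t hs hst ht).trans
      (mul_le_mul_of_nonneg_right (le_max_left _ _) (hpos s t hst)))
    (fun s t hs hst ht => (hCY s t hs hst ht).trans
      (mul_le_mul_of_nonneg_right (le_max_right _ _) (hpos s t hst)))
  obtain ⟨B, H, hB1, -, hBH⟩ := exists_increment_bounds hγ hW
  have hB0 : 0 ≤ B := zero_le_one.trans hB1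
  set θ := ((level γ : ℝ) + 1) * γ with hθdef
  have hθ : 1 < θ := one_lt_level_add_one_mul hγ
  have h2 := two_rpow_one_sub_lt_one hθ
  set A : ℝ := (nonemptyWords d (level γ)).card * (B * (2 * K)) with hA
  have hA0 : 0 ≤ A := by positivity
  obtain ⟨δ, hδ0, hδ1, hδ⟩ : ∃ δ : ℝ, 0 < δ ∧ δ ^ γ ≤ 1 ∧ 2 ^ (1 - θ) + A * δ ^ γ < 1 := by
    -- `η` will be `δ ^ γ`; the choice keeps `A * η` below the gap `1 - 2 ^ (1 - θ)`.
    set η : ℝ := min 1 ((1 - 2 ^ (1 - θ)) / (2 * (A + 1)))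
    have hη0 : 0 < η := lt_min one_pos (div_pos (by linarith) (by positivity))
    refine ⟨η ^ γ⁻¹, Real.rpow_pos_of_pos hη0 _, ?_⟩
    rw [← Real.rpow_mul hη0.le, inv_mul_cancel₀ hγ.ne', Real.rpow_one]
    refine ⟨min_le_left _ _, ?_⟩
    have h3 : η ≤ (1 - 2 ^ (1 - θ)) / (2 * (A + 1)) := min_le_right _ _
    rw [le_div_iff₀ (by positivity)] at h3
    nlinarith
  have hδγ : 0 ≤ δ ^ γ := Real.rpow_nonneg hδ0.le _
  refine ⟨δ, hδ0, fun a b ha hab hb hbδ hXYa => ?_⟩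
  set e : ℝ → ℝ → E := fun s t => remainder γ W f X [] s t - remainder γ W f Y [] s t with he
  -- The empty word is set to zero: its contribution `X s - Y s` belongs to the additive part of
  -- `e`, so the defect of `e` is minus that of the germ of `V`.
  set V : ℝ → Word d → E := fun s w =>
    if w = [] then 0 else wordField f w (X s) - wordField f w (Y s) with hV
  have heV : ∀ s t, 0 ≤ s → s ≤ t → t ≤ T → e s t =
      (X t - Y t) - (X s - Y s) - ∑ w ∈ words d (level γ), increment W s t w • V s w := by
    intro s t hs hst ht
    have h3 : ∑ w ∈ words d (level γ), increment W s t w • V s w =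
        ∑ w ∈ nonemptyWords d (level γ), increment W s t w • wordField f w (X s) -
        ∑ w ∈ nonemptyWords d (level γ), increment W s t w • wordField f w (Y s) := by
      rw [sum_words_eq, ← Finset.sum_sub_distrib]
      simp only [hV, if_true, smul_zero, zero_add]
      refine Finset.sum_congr rfl fun w hw => ?_
      rw [if_neg (Finset.mem_filter.1 hw).2, smul_sub]
    rw [h3]
    simp only [he]
    rw [← norm_sub_sub_sum_eq_remainder hW X ⟨hs, hst.trans ht⟩ ⟨hs.trans hst, ht⟩,
      ← norm_sub_sub_sum_eq_remainder hW Y ⟨hs, hst.trans ht⟩ ⟨hs.trans hst, ht⟩]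
    abel
  have hθpow : ∀ s t : ℝ, s ≤ t → (t - s) ^ θ = ((t - s) ^ γ) ^ (level γ + 1) := fun s t hst => by
    rw [hθdef, ← Nat.cast_succ, rpow_natCast_mul_eq (by linarith)]
  have hωδ : ∀ s t, a ≤ s → s ≤ t → t ≤ b → (t - s) ^ γ ≤ δ ^ γ := fun s t hs hst ht =>
    Real.rpow_le_rpow (by linarith) (by linarith) hγ.le
  have hXYe : ∀ t, a ≤ t → t ≤ b → X t - Y t = e a t := by
    intro t hat htb
    have hVa : ∀ w, V a w = 0 := fun w => by simp [hV, hXYa]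
    rw [heV a t ha hat (htb.trans hb), Finset.sum_eq_zero fun w _ => by rw [hVa, smul_zero],
      hXYa, sub_self, sub_zero, sub_zero]
  have hcontr : ∀ q, 0 ≤ q → (∀ s t, a ≤ s → s ≤ t → t ≤ b → ‖e s t‖ ≤ q * (t - s) ^ θ) →
      ∀ s t, a ≤ s → s ≤ t → t ≤ b →
        ‖e s t‖ ≤ (2 ^ (1 - θ) + A * δ ^ γ) * q * (t - s) ^ θ := by
    intro q hq hP s t hs hst ht
    have hdefect : ∀ s u t, a ≤ s → s ≤ u → u ≤ t → t ≤ b →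
        ‖e s t - e s u - e u t‖ ≤ A * δ ^ γ * q * (t - s) ^ θ := by
      intro s u t hs hsu hut ht
      have h3 := norm_germ_defect_le hγ hW hB0 (K := 2 * K * (q * δ ^ γ)) (by positivity)
        (ha.trans hs) hsu hut (ht.trans hb)
        (hBH u t (ha.trans (hs.trans hsu)) hut (ht.trans hb)).2 (Y := V) (fun r => by simp [hV])
        fun w hw => by
          have hne : w ≠ [] := (Finset.mem_filter.1 hw).2
          have hlen := mem_words.1 (Finset.mem_filter.1 hw).1
          have hlpos := List.length_pos_iff.2 hne
          have h4 : V u w - ∑ v ∈ words d (level γ - w.length), increment W s u v • V s (v ++ w) =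
              remainder γ W f X w s u - remainder γ W f Y w s u := by
            simp only [hV, hne, List.append_eq_nil_iff, and_false, if_false, remainder, smul_sub,
              Finset.sum_sub_distrib]
            abel
          rw [h4]
          refine (hK w hw s u (ha.trans hs) hsu ((hut.trans ht).trans hb)).trans ?_
          have hω0 : 0 ≤ (u - s) ^ γ := Real.rpow_nonneg (by linarith) _
          have hω := hωδ s u hs hsu (hut.trans ht)
          -- The paths agree at `a`, so their difference at `s` is `e a s`, and the assumed bound
          -- with constant `q` applies.
          have h5 : ‖X s - Y s‖ ≤ q * δ ^ γ := by
            rw [hXYe s hs ((hsu.trans hut).trans ht)]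
            refine (hP a s le_rfl hs ((hsu.trans hut).trans ht)).trans
              (mul_le_mul_of_nonneg_left ?_ hq)
            rw [hθpow a s hs]
            have hs0 : 0 ≤ (s - a) ^ γ := Real.rpow_nonneg (by linarith) _
            have hsδ := hωδ a s le_rfl hs ((hsu.trans hut).trans ht)
            exact (pow_le_of_le_one hs0 (hsδ.trans hδ1) (Nat.succ_ne_zero _)).trans hsδ
          have h6 : ‖remainder γ W f X [] s u - remainder γ W f Y [] s u‖ ≤
              q * δ ^ γ * ((u - s) ^ γ) ^ (level γ + 1 - w.length) := by
            refine (hP s u hs hsu (hut.trans ht)).trans ?_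
            rw [hθpow s u hsu, mul_assoc]
            -- The `|w| ≥ 1` surplus powers of `(u - s) ^ γ` yield one factor `δ ^ γ ≤ 1`.
            refine mul_le_mul_of_nonneg_left ?_ hq
            refine (pow_le_mul_pow hω0 hω
              (by omega : level γ + 1 - w.length ≤ level γ + 1)).trans
              (mul_le_mul_of_nonneg_right ?_ (pow_nonneg hω0 _))
            exact pow_le_of_le_one hδγ hδ1 (by omega)
          have h7 := mul_le_mul_of_nonneg_left h5
            (pow_nonneg hω0 (level γ + 1 - w.length))
          calc _ ≤ K * (((u - s) ^ γ) ^ (level γ + 1 - w.length) * (q * δ ^ γ) +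
                q * δ ^ γ * ((u - s) ^ γ) ^ (level γ + 1 - w.length)) :=
                mul_le_mul_of_nonneg_left (add_le_add h7 h6) hK0
            _ = _ := by ring
      rw [heV s t (ha.trans hs) (hsu.trans hut) (ht.trans hb),
        heV s u (ha.trans hs) hsu (hut.trans (ht.trans hb)),
        heV u t (ha.trans (hs.trans hsu)) hut (ht.trans hb), ← norm_neg]
      refine (le_of_eq (congrArg _ ?_)).trans (h3.trans (le_of_eq ?_))
      · abel
      · rw [hA]; ring
    have := norm_le_of_almost_additive hdefect hP hs hst ht
    rwa [← add_mul] at this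
  have hinit : ∀ s t, a ≤ s → s ≤ t → t ≤ b → ‖e s t‖ ≤ (DX + DY) * (t - s) ^ θ := by
    intro s t hs hst ht
    rw [hθpow s t hst, add_mul]
    exact (norm_sub_le _ _).trans (add_le_add (hDX s t (ha.trans hs) hst (ht.trans hb))
      (hDY s t (ha.trans hs) hst (ht.trans hb)))
  rw [← sub_eq_zero, hXYe b hab le_rfl, ← norm_le_zero_iff]
  have hL0 : 0 ≤ (b - a) ^ θ := Real.rpow_nonneg (by linarith) _
  refine le_of_forall_pos_le_add fun ε hε => ?_
  obtain ⟨q, hq, hP⟩ := exists_le_of_contraction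
    (P := fun q => ∀ s t, a ≤ s → s ≤ t → t ≤ b → ‖e s t‖ ≤ q * (t - s) ^ θ)
    (by positivity) hδ (add_nonneg hDX0 hDY0) hinit hcontr
    (ε := ε / ((b - a) ^ θ + 1)) (by positivity)
  rw [lt_div_iff₀ (by positivity)] at hq
  have h8 := hP a b le_rfl hab le_rfl
  rcases le_or_gt 0 q with h0 | h0
  · nlinarith
  · nlinarith [mul_nonpos_of_nonpos_of_nonneg h0.le hL0]

/-- Paths with the expansion along vector fields of class `C^{N_γ+1}` are determined by their
initial value. -/
theorem eq_of_hasDavieExpansion (hγ : 0 < γ) (hW : IsGeometricRoughPath T γ W)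
    (hf : ∀ i, ContDiff ℝ (level γ + 1 : ℕ) (f i)) {X Y : ℝ → E}
    (hX : HasDavieExpansion T γ W f X) (hY : HasDavieExpansion T γ W f Y) (h0 : X 0 = Y 0)
    {t : ℝ} (ht : t ∈ Set.Icc 0 T) : X t = Y t := by
  obtain ⟨δ, hδ0, hδ⟩ := exists_delta_eq_of_hasDavieExpansion hγ hW hf hX hY
  -- Since `δ` does not depend on the starting point, finitely many steps of length `δ` cover
  -- `[0,T]`.
  have key : ∀ n : ℕ, ∀ t, 0 ≤ t → t ≤ T → t ≤ n * δ → X t = Y t := by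
    intro n
    induction n with
    | zero =>
      intro t ht0 _ htn
      rw [Nat.cast_zero, zero_mul] at htn
      rwa [le_antisymm htn ht0]
    | succ n ih =>
      intro t ht0 htT htn
      push_cast at htn
      rcases le_or_gt t (n * δ) with h | h
      · exact ih t ht0 htT h
      · have hn : 0 ≤ (n : ℝ) * δ := by positivity
        exact hδ (n * δ) t hn h.le htT (by linarith) (ih _ hn (h.le.trans htT) le_rfl)
  obtain ⟨n, hn⟩ := exists_nat_ge (t / δ)
  exact key n t ht.1 ht.2 (by rwa [div_le_iff₀ hδ0] at hn)

/-- The lifted solutions are the lifts with coefficients `F_w(X)` of the paths with the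
expansion. -/
theorem isRDELift_iff (hT : 0 ≤ T) (hγ : 0 < γ) (hγ' : γ ≤ 1) (hW : IsGeometricRoughPath T γ W)
    (hf : ∀ i, ContDiff ℝ (level γ) (f i)) (x : E) {M : ℕ}
    (hM : M = level γ ∨ M = level γ + 1) (Z : ℝ → Word d → E) :
    IsRDELift T γ W f M x Z ↔ Z 0 [] = x ∧ HasDavieExpansion T γ W f (fun t => Z t []) ∧
      ∀ t ∈ Set.Icc 0 T, ∀ w : Word d, w.length < M → Z t w = wordField f w (Z t []) := by
  have hN := one_le_level hγ hγ'
  constructor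
  · intro h
    exact ⟨h.initial hT (by omega), h.hasDavieExpansion hT hγ hγ' hW hM hf,
      fun t ht w hw => h.coeff_eq (by omega) hf ht w hw⟩
  · rintro ⟨rfl, h1, h2⟩
    exact isRDELift_of_hasDavieExpansion hT hγ hγ' hW hM hf h1 h2

theorem isRDESolution_iff (hT : 0 ≤ T) (hγ : 0 < γ) (hγ' : γ ≤ 1)
    (hW : IsGeometricRoughPath T γ W) (hf : ∀ i, ContDiff ℝ (level γ) (f i)) (x : E)
    (X : ℝ → E) : IsRDESolution T γ W f x X ↔ X 0 = x ∧ HasDavieExpansion T γ W f X := by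
  constructor
  · rintro ⟨Z, hZX, hZ⟩
    obtain ⟨h0, h1, -⟩ := (isRDELift_iff hT hγ hγ' hW hf x (Or.inl rfl) Z).1 hZ
    exact ⟨hZX 0 ⟨le_rfl, hT⟩ ▸ h0, h1.congr hZX⟩
  · rintro ⟨h0, h1⟩
    exact ⟨fun t w => wordField f w (X t), fun t _ => rfl,
      (isRDELift_iff hT hγ hγ' hW hf x (Or.inl rfl) _).2 ⟨h0, h1, fun t _ w _ => rfl⟩⟩

end Uniqueness

end RoughPath

theorem mainTheorem8 {d n : ℕ} (T γ : ℝ) (hT : 0 < T) (hγ : 0 < γ) (hγ' : γ ≤ 1)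
    (W : ℝ → RoughPath.Word d → ℝ) (hW : RoughPath.IsGeometricRoughPath T γ W)
    (f : Fin d → EuclideanSpace ℝ (Fin n) → EuclideanSpace ℝ (Fin n))
    (hf : ∀ i, ContDiff ℝ (RoughPath.level γ) (f i))
    (x : EuclideanSpace ℝ (Fin n)) :
    -- solutions are characterized by the expansion
    (∀ X : ℝ → EuclideanSpace ℝ (Fin n),
      RoughPath.IsRDESolution T γ W f x X ↔
        X 0 = x ∧ RoughPath.HasDavieExpansion T γ W f X) ∧
    -- the lifts that solve the equation, with values in level `N_γ - 1` or in level `N_γ`,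
    -- are exactly those with coefficients `F_w(X_t)` above a path with the expansion
    (∀ M : ℕ, M = RoughPath.level γ ∨ M = RoughPath.level γ + 1 →
      ∀ Z : ℝ → RoughPath.Word d → EuclideanSpace ℝ (Fin n),
        RoughPath.IsRDELift T γ W f M x Z ↔
          Z 0 [] = x ∧ RoughPath.HasDavieExpansion T γ W f (fun t => Z t []) ∧
          ∀ t ∈ Set.Icc 0 T, ∀ w : RoughPath.Word d, w.length < M →
            Z t w = RoughPath.wordField f w (Z t [])) ∧
    -- for vector fields of class `C^{N_γ+1}_b` the solution is moreover unique
    ((∀ i, RoughPath.IsCkBounded (RoughPath.level γ + 1) (f i)) →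
      ∀ X : ℝ → EuclideanSpace ℝ (Fin n),
        (RoughPath.IsRDESolution T γ W f x X ∧
          ∀ Y : ℝ → EuclideanSpace ℝ (Fin n), RoughPath.IsRDESolution T γ W f x Y →
            ∀ t ∈ Set.Icc 0 T, Y t = X t) ↔
          X 0 = x ∧ RoughPath.HasDavieExpansion T γ W f X) := by
  have hsol := RoughPath.isRDESolution_iff hT.le hγ hγ' hW hf x
  refine ⟨hsol, fun M hM Z => RoughPath.isRDELift_iff hT.le hγ hγ' hW hf x hM Z,
    fun hfb X => ⟨fun h => (hsol X).1 h.1, fun h => ⟨(hsol X).2 h, fun Y hY t ht => ?_⟩⟩⟩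
  obtain ⟨hY0, hYexp⟩ := (hsol Y).1 hY
  exact RoughPath.eq_of_hasDavieExpansion hγ hW (fun i => (hfb i).1) hYexp h.2
    (hY0.trans h.1.symm) ht
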